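/- **Setting.** Let $M$ be the torus $\mathbb T^2=\mathbb R^2/\mathbb Z^2$, the annulus $\mathbb S^1\times[0,1]$ or the closed unit disk, with normalized Lebesgue measure $\lambda$, coordinates $(\theta,r)\in[0,1)\times[0,1)$ (defined up to null sets, with $\lambda=d\theta\,dr$; on the disk $(\theta,r)$ is the point $\sqrt r\,e^{2\pi i\theta}$) and circle action $R_t(\theta,r)=(\theta+t,r)$. Write $\Delta^{i,j}_{a,b}=[\frac ia,\frac{i+1}a)\times[\frac jb,\frac{j+1}b)$. Let $\mathrm{Diff}^\infty(M,\lambda)$ be the set of area-preserving $C^\infty$ diffeomorphisms of $M$. Let $d_k(f,g)$ be the maximum of the uniform distances between $f$ and $g$, between $f^{-1}$ and $g^{-1}$, and between their derivatives of orders $1,\dots,k$ (computed in the universal cover), and let $d_\infty(f,g)=\sum_{k\ge1}\frac{d_k(f,g)}{2^k(1+d_k(f,g))}$. **Twisted abstract AbC transformations.** Let $\alpha_0\in\mathbb Q$ have denominator $q_0$ (in lowest terms), and let $(C_n),(l_n),(s_n)$, $n\ge0$, be sequences of positive integers with $s_n^2\mid C_n$ and $\sum_n 1/l_n<\infty$.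 Put $$k_n=2^{n+2}q_nC_n,\qquad q_{n+1}=k_nl_nq_n^2,\qquad \alpha_{n+1}=\alpha_n+\frac1{k_nl_nq_n^2}.$$ Let $h_{n+1}=h_{n+1,2}\circ h_{n+1,1}$, where both maps permute the rectangles $\Delta^{i,j}_{k_nq_n,s_{n+1}}$ by translations, as follows. For $i=i_1k_n+i_2C_n+i_3$ with $0\le i_1<q_n$, $0\le i_2<2^{n+2}q_n$, $0\le i_3<C_n$, the map $h_{n+1,1}$ sends $\Delta^{i,j}_{k_nq_n,s_{n+1}}$ to $\Delta^{i',j}_{k_nq_n,s_{n+1}}$ with $i'=((i_1+a_n(i_2))\bmod q_n)\,k_n+i_2C_n+i_3$, where for $i_2<2^{n+1}q_n$ one has $a_n(i_2)=0$ if $i_2$ is even and $a_n(i_2)=\frac{i_2+1}2$ if $i_2$ is odd, and for $i_2\ge2^{n+1}q_n$ one has $a_n(i_2)=\frac{i_2}2+1$ if $i_2$ is even and $a_n(i_2)=1$ if $i_2$ is odd. The map $h_{n+1,2}$ commutes with $R_{1/q_n}$ and permutes the rectangles in $[0,\frac1{q_n})\times[0,1)$. For $0\le i<k_n$, $0\le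 j<s_{n+1}$ let $b_n(i,j)\in\{0,\dots,s_n-1\}$ be the number with $h_{n+1,2}(\Delta^{i,j}_{k_nq_n,s_{n+1}})\subseteq\Delta^{0,b_n(i,j)}_{q_n,s_n}$. Assume for all $n$: - **(R1)** $s_n\mid s_{n+1}$, and $s_n\to\infty$; - **(R2)** for all $0\le j<s_{n+1}$ and $0\le t<s_n$, exactly $k_n/s_n$ of the indices $0\le i<k_n$ satisfy $b_n(i,j)=t$; - **(R3)** the map $j\mapsto(b_n(i,j))_{0\le i<k_n}$ is one-to-one. Put $H_n=h_1\circ\dots\circ h_n$ and $T_n=H_n\circ R_{\alpha_n}\circ H_n^{-1}$, and let $T:M\to M$ be the invertible measure-preserving transformation that is the limit of $(T_n)$ in the weak topology, i.e. $\lambda(T_n(A)\,\triangle\,T(A))\to0$ for every measurable $A$. **Proposition.** Let $M$ be one of the three surfaces. There are functions $$l_n^*=l_n^*\big((k_m)_{m\le n},(l_m)_{m<n},(s_m)_{m\le n+1},(\varepsilon_m)_{m\le n}\big)\in\mathbb N,\qquad n\ge 0,$$ such that the following holds. Let $(\varepsilon_n)_{n\ge0}$ be a summable sequence of positive reals with $\sum_{m>n}\varepsilon_m<\frac{\varepsilon_n}4$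 for all $n$, and let $T:M\to M$ be a transformation as above whose parameters satisfy $l_n\ge l_n^*$ for all $n$. Then there are diffeomorphisms $h_{n+1}^{(s)}\in\mathrm{Diff}^\infty(M,\lambda)$ commuting with $R_{1/q_n}$ such that the smooth AbC diffeomorphisms $$T_n^{(s)}=H_n^{(s)}\circ R_{\alpha_n}\circ(H_n^{(s)})^{-1},\qquad H_n^{(s)}=h_1^{(s)}\circ\dots\circ h_n^{(s)},$$ satisfy $$d_\infty\big(T_n^{(s)},T_{n+1}^{(s)}\big)<\frac{\varepsilon_n}4\qquad\text{for all }n\ge0$$ and converge with respect to $d_\infty$ to a diffeomorphism $T^{(s)}\in\mathrm{Diff}^\infty(M,\lambda)$ that is measure-theoretically isomorphic to $T$. -/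

import Mathlib

open MeasureTheory Filter Topology
open scoped ContDiff

noncomputable section

/-! ### The three surfaces -/

/-- The surfaces under consideration: the torus `𝕋² = ℝ²/ℤ²`, the annulus `𝔸 = 𝕊¹ × [0,1]` and the
closed unit disk `𝔻`. -/
inductive Surface : Type
  | torus
  | annulus
  | disk

namespace Surface

/-- The universal cover of the surface, as a subset of the plane: the plane for the torus, the strip
`ℝ × [0,1]` for the annulus, the disk itself for the disk. -/
def cover : Surface → Set (ℝ × ℝ)
  | torus => Set.univ
  | annulus => {x | x.2 ∈ Set.Icc (0 : ℝ) 1}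
  | disk => {x | x.1 ^ 2 + x.2 ^ 2 ≤ 1}

/-- The points of the surface. -/
def Pt : Surface → Type
  | torus => UnitAddCircle × UnitAddCircle
  | annulus => UnitAddCircle × Set.Icc (0 : ℝ) 1
  | disk => {x : ℝ × ℝ // x.1 ^ 2 + x.2 ^ 2 ≤ 1}

instance instMetricSpacePt : (M : Surface) → MetricSpace M.Pt
  | torus => inferInstanceAs (MetricSpace (UnitAddCircle × UnitAddCircle))
  | annulus => inferInstanceAs (MetricSpace (UnitAddCircle × Set.Icc (0 : ℝ) 1))
  | disk => inferInstanceAs (MetricSpace {x : ℝ × ℝ // x.1 ^ 2 + x.2 ^ 2 ≤ 1})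

instance instMeasurableSpacePt : (M : Surface) → MeasurableSpace M.Pt
  | torus => inferInstanceAs (MeasurableSpace (UnitAddCircle × UnitAddCircle))
  | annulus => inferInstanceAs (MeasurableSpace (UnitAddCircle × Set.Icc (0 : ℝ) 1))
  | disk => inferInstanceAs (MeasurableSpace {x : ℝ × ℝ // x.1 ^ 2 + x.2 ^ 2 ≤ 1})

/-- Lebesgue measure `λ` on the surface, normalized to total mass one. -/
def vol : (M : Surface) → Measure M.Pt
  | torus => (volume : Measure (UnitAddCircle × UnitAddCircle))
  | annulus => (volume : Measure (UnitAddCircle × Set.Icc (0 : ℝ) 1))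
  | disk =>
    (volume {x : ℝ × ℝ | x.1 ^ 2 + x.2 ^ 2 ≤ 1})⁻¹ •
      Measure.comap (Subtype.val : {x : ℝ × ℝ // x.1 ^ 2 + x.2 ^ 2 ≤ 1} → ℝ × ℝ) volume

/-- The covering projection. -/
def proj : (M : Surface) → M.cover → M.Pt
  | torus => fun x => (((x : ℝ × ℝ).1 : UnitAddCircle), ((x : ℝ × ℝ).2 : UnitAddCircle))
  | annulus => fun x => (((x : ℝ × ℝ).1 : UnitAddCircle), ⟨(x : ℝ × ℝ).2, x.2⟩)
  | disk => fun x => ⟨(x : ℝ × ℝ), x.2⟩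

/-- Rotation of the plane about the origin by the angle `2πt`. -/
def planeRot (t : ℝ) (x : ℝ × ℝ) : ℝ × ℝ :=
  (Real.cos (2 * Real.pi * t) * x.1 - Real.sin (2 * Real.pi * t) * x.2,
    Real.sin (2 * Real.pi * t) * x.1 + Real.cos (2 * Real.pi * t) * x.2)

theorem planeRot_normSq (t : ℝ) (x : ℝ × ℝ) :
    (planeRot t x).1 ^ 2 + (planeRot t x).2 ^ 2 = x.1 ^ 2 + x.2 ^ 2 := by
  simp only [planeRot]
  linear_combination (x.1 ^ 2 + x.2 ^ 2) * Real.sin_sq_add_cos_sq (2 * Real.pi * t)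

theorem planeRot_neg (t : ℝ) (x : ℝ × ℝ) : planeRot (-t) (planeRot t x) = x := by
  have h := Real.sin_sq_add_cos_sq (2 * Real.pi * t)
  have h1 : 2 * Real.pi * -t = -(2 * Real.pi * t) := by ring
  ext
  · simp only [planeRot, h1, Real.cos_neg, Real.sin_neg]
    linear_combination x.1 * h
  · simp only [planeRot, h1, Real.cos_neg, Real.sin_neg]
    linear_combination x.2 * h

/-- The circle action `R_t(θ, r) = (θ + t, r)`. -/
def rot : (M : Surface) → ℝ → Equiv.Perm M.Pt
  | torus => fun t =>
    Equiv.prodCongr (Equiv.addRight (t : UnitAddCircle)) (Equiv.refl UnitAddCircle)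
  | annulus => fun t =>
    Equiv.prodCongr (Equiv.addRight (t : UnitAddCircle)) (Equiv.refl (Set.Icc (0 : ℝ) 1))
  | disk => fun t =>
    { toFun := fun x => ⟨planeRot t x.1, by rw [planeRot_normSq]; exact x.2⟩
      invFun := fun x => ⟨planeRot (-t) x.1, by rw [planeRot_normSq]; exact x.2⟩
      left_inv := fun x => Subtype.ext (planeRot_neg t x.1)
      right_inv := fun x => Subtype.ext (by simpa using planeRot_neg (-t) x.1) }

/-- `F` is a smooth lift of `f` to the universal cover; smoothness holds up to the boundary. -/
def IsSmoothLift (M : Surface) (F : ℝ × ℝ → ℝ × ℝ) (f : M.Pt → M.Pt) : Prop :=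
  ContDiffOn ℝ ∞ F M.cover ∧
    ∀ x : M.cover, ∃ h : F x ∈ M.cover, f (M.proj x) = M.proj ⟨F x, h⟩

/-- A self-map of the surface is smooth if it has a smooth lift (the cover is simply connected). -/
def IsSmooth (M : Surface) (f : M.Pt → M.Pt) : Prop :=
  ∃ F, M.IsSmoothLift F f

/-- Membership in `Diff^∞(M, λ)`: area-preserving `C^∞` diffeomorphisms. -/
structure IsAreaDiffeo (M : Surface) (f : Equiv.Perm M.Pt) : Prop where
  smooth : M.IsSmooth f
  smooth_symm : M.IsSmooth f.symm
  measurePreserving : MeasurePreserving f M.vol M.vol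

/-- `C` bounds the distance of `f` and `g` and of all derivatives of orders `1, …, k` of their lifts.
(Smooth lifts of a map differ by constants, so the derivatives do not depend on the lift.) -/
def IsCkBound (M : Surface) (k : ℕ) (f g : M.Pt → M.Pt) (C : ℝ) : Prop :=
  (∀ p, dist (f p) (g p) ≤ C) ∧
    ∃ F G, M.IsSmoothLift F f ∧ M.IsSmoothLift G g ∧
      ∀ j, 1 ≤ j → j ≤ k → ∀ x ∈ M.cover,
        ‖iteratedFDerivWithin ℝ j F M.cover x - iteratedFDerivWithin ℝ j G M.cover x‖ ≤ C

/-- The distance `d_k` of two diffeomorphisms: the least common `C^k` bound for the maps and for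
their inverses. -/
def dC (M : Surface) (k : ℕ) (f g : Equiv.Perm M.Pt) : ℝ :=
  sInf {C : ℝ | 0 ≤ C ∧ M.IsCkBound k f g C ∧ M.IsCkBound k f.symm g.symm C}

/-- `d_∞(f, g) = ∑_{k ≥ 1} d_k(f, g) / (2^k (1 + d_k(f, g)))`. -/
def dInf (M : Surface) (f g : Equiv.Perm M.Pt) : ℝ :=
  ∑' k : ℕ, M.dC (k + 1) f g / (2 ^ (k + 1) * (1 + M.dC (k + 1) f g))

end Surface

/-! ### Coordinates and partition permutations -/

/-- The coordinate square `[0,1) × [0,1)` of the coordinates `(θ, r)`. -/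
abbrev Sq : Type := Set.Ico (0 : ℝ) 1 × Set.Ico (0 : ℝ) 1

/-- The parametrization of a surface, up to null sets, by the coordinates `(θ, r)`. On the disk,
`(θ, r)` stands for the point `√r e^{2πiθ}`, so that `λ` is `dθ dr` in coordinates. -/
def Surface.param : (M : Surface) → Sq → M.Pt
  | .torus => fun x => (((x.1 : ℝ) : UnitAddCircle), ((x.2 : ℝ) : UnitAddCircle))
  | .annulus => fun x => (((x.1 : ℝ) : UnitAddCircle), ⟨(x.2 : ℝ), x.2.2.1, x.2.2.2.le⟩)
  | .disk => fun x =>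
    ⟨Surface.planeRot x.1 (Real.sqrt x.2, 0), by
      rw [Surface.planeRot_normSq]
      have h := x.2.2
      simp only [Real.sq_sqrt h.1]
      linarith [h.2]⟩

/-- Splits `[0,1)` into `r` intervals of equal length: `x = (i + t) / r` corresponds to `(i, t)`. -/
def splitIco (r : ℕ+) : Set.Ico (0 : ℝ) 1 ≃ Fin r × Set.Ico (0 : ℝ) 1 where
  toFun x :=
    (⟨⌊(r : ℝ) * x⌋₊, by
        have hr : (0 : ℝ) < r := by exact_mod_cast r.pos
        rw [Nat.floor_lt (mul_nonneg hr.le x.2.1)]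
        nlinarith [x.2.2]⟩,
      ⟨Int.fract ((r : ℝ) * x), Int.fract_nonneg _, Int.fract_lt_one _⟩)
  invFun y :=
    ⟨((y.1 : ℕ) + (y.2 : ℝ)) / (r : ℝ), by
      have hr : (0 : ℝ) < r := by exact_mod_cast r.pos
      have h1 : ((y.1 : ℕ) : ℝ) + 1 ≤ r := by exact_mod_cast y.1.2
      have h2 := y.2.2
      refine ⟨div_nonneg (add_nonneg (Nat.cast_nonneg _) h2.1) hr.le, ?_⟩
      rw [div_lt_one hr]
      linarith [h2.2]⟩
  left_inv x := by
    have hr : (0 : ℝ) < r := by exact_mod_cast r.pos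
    ext
    simp only
    rw [natCast_floor_eq_intCast_floor (mul_nonneg hr.le x.2.1), Int.floor_add_fract]
    field_simp
  right_inv y := by
    have hr : (r : ℝ) ≠ 0 := by exact_mod_cast r.pos.ne'
    have h2 := y.2.2
    have e : (r : ℝ) * ((((y.1 : ℕ) : ℝ) + (y.2 : ℝ)) / (r : ℝ)) = (y.2 : ℝ) + ((y.1 : ℕ) : ℝ) := by
      field_simp
      ring
    ext
    · simp only [e]
      rw [Nat.floor_add_natCast h2.1, Nat.floor_eq_zero.2 h2.2, zero_add]
    · simp only [e]
      rw [Int.fract_add_natCast, Int.fract_eq_self.2 h2]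

/-- The cell of a point of the square in the partition into rectangles
`Δ^{i,j} = [i/(kq), (i+1)/(kq)) × [j/s, (j+1)/s)`, with the position inside the cell. The column index
`i = i₁ k + i'` is recorded as the pair `(i₁, i')` with `i₁ < q`, `i' < k`. -/
def cellEquiv (q k s : ℕ+) : Sq ≃ ((Fin q × Fin k) × Fin s) × Sq where
  toFun x :=
    let a := splitIco q x.1
    let b := splitIco k a.2
    let c := splitIco s x.2
    (((a.1, b.1), c.1), (b.2, c.2))
  invFun y :=
    ((splitIco q).symm (y.1.1.1, (splitIco k).symm (y.1.1.2, y.2.1)),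
      (splitIco s).symm (y.1.2, y.2.2))
  left_inv x := by simp
  right_inv y := by simp

/-- The partition permutation of the square that moves each cell by the translation to the cell
prescribed by a permutation of the indices. -/
def cellPerm (q k s : ℕ+) (π : Equiv.Perm ((Fin q × Fin k) × Fin s)) : Equiv.Perm Sq :=
  (cellEquiv q k s).trans ((Equiv.prodCongr π (Equiv.refl Sq)).trans (cellEquiv q k s).symm)

/-- Rotation of `[0,1)` by `t` modulo `1`. -/
def rotIco (t : ℝ) : Equiv.Perm (Set.Ico (0 : ℝ) 1) where
  toFun x := ⟨Int.fract ((x : ℝ) + t), Int.fract_nonneg _, Int.fract_lt_one _⟩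
  invFun x := ⟨Int.fract ((x : ℝ) - t), Int.fract_nonneg _, Int.fract_lt_one _⟩
  left_inv x := by
    ext
    have e : Int.fract ((x : ℝ) + t) - t = (x : ℝ) - (⌊(x : ℝ) + t⌋ : ℤ) := by
      rw [Int.fract]; ring
    simp only [e]
    rw [Int.fract_sub_intCast, Int.fract_eq_self.2 x.2]
  right_inv x := by
    ext
    have e : Int.fract ((x : ℝ) - t) + t = (x : ℝ) - (⌊(x : ℝ) - t⌋ : ℤ) := by
      rw [Int.fract]; ring
    simp only [e]
    rw [Int.fract_sub_intCast, Int.fract_eq_self.2 x.2]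

/-- `R_t(θ, r) = (θ + t, r)` in coordinates. -/
def sqRot (t : ℝ) : Equiv.Perm Sq :=
  Equiv.prodCongr (rotIco t) (Equiv.refl _)

/-! ### Twisted abstract AbC constructions -/

/-- Numerical parameters of a twisted AbC construction. -/
structure AbCParams where
  α₀ : ℚ
  C : ℕ → ℕ+
  l : ℕ → ℕ+
  s : ℕ → ℕ+

namespace AbCParams

variable (P : AbCParams)

/-- `q_0` is the denominator of `α_0` and `q_{n+1} = k_n l_n q_n²` with `k_n = 2^{n+2} q_n C_n`. -/
def q : ℕ → ℕ+
  | 0 => ⟨P.α₀.den, P.α₀.den_pos⟩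
  | n + 1 => (2 ^ (n + 2) * q n * P.C n) * P.l n * q n ^ 2

/-- `k_n = 2^{n+2} q_n C_n`. -/
def k (n : ℕ) : ℕ+ := 2 ^ (n + 2) * P.q n * P.C n

/-- `α_{n+1} = α_n + 1 / (k_n l_n q_n²)`. -/
def α : ℕ → ℚ
  | 0 => P.α₀
  | n + 1 => α n + 1 / ((P.k n : ℚ) * (P.l n : ℚ) * (P.q n : ℚ) ^ 2)

/-- The numbers `a_n(i₂)` for `0 ≤ i₂ < 2^{n+2} q_n`, before reduction modulo `q_n`. -/
def a (n i₂ : ℕ) : ℕ :=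
  if i₂ < 2 ^ (n + 1) * (P.q n : ℕ) then
    if Even i₂ then 0 else (i₂ + 1) / 2
  else
    if Even i₂ then i₂ / 2 + 1 else 1

/-- Action of `h_{n+1,1}` on cells: column `i₁ k_n + i₂ C_n + i₃` is sent to column
`((i₁ + a_n(i₂)) mod q_n) k_n + i₂ C_n + i₃`. Here `i' = i₂ C_n + i₃`. -/
def twistIndex (n : ℕ) :
    Equiv.Perm ((Fin (P.q n) × Fin (P.k n)) × Fin (P.s (n + 1))) where
  toFun x := ((x.1.1 + Fin.ofNat (P.q n) (P.a n ((x.1.2 : ℕ) / (P.C n : ℕ))), x.1.2), x.2)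
  invFun x := ((x.1.1 - Fin.ofNat (P.q n) (P.a n ((x.1.2 : ℕ) / (P.C n : ℕ))), x.1.2), x.2)
  left_inv x := by simp
  right_inv x := by simp

/-- Extension of a permutation of the cells of the fundamental domain `[0, 1/q_n) × [0,1)` to all
cells, commuting with `R_{1/q_n}`. -/
def untwistedIndex (n : ℕ) (σ : Equiv.Perm (Fin (P.k n) × Fin (P.s (n + 1)))) :
    Equiv.Perm ((Fin (P.q n) × Fin (P.k n)) × Fin (P.s (n + 1))) :=
  (Equiv.prodAssoc _ _ _).trans
    ((Equiv.prodCongr (Equiv.refl _) σ).trans (Equiv.prodAssoc _ _ _).symm)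

/-- The number `b_n(i, j)` such that the cell of column `i < k_n` and row `j < s_{n+1}` is mapped into
`[0, 1/q_n) × [b/s_n, (b+1)/s_n)` (when `s_n` divides `s_{n+1}`). -/
def b (n : ℕ) (σ : Equiv.Perm (Fin (P.k n) × Fin (P.s (n + 1))))
    (i : Fin (P.k n)) (j : Fin (P.s (n + 1))) : ℕ :=
  ((σ (i, j)).2 : ℕ) / ((P.s (n + 1) : ℕ) / (P.s n : ℕ))

end AbCParams

/-- The data of a twisted abstract AbC construction with its uniformity requirements. -/
structure TwistedAbC extends AbCParams where
  /-- The permutation of the cells of the fundamental domain that defines `h_{n+1,2}`. -/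
  σ : ∀ n, Equiv.Perm (Fin (toAbCParams.k n) × Fin (toAbCParams.s (n + 1)))
  C_dvd : ∀ n, (s n : ℕ) ^ 2 ∣ (C n : ℕ)
  l_summable : Summable fun n => 1 / (l n : ℝ)
  s_dvd : ∀ n, (s n : ℕ) ∣ (s (n + 1) : ℕ)
  s_tendsto : Tendsto (fun n => (s n : ℕ)) atTop atTop
  /-- In every row, each symbol `t < s_n` occurs `k_n / s_n` times. -/
  uniform : ∀ n (j : Fin (s (n + 1))) (t : ℕ), t < s n →
    (Finset.univ.filter fun i => toAbCParams.b n (σ n) i j = t).card =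
      (toAbCParams.k n : ℕ) / (s n : ℕ)
  /-- Different rows have different sequences of symbols. -/
  rows_injective : ∀ n, Function.Injective fun j i => toAbCParams.b n (σ n) i j

namespace TwistedAbC

variable (P : TwistedAbC)

/-- `h n` is the conjugation map `h_{n+1} = h_{n+1,2} ∘ h_{n+1,1}`. -/
def h (n : ℕ) : Equiv.Perm Sq :=
  cellPerm (P.q n) (P.k n) (P.s (n + 1)) (P.untwistedIndex n (P.σ n)) *
    cellPerm (P.q n) (P.k n) (P.s (n + 1)) (P.twistIndex n)

/-- `H_0 = id`, `H_{n+1} = H_n ∘ h_{n+1}`. -/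
def H : ℕ → Equiv.Perm Sq
  | 0 => 1
  | n + 1 => H n * P.h n

/-- `T_n = H_n ∘ R_{α_n} ∘ H_n⁻¹`. -/
def T (n : ℕ) : Equiv.Perm Sq :=
  P.H n * sqRot (P.α n) * (P.H n)⁻¹

/-- `S : M → M` is the limit in the weak topology of the transformations `T_n`, transported to the
surface by the coordinates: `λ(T_n(A) Δ S(A)) → 0` for all measurable `A`. -/
def IsWeakLimit (M : Surface) (S : M.Pt → M.Pt) : Prop :=
  ∀ A : Set Sq, MeasurableSet A →
    Tendsto (fun n => M.vol (symmDiff (M.param '' (P.T n '' A)) (S '' (M.param '' A))))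
      atTop (𝓝 0)

end TwistedAbC

/-! ### Smooth AbC diffeomorphisms and isomorphism -/

/-- `H_0 = id`, `H_{n+1} = H_n ∘ h_{n+1}` on the surface; `hs n` is `h_{n+1}`. -/
def smoothH {M : Surface} (hs : ℕ → Equiv.Perm M.Pt) : ℕ → Equiv.Perm M.Pt
  | 0 => 1
  | n + 1 => smoothH hs n * hs n

/-- `Ts` is a sequence of smooth AbC diffeomorphisms with the parameters `α_n = p_n/q_n`:
`Ts n = H_n ∘ R_{α_n} ∘ H_n⁻¹` with `H_n = h_1 ∘ ⋯ ∘ h_n`, where `h_{n+1}` is an area-preserving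
`C^∞` diffeomorphism that commutes with `R_{1/q_n}`. -/
def IsSmoothAbC (P : AbCParams) (M : Surface) (Ts : ℕ → Equiv.Perm M.Pt) : Prop :=
  ∃ hs : ℕ → Equiv.Perm M.Pt,
    (∀ n, M.IsAreaDiffeo (hs n)) ∧
    (∀ n, hs n * M.rot (1 / (P.q n : ℝ)) = M.rot (1 / (P.q n : ℝ)) * hs n) ∧
    ∀ n, Ts n = smoothH hs n * M.rot (P.α n) * (smoothH hs n)⁻¹

/-- Measure-theoretic isomorphism of `(X, μ, S)` and `(Y, ν, T)`: an almost everywhere invertible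
measure-preserving map, with measure-preserving inverse, that intertwines `S` and `T`. -/
def MeasureIsomorphic {X Y : Type*} [MeasurableSpace X] [MeasurableSpace Y]
    (μ : Measure X) (S : X → X) (ν : Measure Y) (T : Y → Y) : Prop :=
  ∃ (φ : X → Y) (ψ : Y → X), MeasurePreserving φ μ ν ∧ MeasurePreserving ψ ν μ ∧
    (∀ᵐ x ∂μ, ψ (φ x) = x) ∧ (∀ᵐ y ∂ν, φ (ψ y) = y) ∧ ∀ᵐ x ∂μ, φ (S x) = T (φ x)

end

open scoped ENNReal

/-! ### Area-preserving diffeomorphisms of the plane -/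

/-! The proof replaces each abstract map `P.h n` by an area-preserving diffeomorphism of the strip
that commutes with `R_{1/q_n}`, is the identity near the boundary, and agrees with `P.h n` off a set
of measure less than `2⁻ⁿ`.

Approximation. The permutations of the square that can be approximated in this way form a group
(`approxGroup`), so generators suffice. The half-turn of a rectangle belongs to it: a map of
constant Jacobian turns the square into a disk, where one rotates by an angle that is `π` except
near the boundary (`exists_squareHalfTurn`). Three half-turns exchange two adjacent rectangles, and
such exchanges generate all permutations of the cells in a fundamental domain of `R_{1/q}`. To move
a column into another fundamental domain one uses the rotation by a single column width, which is a
limit of cut-off shears and differs from the shift of one column by a permutation inside the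
fundamental domains. This gives `TwistedAbC.h_mem_approxGroup`. The coordinates `(θ, r)` carry these
diffeomorphisms to each surface; on the disk, polar coordinates with `√r` have constant Jacobian,
and being the identity near `r = 0` gives smoothness at the centre.

Convergence. The angle `α_n` is a multiple of `1/q_n`, so the factor added in passing from `H_n` to
`H_{n+1}` commutes with `R_{α_n}` (`TwistedAbC.liftT_eq`). Hence `T_n` and `T_{n+1}` are conjugates,
by the same map, of rotations whose angles differ by `1/q_{n+1} ≤ 1/l_n`, and for large `l_n` they
are close to any prescribed order of derivatives. The bound on `l_n` may depend only on the listed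
parameters. This is possible because the approximants are chosen once and for all as functions of
the cell permutation, and the numbers of cells leave only finitely many permutations
(`TwistedAbC.finite_liftH`); the bound is taken uniformly over them (`TwistedAbC.exists_threshold`).
All estimates are made for lifts to the plane, and `exists_liftGroup_limit` supplies the limit
diffeomorphism.

Isomorphism. Let `K_n` be the product of the first `n` approximants times the inverse of the product
of the first `n` maps `P.h`. Passing from `K_n` to `K_{n+1}` changes values only on a set of measure
less than `2⁻ⁿ`, so by Borel–Cantelli `K_n` is almost everywhere eventually constant, and so is its
inverse. The limit `L` is an invertible measure-preserving map. Since `K_n` conjugates the abstract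
`T_n` to the smooth one, and these converge weakly and uniformly respectively, `L` conjugates the
limits (`ae_intertwines_of_tendsto`, `TwistedAbC.IsWeakLimit.measureIsomorphic`). -/

theorem det_comp_clm (A B : ℝ × ℝ →L[ℝ] ℝ × ℝ) : (A.comp B).det = A.det * B.det :=
  LinearMap.det_comp (A : ℝ × ℝ →ₗ[ℝ] ℝ × ℝ) (B : ℝ × ℝ →ₗ[ℝ] ℝ × ℝ)

theorem det_id_clm : (ContinuousLinearMap.id ℝ (ℝ × ℝ)).det = 1 :=
  LinearMap.det_id

/-- The linear self-map of the plane with the given matrix entries. -/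
noncomputable def planeMatrix (a b c d : ℝ) : ℝ × ℝ →L[ℝ] ℝ × ℝ :=
  (a • ContinuousLinearMap.fst ℝ ℝ ℝ + b • ContinuousLinearMap.snd ℝ ℝ ℝ).prod
    (c • ContinuousLinearMap.fst ℝ ℝ ℝ + d • ContinuousLinearMap.snd ℝ ℝ ℝ)

theorem det_planeMatrix (a b c d : ℝ) : (planeMatrix a b c d).det = a * d - b * c := by
  rw [planeMatrix, ← Matrix.toLin_finTwoProd_toContinuousLinearMap]
  simp [ContinuousLinearMap.det, LinearMap.coe_toContinuousLinearMap, LinearMap.det_toLin,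
    Matrix.det_fin_two_of]

/-- Area-preserving `C^∞` diffeomorphisms of the plane. -/
structure IsPlaneDiffeo (F : Equiv.Perm (ℝ × ℝ)) : Prop where
  contDiff : ContDiff ℝ ∞ F
  contDiff_symm : ContDiff ℝ ∞ F.symm
  det : ∀ x, (fderiv ℝ F x).det = 1

theorem det_fderiv_comp {f g : ℝ × ℝ → ℝ × ℝ} {x : ℝ × ℝ} (hg : DifferentiableAt ℝ g (f x))
    (hf : DifferentiableAt ℝ f x) :
    (fderiv ℝ (g ∘ f) x).det = (fderiv ℝ g (f x)).det * (fderiv ℝ f x).det := by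
  rw [fderiv_comp x hg hf, det_comp_clm]

theorem det_fderiv_mul_eq_one {f g : ℝ × ℝ → ℝ × ℝ} {x : ℝ × ℝ} (hg : DifferentiableAt ℝ g (f x))
    (hf : DifferentiableAt ℝ f x) (h : g ∘ f =ᶠ[𝓝 x] id) :
    (fderiv ℝ g (f x)).det * (fderiv ℝ f x).det = 1 := by
  rw [← det_fderiv_comp hg hf, h.fderiv_eq, fderiv_id, det_id_clm]

namespace IsPlaneDiffeo

theorem one : IsPlaneDiffeo 1 where
  contDiff := contDiff_id
  contDiff_symm := contDiff_id
  det x := by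
    have : fderiv ℝ (⇑(1 : Equiv.Perm (ℝ × ℝ))) x = ContinuousLinearMap.id ℝ (ℝ × ℝ) := fderiv_id
    rw [this, det_id_clm]

theorem mul {F G : Equiv.Perm (ℝ × ℝ)} (hF : IsPlaneDiffeo F) (hG : IsPlaneDiffeo G) :
    IsPlaneDiffeo (F * G) where
  contDiff := hF.contDiff.comp hG.contDiff
  contDiff_symm := hG.contDiff_symm.comp hF.contDiff_symm
  det x := by
    rw [Equiv.Perm.coe_mul, det_fderiv_comp (hF.contDiff.differentiable (by simp) _)
      (hG.contDiff.differentiable (by simp) _), hF.det, hG.det, one_mul]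

theorem inv {F : Equiv.Perm (ℝ × ℝ)} (hF : IsPlaneDiffeo F) : IsPlaneDiffeo F⁻¹ where
  contDiff := hF.contDiff_symm
  contDiff_symm := hF.contDiff
  det x := by
    have h := det_fderiv_mul_eq_one (f := F.symm) (g := F) (x := x)
      (hF.contDiff.differentiable (by simp) _) (hF.contDiff_symm.differentiable (by simp) _)
      (Eventually.of_forall fun y => F.apply_symm_apply y)
    rwa [hF.det, one_mul] at h

/-- Change of variables for the inverse, whose Jacobian is also `1`: preimages under `F` are images
under `F.symm`. -/
theorem measurePreserving {F : Equiv.Perm (ℝ × ℝ)} (hF : IsPlaneDiffeo F) :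
    MeasurePreserving F := by
  refine ⟨hF.contDiff.continuous.measurable, ?_⟩
  have himage : ∀ s : Set (ℝ × ℝ), MeasurableSet s → volume (F.symm '' s) = volume s := by
    intro s hs
    rw [← lintegral_abs_det_fderiv_eq_addHaar_image volume hs
      (f' := fun x => fderiv ℝ F.symm x)
      (fun x _ => ((hF.contDiff_symm.differentiable (by simp)) x).hasFDerivAt.hasFDerivWithinAt)
      F.symm.injective.injOn]
    have : ∀ x, (fderiv ℝ F.symm x).det = 1 := hF.inv.det
    simp [this]
  ext s hs
  rw [Measure.map_apply hF.contDiff.continuous.measurable hs, ← himage s hs,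
    Equiv.image_symm_eq_preimage]

/-- Conjugation by a diffeomorphism with constant Jacobian preserves area-preserving maps. -/
theorem conj {F A : Equiv.Perm (ℝ × ℝ)} (hF : IsPlaneDiffeo F) (hA : ContDiff ℝ ∞ A)
    (hA' : ContDiff ℝ ∞ A.symm) {c : ℝ} (hc : ∀ x, (fderiv ℝ A x).det = c) :
    IsPlaneDiffeo (A * F * A⁻¹) where
  contDiff := (hA.comp hF.contDiff).comp hA'
  contDiff_symm := (hA.comp hF.contDiff_symm).comp hA'
  det x := by
    have h := det_fderiv_mul_eq_one (f := A.symm) (g := A) (x := x)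
      (hA.differentiable (by simp) _) (hA'.differentiable (by simp) _)
      (Eventually.of_forall fun y => A.apply_symm_apply y)
    have e : ⇑(A * F * A⁻¹) = A ∘ F ∘ A.symm := rfl
    rw [e, det_fderiv_comp (hA.differentiable (by simp) _)
      ((hF.contDiff.comp hA').differentiable (by simp) _),
      det_fderiv_comp (hF.contDiff.differentiable (by simp) _) (hA'.differentiable (by simp) _),
      hF.det, one_mul, hc]
    rwa [hc] at h

end IsPlaneDiffeo

/-- The horizontal shear `(x, y) ↦ (x + φ(y), y)`. -/
def shear (φ : ℝ → ℝ) : Equiv.Perm (ℝ × ℝ) where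
  toFun p := (p.1 + φ p.2, p.2)
  invFun p := (p.1 - φ p.2, p.2)
  left_inv p := by simp
  right_inv p := by simp

theorem shear_isPlaneDiffeo {φ : ℝ → ℝ} (hφ : ContDiff ℝ ∞ φ) : IsPlaneDiffeo (shear φ) where
  contDiff := by
    change ContDiff ℝ ∞ fun p : ℝ × ℝ => (p.1 + φ p.2, p.2)
    fun_prop
  contDiff_symm := by
    change ContDiff ℝ ∞ fun p : ℝ × ℝ => (p.1 - φ p.2, p.2)
    fun_prop
  det p := by
    have h : HasFDerivAt (shear φ) (planeMatrix 1 (deriv φ p.2) 0 1) p := by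
      have h2 : HasFDerivAt (fun x : ℝ × ℝ => φ x.2)
          (deriv φ p.2 • ContinuousLinearMap.snd ℝ ℝ ℝ) p :=
        ((hφ.differentiable (by simp)) p.2).hasDerivAt.comp_hasFDerivAt p hasFDerivAt_snd
      have h3 := (hasFDerivAt_fst.add h2).prodMk (hasFDerivAt_snd (p := p) (𝕜 := ℝ))
      refine h3.congr_fderiv ?_
      simp [planeMatrix]
    rw [h.fderiv, det_planeMatrix]
    ring

/-- The rotation of the plane about the origin whose angle depends on the distance to the origin. -/
noncomputable def twistMap (χ : ℝ → ℝ) : Equiv.Perm (ℝ × ℝ) where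
  toFun p := Surface.planeRot (χ (p.1 ^ 2 + p.2 ^ 2)) p
  invFun p := Surface.planeRot (-χ (p.1 ^ 2 + p.2 ^ 2)) p
  left_inv p := by
    simp only [Surface.planeRot_normSq, Surface.planeRot_neg]
  right_inv p := by
    simp only [Surface.planeRot_normSq]
    simpa using Surface.planeRot_neg (-χ (p.1 ^ 2 + p.2 ^ 2)) p

theorem twistMap_apply (χ : ℝ → ℝ) (p : ℝ × ℝ) :
    twistMap χ p = Surface.planeRot (χ (p.1 ^ 2 + p.2 ^ 2)) p := rfl

theorem twistMap_normSq (χ : ℝ → ℝ) (p : ℝ × ℝ) :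
    (twistMap χ p).1 ^ 2 + (twistMap χ p).2 ^ 2 = p.1 ^ 2 + p.2 ^ 2 :=
  Surface.planeRot_normSq _ p

theorem twistMap_symm (χ : ℝ → ℝ) : (twistMap χ).symm = twistMap fun t => -χ t :=
  Equiv.ext fun _ => rfl

theorem twistMap_contDiff {χ : ℝ → ℝ} (hχ : ContDiff ℝ ∞ χ) : ContDiff ℝ ∞ (twistMap χ) := by
  change ContDiff ℝ ∞ fun p : ℝ × ℝ => Surface.planeRot (χ (p.1 ^ 2 + p.2 ^ 2)) p
  unfold Surface.planeRot
  have := Real.contDiff_cos (n := ∞)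
  have := Real.contDiff_sin (n := ∞)
  fun_prop

theorem hasFDerivAt_rotationAngle {χ : ℝ → ℝ} (hχ : ContDiff ℝ ∞ χ) (x y : ℝ) :
    HasFDerivAt (fun p : ℝ × ℝ => 2 * Real.pi * χ (p.1 ^ 2 + p.2 ^ 2))
      ((2 * Real.pi * deriv χ (x ^ 2 + y ^ 2) * (2 * x)) • ContinuousLinearMap.fst ℝ ℝ ℝ +
        (2 * Real.pi * deriv χ (x ^ 2 + y ^ 2) * (2 * y)) • ContinuousLinearMap.snd ℝ ℝ ℝ)
      (x, y) := by
  have h1 : HasFDerivAt (fun p : ℝ × ℝ => p.1 ^ 2 + p.2 ^ 2)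
      ((2 * x) • ContinuousLinearMap.fst ℝ ℝ ℝ +
        (2 * y) • ContinuousLinearMap.snd ℝ ℝ ℝ) (x, y) := by
    have := ((hasFDerivAt_fst (𝕜 := ℝ) (p := (x, y))).pow 2).add
      ((hasFDerivAt_snd (𝕜 := ℝ) (p := (x, y))).pow 2)
    refine this.congr_fderiv ?_
    ext <;> simp
  have h2 : HasDerivAt (fun t => 2 * Real.pi * χ t) (2 * Real.pi * deriv χ (x ^ 2 + y ^ 2))
      (x ^ 2 + y ^ 2) :=
    ((hχ.differentiable (by simp)) (x ^ 2 + y ^ 2)).hasDerivAt.const_mul (2 * Real.pi)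
  refine (HasDerivAt.comp_hasFDerivAt (x, y) (f := fun p : ℝ × ℝ => p.1 ^ 2 + p.2 ^ 2) h2
    h1).congr_fderiv ?_
  ext <;> simp

theorem hasFDerivAt_rotate {A : ℝ × ℝ → ℝ} {x y u v : ℝ}
    (hA : HasFDerivAt A (u • ContinuousLinearMap.fst ℝ ℝ ℝ + v • ContinuousLinearMap.snd ℝ ℝ ℝ)
      (x, y)) :
    HasFDerivAt (fun p : ℝ × ℝ => (Real.cos (A p) * p.1 - Real.sin (A p) * p.2,
        Real.sin (A p) * p.1 + Real.cos (A p) * p.2))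
      (planeMatrix
        (Real.cos (A (x, y)) - (x * Real.sin (A (x, y)) + y * Real.cos (A (x, y))) * u)
        (-Real.sin (A (x, y)) - (x * Real.sin (A (x, y)) + y * Real.cos (A (x, y))) * v)
        (Real.sin (A (x, y)) + (x * Real.cos (A (x, y)) - y * Real.sin (A (x, y))) * u)
        (Real.cos (A (x, y)) + (x * Real.cos (A (x, y)) - y * Real.sin (A (x, y))) * v))
      (x, y) := by
  have hf := hasFDerivAt_fst (𝕜 := ℝ) (p := (x, y))
  have hg := hasFDerivAt_snd (𝕜 := ℝ) (p := (x, y))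
  refine (((hA.cos.mul hf).sub (hA.sin.mul hg)).prodMk
    ((hA.sin.mul hf).add (hA.cos.mul hg))).congr_fderiv ?_
  ext <;> simp [planeMatrix] <;> ring

/-- Rotation by a variable angle with differential `u dx + v dy` has Jacobian `1 + x v - y u`. For a
radial angle `(u, v)` is proportional to `(x, y)`, and the correction vanishes. -/
theorem twistMap_isPlaneDiffeo {χ : ℝ → ℝ} (hχ : ContDiff ℝ ∞ χ) :
    IsPlaneDiffeo (twistMap χ) where
  contDiff := twistMap_contDiff hχ
  contDiff_symm := by
    rw [twistMap_symm]
    exact twistMap_contDiff hχ.neg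
  det p := by
    obtain ⟨x, y⟩ := p
    have h := hasFDerivAt_rotate (hasFDerivAt_rotationAngle hχ x y)
    have e : ⇑(twistMap χ) = fun p : ℝ × ℝ =>
        (Real.cos (2 * Real.pi * χ (p.1 ^ 2 + p.2 ^ 2)) * p.1 -
          Real.sin (2 * Real.pi * χ (p.1 ^ 2 + p.2 ^ 2)) * p.2,
        Real.sin (2 * Real.pi * χ (p.1 ^ 2 + p.2 ^ 2)) * p.1 +
          Real.cos (2 * Real.pi * χ (p.1 ^ 2 + p.2 ^ 2)) * p.2) := rfl
    rw [e, h.fderiv, det_planeMatrix]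
    linear_combination Real.sin_sq_add_cos_sq (2 * Real.pi * χ (x ^ 2 + y ^ 2))

/-! ### Half-turns of a square

The open unit square (the unit ball of the sup norm) is mapped to the open unit disk by a
diffeomorphism of constant Jacobian; conjugating rotations of the disk yields diffeomorphisms of the
square with compact support that agree with `x ↦ -x` on most of the square. -/

/-- The normalized area of the part of the unit disk between the vertical lines at `0` and
`sin φ`. -/
noncomputable def arcArea (φ : ℝ) : ℝ := (2 * φ + Real.sin (2 * φ)) / Real.pi

/-- The derivative vanishes at odd multiples of `π/2`, so increments are compared directly, by `|sin
(b - a)| < b - a`. -/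
theorem arcArea_strictMono : StrictMono arcArea := by
  intro a b hab
  have hpos : 0 < b - a := sub_pos.2 hab
  have hs : |Real.sin (b - a)| < b - a := by
    simpa [abs_of_pos hpos] using Real.abs_sin_lt_abs hpos.ne'
  have he : Real.sin (2 * b) - Real.sin (2 * a) = 2 * Real.sin (b - a) * Real.cos (b + a) := by
    rw [Real.sin_sub_sin]; ring_nf
  have hc : -(b - a) < Real.sin (b - a) * Real.cos (b + a) := by
    have h1 : |Real.sin (b - a) * Real.cos (b + a)| ≤ |Real.sin (b - a)| := by
      rw [abs_mul]
      exact mul_le_of_le_one_right (abs_nonneg _) (Real.abs_cos_le_one _)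
    exact (abs_lt.1 (h1.trans_lt hs)).1
  unfold arcArea
  apply div_lt_div_of_pos_right _ Real.pi_pos
  linarith

theorem arcArea_contDiff : ContDiff ℝ ∞ arcArea := by
  unfold arcArea
  have := Real.contDiff_sin (n := ∞)
  fun_prop

theorem arcArea_surjective : Function.Surjective arcArea := by
  refine arcArea_contDiff.continuous.surjective ?_ ?_
  · refine tendsto_atTop_mono (f := fun φ => (2 * φ - 1) / Real.pi) (fun φ => ?_) ?_
    · unfold arcArea
      apply div_le_div_of_nonneg_right _ Real.pi_pos.le
      linarith [Real.neg_one_le_sin (2 * φ)]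
    · apply Tendsto.atTop_div_const Real.pi_pos
      exact tendsto_atTop_add_const_right _ _ (tendsto_id.const_mul_atTop two_pos)
  · refine tendsto_atBot_mono (f := fun φ => (2 * φ + 1) / Real.pi) (fun φ => ?_) ?_
    · unfold arcArea
      apply div_le_div_of_nonneg_right _ Real.pi_pos.le
      linarith [Real.sin_le_one (2 * φ)]
    · apply Tendsto.atBot_div_const Real.pi_pos
      exact tendsto_atBot_add_const_right _ _ (tendsto_id.const_mul_atBot two_pos)

theorem arcArea_neg (φ : ℝ) : arcArea (-φ) = -arcArea φ := by
  unfold arcArea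
  rw [show 2 * -φ = -(2 * φ) by ring, Real.sin_neg]
  ring

theorem arcArea_pi_div_two : arcArea (Real.pi / 2) = 1 := by
  unfold arcArea
  rw [show 2 * (Real.pi / 2) = Real.pi by ring, Real.sin_pi, add_zero, div_self Real.pi_ne_zero]

theorem hasDerivAt_arcArea (φ : ℝ) :
    HasDerivAt arcArea (4 * Real.cos φ ^ 2 / Real.pi) φ := by
  have h1 : HasDerivAt (fun φ : ℝ => 2 * φ) 2 φ := by
    simpa using (hasDerivAt_id φ).const_mul 2
  have h := (h1.add h1.sin).div_const Real.pi
  refine h.congr_deriv ?_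
  rw [Real.cos_two_mul]
  ring

/-- The inverse of `arcArea`. -/
noncomputable def arcAreaIso : ℝ ≃o ℝ :=
  arcArea_strictMono.orderIsoOfSurjective arcArea arcArea_surjective

/-- The angle `φ` with given `arcArea φ`. -/
noncomputable def chordAngle (u : ℝ) : ℝ := arcAreaIso.symm u

theorem arcArea_chordAngle (u : ℝ) : arcArea (chordAngle u) = u :=
  arcAreaIso.apply_symm_apply u

theorem chordAngle_arcArea (φ : ℝ) : chordAngle (arcArea φ) = φ :=
  arcAreaIso.symm_apply_apply φ

theorem chordAngle_neg (u : ℝ) : chordAngle (-u) = -chordAngle u := by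
  apply arcArea_strictMono.injective
  rw [arcArea_neg, arcArea_chordAngle, arcArea_chordAngle]

theorem abs_chordAngle_lt {u : ℝ} (hu : |u| < 1) :
    -(Real.pi / 2) < chordAngle u ∧ chordAngle u < Real.pi / 2 := by
  rw [abs_lt] at hu
  constructor
  · rw [← arcArea_strictMono.lt_iff_lt, arcArea_neg, arcArea_pi_div_two, arcArea_chordAngle]
    exact hu.1
  · rw [← arcArea_strictMono.lt_iff_lt, arcArea_pi_div_two, arcArea_chordAngle]
    exact hu.2

theorem cos_chordAngle_pos {u : ℝ} (hu : |u| < 1) : 0 < Real.cos (chordAngle u) :=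
  Real.cos_pos_of_mem_Ioo (abs_chordAngle_lt hu)

theorem chordAngle_contDiffAt {u : ℝ} (hu : |u| < 1) : ContDiffAt ℝ ∞ chordAngle u := by
  have hc := cos_chordAngle_pos hu
  exact arcAreaIso.toHomeomorph.toOpenPartialHomeomorph.contDiffAt_symm_deriv
    (f₀' := 4 * Real.cos (chordAngle u) ^ 2 / Real.pi) (by have := Real.pi_pos; positivity)
    (Set.mem_univ u) (hasDerivAt_arcArea _) arcArea_contDiff.contDiffAt

theorem hasDerivAt_chordAngle {u : ℝ} (hu : |u| < 1) :
    HasDerivAt chordAngle (4 * Real.cos (chordAngle u) ^ 2 / Real.pi)⁻¹ u := by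
  have hc := cos_chordAngle_pos hu
  refine HasDerivAt.of_local_left_inverse (chordAngle_contDiffAt hu).continuousAt
    (hasDerivAt_arcArea _) (by have := Real.pi_pos; positivity)
    (Eventually.of_forall arcArea_chordAngle)

/-- The diffeomorphism of the open unit square onto the open unit disk. -/
noncomputable def squareToDisk (p : ℝ × ℝ) : ℝ × ℝ :=
  (Real.sin (chordAngle p.1), p.2 * Real.cos (chordAngle p.1))

/-- The diffeomorphism of the open unit disk onto the open unit square. -/
noncomputable def diskToSquare (p : ℝ × ℝ) : ℝ × ℝ :=
  (arcArea (Real.arcsin p.1), p.2 / Real.sqrt (1 - p.1 ^ 2))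

theorem norm_lt_one_iff (p : ℝ × ℝ) : ‖p‖ < 1 ↔ |p.1| < 1 ∧ |p.2| < 1 := by
  rw [Prod.norm_def, max_lt_iff, Real.norm_eq_abs, Real.norm_eq_abs]

theorem squareToDisk_mem {p : ℝ × ℝ} (hp : ‖p‖ < 1) :
    (squareToDisk p).1 ^ 2 + (squareToDisk p).2 ^ 2 < 1 := by
  rw [norm_lt_one_iff] at hp
  have hc := cos_chordAngle_pos hp.1
  have h2 : p.2 ^ 2 < 1 := by rw [← sq_abs]; exact pow_lt_one₀ (abs_nonneg _) hp.2 two_ne_zero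
  have h := Real.sin_sq_add_cos_sq (chordAngle p.1)
  simp only [squareToDisk]
  nlinarith [pow_pos hc 2]

theorem sq_lt_of_mem_disk {p : ℝ × ℝ} (hp : p.1 ^ 2 + p.2 ^ 2 < 1) : 0 < 1 - p.1 ^ 2 := by
  nlinarith [sq_nonneg p.2]

theorem abs_lt_of_mem_disk {p : ℝ × ℝ} (hp : p.1 ^ 2 + p.2 ^ 2 < 1) : -1 < p.1 ∧ p.1 < 1 := by
  have := sq_lt_of_mem_disk hp
  rw [← abs_lt]
  exact (sq_lt_one_iff_abs_lt_one _).1 (by linarith)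

theorem diskToSquare_mem {p : ℝ × ℝ} (hp : p.1 ^ 2 + p.2 ^ 2 < 1) : ‖diskToSquare p‖ < 1 := by
  rw [norm_lt_one_iff]
  have h0 := sq_lt_of_mem_disk hp
  obtain ⟨h1, h2⟩ := abs_lt_of_mem_disk hp
  constructor
  · rw [abs_lt]
    simp only [diskToSquare]
    rw [← arcArea_pi_div_two, ← arcArea_neg, arcArea_strictMono.lt_iff_lt,
      arcArea_strictMono.lt_iff_lt]
    exact ⟨Real.neg_pi_div_two_lt_arcsin.2 h1, Real.arcsin_lt_pi_div_two.2 h2⟩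
  · simp only [diskToSquare]
    rw [abs_div, abs_of_pos (Real.sqrt_pos.2 h0), div_lt_one (Real.sqrt_pos.2 h0)]
    apply Real.lt_sqrt_of_sq_lt
    rw [sq_abs]; linarith

theorem diskToSquare_squareToDisk {p : ℝ × ℝ} (hp : ‖p‖ < 1) :
    diskToSquare (squareToDisk p) = p := by
  rw [norm_lt_one_iff] at hp
  have hc := cos_chordAngle_pos hp.1
  have ha := abs_chordAngle_lt hp.1
  have hs : Real.sqrt (1 - Real.sin (chordAngle p.1) ^ 2) = Real.cos (chordAngle p.1) := by
    rw [← Real.cos_sq', Real.sqrt_sq hc.le]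
  ext
  · simp only [diskToSquare, squareToDisk]
    rw [Real.arcsin_sin ha.1.le ha.2.le, arcArea_chordAngle]
  · simp only [diskToSquare, squareToDisk]
    rw [hs, mul_div_cancel_right₀ _ hc.ne']

theorem squareToDisk_diskToSquare {p : ℝ × ℝ} (hp : p.1 ^ 2 + p.2 ^ 2 < 1) :
    squareToDisk (diskToSquare p) = p := by
  have h0 := sq_lt_of_mem_disk hp
  obtain ⟨h1, h2⟩ := abs_lt_of_mem_disk hp
  ext
  · simp only [diskToSquare, squareToDisk]
    rw [chordAngle_arcArea, Real.sin_arcsin h1.le h2.le]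
  · simp only [diskToSquare, squareToDisk]
    rw [chordAngle_arcArea, Real.cos_arcsin, div_mul_cancel₀ _ (Real.sqrt_pos.2 h0).ne']

theorem squareToDisk_neg (p : ℝ × ℝ) : squareToDisk (-p) = -squareToDisk p := by
  ext <;> simp [squareToDisk, chordAngle_neg]

theorem squareToDisk_contDiffAt {p : ℝ × ℝ} (hp : ‖p‖ < 1) : ContDiffAt ℝ ∞ squareToDisk p := by
  rw [norm_lt_one_iff] at hp
  have h : ContDiffAt ℝ ∞ (fun p : ℝ × ℝ => chordAngle p.1) p :=
    (chordAngle_contDiffAt hp.1).comp p contDiffAt_fst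
  exact h.sin.prodMk (contDiffAt_snd.mul h.cos)

theorem diskToSquare_contDiffAt {p : ℝ × ℝ} (hp : p.1 ^ 2 + p.2 ^ 2 < 1) :
    ContDiffAt ℝ ∞ diskToSquare p := by
  have h0 := sq_lt_of_mem_disk hp
  obtain ⟨h1, h2⟩ := abs_lt_of_mem_disk hp
  have ha : ContDiffAt ℝ ∞ (fun p : ℝ × ℝ => Real.arcsin p.1) p :=
    (Real.contDiffAt_arcsin h1.ne' h2.ne).comp p contDiffAt_fst
  have hb : ContDiffAt ℝ ∞ (fun p : ℝ × ℝ => 1 - p.1 ^ 2) p :=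
    contDiffAt_const.sub (contDiffAt_fst.pow 2)
  exact (arcArea_contDiff.contDiffAt.comp p ha).prodMk
    (contDiffAt_snd.div (hb.sqrt h0.ne') (Real.sqrt_pos.2 h0).ne')

/-- The half-chord at angle `φ` has length `cos φ`, while the abscissa `sin φ` moves at speed
proportional to `1 / cos φ` because `φ` is parametrized by area. The product is constant, the ratio
of the areas `π` and `4`. -/
theorem det_fderiv_squareToDisk {p : ℝ × ℝ} (hp : ‖p‖ < 1) :
    (fderiv ℝ squareToDisk p).det = Real.pi / 4 := by
  rw [norm_lt_one_iff] at hp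
  have hc := cos_chordAngle_pos hp.1
  set φ := chordAngle p.1 with hφ
  set d := (4 * Real.cos φ ^ 2 / Real.pi)⁻¹ with hd
  have h1 : HasFDerivAt (fun x : ℝ × ℝ => chordAngle x.1)
      (d • ContinuousLinearMap.fst ℝ ℝ ℝ) p :=
    (hasDerivAt_chordAngle hp.1).comp_hasFDerivAt p hasFDerivAt_fst
  have h : HasFDerivAt squareToDisk
      (planeMatrix (Real.cos φ * d) 0 (p.2 * -(Real.sin φ * d)) (Real.cos φ)) p := by
    refine (h1.sin.prodMk ((hasFDerivAt_snd (𝕜 := ℝ) (p := p)).mul h1.cos)).congr_fderiv ?_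
    ext <;> simp [planeMatrix, ← hφ]
  rw [h.fderiv, det_planeMatrix, hd]
  have := Real.pi_pos
  field_simp
  ring

open Classical in
/-- The self-map of the plane that acts on the open unit square as `twistMap χ` in disk coordinates
and is the identity elsewhere. -/
noncomputable def squareTwist (χ : ℝ → ℝ) (p : ℝ × ℝ) : ℝ × ℝ :=
  if ‖p‖ < 1 then diskToSquare (twistMap χ (squareToDisk p)) else p

theorem squareTwist_of_mem {χ : ℝ → ℝ} {p : ℝ × ℝ} (hp : ‖p‖ < 1) :
    squareTwist χ p = diskToSquare (twistMap χ (squareToDisk p)) := if_pos hp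

theorem twistMap_squareToDisk_mem (χ : ℝ → ℝ) {p : ℝ × ℝ} (hp : ‖p‖ < 1) :
    (twistMap χ (squareToDisk p)).1 ^ 2 + (twistMap χ (squareToDisk p)).2 ^ 2 < 1 := by
  rw [twistMap_normSq]
  exact squareToDisk_mem hp

theorem squareTwist_neg_squareTwist (χ : ℝ → ℝ) (p : ℝ × ℝ) :
    squareTwist (fun t => -χ t) (squareTwist χ p) = p := by
  by_cases hp : ‖p‖ < 1
  · have hm := twistMap_squareToDisk_mem χ hp
    rw [squareTwist_of_mem hp, squareTwist_of_mem (diskToSquare_mem hm),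
      squareToDisk_diskToSquare hm, ← twistMap_symm, Equiv.symm_apply_apply,
      diskToSquare_squareToDisk hp]
  · simp [squareTwist, hp]

/-- `squareTwist` as a permutation of the plane. -/
noncomputable def squareTwistPerm (χ : ℝ → ℝ) : Equiv.Perm (ℝ × ℝ) where
  toFun := squareTwist χ
  invFun := squareTwist fun t => -χ t
  left_inv := squareTwist_neg_squareTwist χ
  right_inv p := by simpa using squareTwist_neg_squareTwist (fun t => -χ t) p

/-- If the twist vanishes near the boundary of the disk, then `squareTwist` has compact support in
the open square. -/
theorem squareTwist_support {χ : ℝ → ℝ} {R : ℝ} (hR : R < 1) (h0 : 0 ≤ R)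
    (hχ : ∀ t, R ≤ t → χ t = 0) : ∃ δ > 0, ∀ p : ℝ × ℝ, 1 - δ < ‖p‖ → squareTwist χ p = p := by
  have hK : IsCompact {p : ℝ × ℝ | p.1 ^ 2 + p.2 ^ 2 ≤ R} := by
    refine Metric.isCompact_of_isClosed_isBounded ?_ ?_
    · exact isClosed_le (by fun_prop) continuous_const
    · refine (Metric.isBounded_closedBall (x := (0 : ℝ × ℝ)) (r := 1)).subset fun p hp => ?_
      have hp' : p.1 ^ 2 + p.2 ^ 2 ≤ R := hp
      rw [mem_closedBall_zero_iff, Prod.norm_def, max_le_iff, Real.norm_eq_abs, Real.norm_eq_abs,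
        ← sq_le_one_iff_abs_le_one, ← sq_le_one_iff_abs_le_one]
      constructor <;> nlinarith [sq_nonneg p.1, sq_nonneg p.2]
  have hcont : ContinuousOn (fun p => ‖diskToSquare p‖) {p : ℝ × ℝ | p.1 ^ 2 + p.2 ^ 2 ≤ R} :=
    fun p hp => ((diskToSquare_contDiffAt (lt_of_le_of_lt hp hR)).continuousAt.norm).continuousWithinAt
  obtain ⟨p₀, hp₀, hmax⟩ := hK.exists_isMaxOn ⟨0, by simpa using h0⟩ hcont
  -- The number `δ` is the gap between the image of the compact disk that carries the twist and the
  -- boundary of the square.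
  refine ⟨1 - ‖diskToSquare p₀‖, sub_pos.2 (diskToSquare_mem (lt_of_le_of_lt hp₀ hR)), ?_⟩
  intro p hp
  by_cases hp1 : ‖p‖ < 1
  · have hlt : R < (squareToDisk p).1 ^ 2 + (squareToDisk p).2 ^ 2 := by
      by_contra hle
      have := hmax (a := squareToDisk p) (not_lt.1 hle)
      simp only [Set.mem_ofPred_eq, diskToSquare_squareToDisk hp1] at this
      linarith
    rw [squareTwist_of_mem hp1, twistMap_apply, hχ _ hlt.le]
    simp [Surface.planeRot, diskToSquare_squareToDisk hp1]
  · simp [squareTwist, hp1]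

theorem squareTwist_contDiff {χ : ℝ → ℝ} (hχ : ContDiff ℝ ∞ χ) {δ : ℝ} (hδ : 0 < δ)
    (hsupp : ∀ p : ℝ × ℝ, 1 - δ < ‖p‖ → squareTwist χ p = p) :
    ContDiff ℝ ∞ (squareTwist χ) := by
  rw [contDiff_iff_contDiffAt]
  intro p
  rcases lt_or_ge ‖p‖ 1 with hp | hp
  · have hm := twistMap_squareToDisk_mem χ hp
    have h : ContDiffAt ℝ ∞ (fun p => diskToSquare (twistMap χ (squareToDisk p))) p :=
      ContDiffAt.comp (g := diskToSquare) (f := twistMap χ ∘ squareToDisk) p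
        (diskToSquare_contDiffAt hm)
        ((twistMap_contDiff hχ).contDiffAt.comp p (squareToDisk_contDiffAt hp))
    refine h.congr_of_eventuallyEq ?_
    filter_upwards [(isOpen_lt continuous_norm continuous_const).mem_nhds hp] with q hq
    exact squareTwist_of_mem hq
  · refine contDiffAt_id.congr_of_eventuallyEq ?_
    have : 1 - δ < ‖p‖ := by linarith
    filter_upwards [(isOpen_lt continuous_const continuous_norm).mem_nhds this] with q hq
    exact hsupp q hq

/-- The Jacobians of the two coordinate changes are taken at different points; they cancel because
they are constant. -/
theorem squareTwist_det {χ : ℝ → ℝ} (hχ : ContDiff ℝ ∞ χ) {δ : ℝ} (hδ : 0 < δ)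
    (hsupp : ∀ p : ℝ × ℝ, 1 - δ < ‖p‖ → squareTwist χ p = p) (p : ℝ × ℝ) :
    (fderiv ℝ (squareTwist χ) p).det = 1 := by
  rcases lt_or_ge ‖p‖ 1 with hp | hp
  · have hm := twistMap_squareToDisk_mem χ hp
    set y := twistMap χ (squareToDisk p) with hy
    have he : squareTwist χ =ᶠ[𝓝 p] diskToSquare ∘ (twistMap χ ∘ squareToDisk) := by
      filter_upwards [(isOpen_lt continuous_norm continuous_const).mem_nhds hp] with q hq
      exact squareTwist_of_mem hq
    have dS := (squareToDisk_contDiffAt hp).differentiableAt (by simp)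
    have dT := (twistMap_contDiff hχ).contDiffAt.differentiableAt (x := squareToDisk p) (by simp)
    have dD : DifferentiableAt ℝ diskToSquare ((twistMap χ ∘ squareToDisk) p) :=
      (diskToSquare_contDiffAt hm).differentiableAt (by simp)
    rw [he.fderiv_eq, det_fderiv_comp dD (dT.comp p dS), det_fderiv_comp dT dS,
      (twistMap_isPlaneDiffeo hχ).det, det_fderiv_squareToDisk hp, one_mul]
    have hz := diskToSquare_mem hm
    have h1 := det_fderiv_mul_eq_one (f := diskToSquare) (g := squareToDisk) (x := y)
      ((squareToDisk_contDiffAt hz).differentiableAt (by simp)) dD (by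
        have ho : IsOpen {p : ℝ × ℝ | p.1 ^ 2 + p.2 ^ 2 < 1} :=
          isOpen_lt (by fun_prop) continuous_const
        filter_upwards [ho.mem_nhds hm] with q hq
        exact squareToDisk_diskToSquare hq)
    rw [det_fderiv_squareToDisk hz] at h1
    rw [mul_comm]
    exact h1
  · have he : squareTwist χ =ᶠ[𝓝 p] id := by
      have : 1 - δ < ‖p‖ := by linarith
      filter_upwards [(isOpen_lt continuous_const continuous_norm).mem_nhds this] with q hq
      exact hsupp q hq
    rw [he.fderiv_eq, fderiv_id, det_id_clm]

theorem squareTwistPerm_isPlaneDiffeo {χ : ℝ → ℝ} (hχ : ContDiff ℝ ∞ χ) {R : ℝ} (hR : R < 1)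
    (h0 : 0 ≤ R) (hχ0 : ∀ t, R ≤ t → χ t = 0) : IsPlaneDiffeo (squareTwistPerm χ) := by
  obtain ⟨δ, hδ, hsupp⟩ := squareTwist_support hR h0 hχ0
  obtain ⟨δ', hδ', hsupp'⟩ := squareTwist_support (χ := fun t => -χ t) hR h0
    fun t ht => by simp [hχ0 t ht]
  exact ⟨squareTwist_contDiff hχ hδ hsupp, squareTwist_contDiff hχ.neg hδ' hsupp',
    squareTwist_det hχ hδ hsupp⟩

/-- There are area-preserving diffeomorphisms with compact support in the open square
`(-1, 1) × (-1, 1)` that converge to `x ↦ -x` there, in the sense that each point is eventually sent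
to its negative. -/
theorem exists_squareHalfTurn : ∃ E : ℕ → Equiv.Perm (ℝ × ℝ), (∀ n, IsPlaneDiffeo (E n)) ∧
    (∀ n, ∃ δ > 0, ∀ p : ℝ × ℝ, 1 - δ < ‖p‖ → E n p = p) ∧
    ∀ p : ℝ × ℝ, ‖p‖ < 1 → ∀ᶠ n in atTop, E n p = -p := by
  -- Angles are measured in full turns, so `1/2` is the half-turn. It is attained where `1 - t ≥ 2 /
  -- (n + 1)`, and the twist vanishes where `1 - t ≤ 1 / (n + 1)`.
  set χ : ℕ → ℝ → ℝ := fun n t =>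
    1 / 2 * Real.smoothTransition ((n + 1) * (1 - t) - 1) with hχdef
  have hχ : ∀ n, ContDiff ℝ ∞ (χ n) := fun n => by
    have := Real.smoothTransition.contDiff (n := ⊤)
    exact contDiff_const.mul (this.comp (by fun_prop))
  have hn : ∀ n : ℕ, (0 : ℝ) < n + 1 := fun n => by positivity
  have hR : ∀ n : ℕ, 1 - 1 / ((n : ℝ) + 1) < 1 := fun n => by
    have := one_div_pos.2 (hn n)
    linarith
  have hR0 : ∀ n : ℕ, 0 ≤ 1 - 1 / ((n : ℝ) + 1) := fun n => by
    rw [sub_nonneg, div_le_one (hn n)]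
    have : (0 : ℝ) ≤ n := n.cast_nonneg
    linarith
  have hχ0 : ∀ (n : ℕ) (t : ℝ), 1 - 1 / ((n : ℝ) + 1) ≤ t → χ n t = 0 := fun n t ht => by
    have h1 : (n + 1) * (1 - t) ≤ 1 := by
      have : 1 - t ≤ 1 / ((n : ℝ) + 1) := by linarith
      rw [le_div_iff₀ (hn n)] at this
      linarith
    simp [hχdef, Real.smoothTransition.zero_of_nonpos (sub_nonpos.2 h1)]
  refine ⟨fun n => squareTwistPerm (χ n),
    fun n => squareTwistPerm_isPlaneDiffeo (hχ n) (hR n) (hR0 n) (hχ0 n),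
    fun n => squareTwist_support (hR n) (hR0 n) (hχ0 n), fun p hp => ?_⟩
  have hm := squareToDisk_mem hp
  set t := (squareToDisk p).1 ^ 2 + (squareToDisk p).2 ^ 2 with ht
  have hlim : Tendsto (fun n : ℕ => ((n : ℝ) + 1) * (1 - t)) atTop atTop :=
    (tendsto_atTop_add_const_right _ 1 tendsto_natCast_atTop_atTop).atTop_mul_const
      (sub_pos.2 hm)
  filter_upwards [hlim.eventually_ge_atTop 2] with n hn2
  change squareTwist (χ n) p = -p
  have h1 : χ n t = 1 / 2 := by
    simp only [hχdef]
    rw [Real.smoothTransition.one_of_one_le (by linarith), mul_one]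
  have h2 : twistMap (χ n) (squareToDisk p) = squareToDisk (-p) := by
    rw [twistMap_apply, ← ht, h1, squareToDisk_neg]
    have h3 : 2 * Real.pi * (1 / 2) = Real.pi := by ring
    ext <;> simp only [Surface.planeRot, h3] <;> simp
  rw [squareTwist_of_mem hp, h2, diskToSquare_squareToDisk (by rwa [norm_neg])]

theorem perm_inv_apply_self {α : Type*} (e : Equiv.Perm α) (x : α) : e⁻¹ (e x) = x :=
  e.symm_apply_apply x

theorem perm_apply_inv_self {α : Type*} (e : Equiv.Perm α) (x : α) : e (e⁻¹ x) = x :=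
  e.apply_symm_apply x

/-! ### Periodization -/

/-- `G` is the identity outside a closed slab in the interior of `{0 ≤ ℓ ≤ 1}`. -/
def SlabSupported (ℓ : ℝ × ℝ →L[ℝ] ℝ) (G : ℝ × ℝ → ℝ × ℝ) : Prop :=
  ∃ δ > 0, ∀ x, ¬(δ ≤ ℓ x ∧ ℓ x ≤ 1 - δ) → G x = x

/-- The map that commutes with the translation by `v` and agrees with `G` on `{0 ≤ ℓ < 1}`, where
`ℓ v = 1`. -/
noncomputable def periodize (ℓ : ℝ × ℝ →L[ℝ] ℝ) (v : ℝ × ℝ) (G : ℝ × ℝ → ℝ × ℝ) (x : ℝ × ℝ) :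
    ℝ × ℝ :=
  G (x - (⌊ℓ x⌋ : ℝ) • v) + (⌊ℓ x⌋ : ℝ) • v

section Periodize

variable {ℓ : ℝ × ℝ →L[ℝ] ℝ} {v : ℝ × ℝ}

theorem SlabSupported.symm {G : Equiv.Perm (ℝ × ℝ)} (hG : SlabSupported ℓ G) :
    SlabSupported ℓ G.symm := by
  obtain ⟨δ, hδ, h⟩ := hG
  exact ⟨δ, hδ, fun x hx => by rw [Equiv.symm_apply_eq, h x hx]⟩

/-- A value `G x` outside the supporting slab is fixed by `G`, and then injectivity gives `G x = x`.
-/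
theorem SlabSupported.floor_apply {G : Equiv.Perm (ℝ × ℝ)} (hG : SlabSupported ℓ G) {x : ℝ × ℝ}
    (hx : ⌊ℓ x⌋ = 0) : ⌊ℓ (G x)⌋ = 0 := by
  obtain ⟨δ, hδ, h⟩ := hG
  by_cases hGx : δ ≤ ℓ (G x) ∧ ℓ (G x) ≤ 1 - δ
  · rw [Int.floor_eq_iff]
    simp only [Int.cast_zero]
    constructor <;> linarith [hGx.1, hGx.2]
  · rw [G.injective (h _ hGx), hx]

theorem floor_sub_floor (hv : ℓ v = 1) (x : ℝ × ℝ) : ⌊ℓ (x - (⌊ℓ x⌋ : ℝ) • v)⌋ = 0 := by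
  rw [map_sub, map_smul, hv, smul_eq_mul, mul_one, Int.floor_sub_intCast, sub_self]

theorem floor_periodize (hv : ℓ v = 1) {G : Equiv.Perm (ℝ × ℝ)} (hG : SlabSupported ℓ G)
    (x : ℝ × ℝ) : ⌊ℓ (periodize ℓ v G x)⌋ = ⌊ℓ x⌋ := by
  rw [periodize, map_add, map_smul, hv, smul_eq_mul, mul_one, Int.floor_add_intCast,
    hG.floor_apply (floor_sub_floor hv x), zero_add]

theorem periodize_symm_periodize (hv : ℓ v = 1) {G : Equiv.Perm (ℝ × ℝ)}
    (hG : SlabSupported ℓ G) (x : ℝ × ℝ) :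
    periodize ℓ v G.symm (periodize ℓ v G x) = x := by
  conv_lhs => rw [periodize, floor_periodize hv hG]
  rw [periodize, add_sub_cancel_right, Equiv.symm_apply_apply, sub_add_cancel]

/-- Periodization of a permutation of the plane. -/
noncomputable def periodizePerm (hv : ℓ v = 1) (G : Equiv.Perm (ℝ × ℝ))
    (hG : SlabSupported ℓ G) : Equiv.Perm (ℝ × ℝ) where
  toFun := periodize ℓ v G
  invFun := periodize ℓ v G.symm
  left_inv := periodize_symm_periodize hv hG
  right_inv := periodize_symm_periodize (G := G.symm) hv hG.symm

theorem periodize_add (hv : ℓ v = 1) (G : ℝ × ℝ → ℝ × ℝ) (x : ℝ × ℝ) :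
    periodize ℓ v G (x + v) = periodize ℓ v G x + v := by
  have : ⌊ℓ (x + v)⌋ = ⌊ℓ x⌋ + 1 := by rw [map_add, hv, Int.floor_add_one]
  simp only [periodize, this, Int.cast_add, Int.cast_one, add_smul, one_smul]
  rw [add_sub_add_right_eq_sub, add_assoc]

/-- The floor jumps where `ℓ` is an integer, but there `G` is the identity on both sides, so the two
formulas agree. Smoothness and Jacobian of the periodization are read off from this local form. -/
theorem periodize_eventuallyEq (hv : ℓ v = 1) {G : ℝ × ℝ → ℝ × ℝ} (hG : SlabSupported ℓ G)
    (x : ℝ × ℝ) :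
    periodize ℓ v G =ᶠ[𝓝 x] fun y => G (y - (⌊ℓ x⌋ : ℝ) • v) + (⌊ℓ x⌋ : ℝ) • v := by
  obtain ⟨δ, hδ, h⟩ := hG
  set m := ⌊ℓ x⌋ with hm
  -- Within `δ` below the level `m` both translates of `G` are the identity; the cap by `1` ensures
  -- that the floor there is exactly `m - 1`.
  have h1 : ((m : ℝ) - min δ 1) < ℓ x := by
    have := Int.floor_le (ℓ x)
    have h2 : 0 < min δ 1 := lt_min hδ one_pos
    linarith
  have h2 : ℓ x < m + 1 := Int.lt_floor_add_one _
  filter_upwards [(isOpen_lt continuous_const ℓ.continuous).mem_nhds h1,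
    (isOpen_lt ℓ.continuous continuous_const).mem_nhds h2] with y hy1 hy2
  replace hy1 : (m : ℝ) - min δ 1 < ℓ y := hy1
  replace hy2 : ℓ y < (m : ℝ) + 1 := hy2
  rcases le_or_gt (m : ℝ) (ℓ y) with hle | hlt
  · have : ⌊ℓ y⌋ = m := Int.floor_eq_iff.2 ⟨hle, hy2⟩
    rw [periodize, this]
  · have hfl : ⌊ℓ y⌋ = m - 1 := by
      rw [Int.floor_eq_iff]
      push_cast
      constructor <;> linarith [min_le_right δ (1 : ℝ)]
    have e1 : G (y - (m : ℝ) • v) = y - (m : ℝ) • v := by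
      apply h
      rw [map_sub, map_smul, hv, smul_eq_mul, mul_one]
      intro hc
      linarith [hc.1]
    have e2 : G (y - ((m - 1 : ℤ) : ℝ) • v) = y - ((m - 1 : ℤ) : ℝ) • v := by
      apply h
      rw [map_sub, map_smul, hv, smul_eq_mul, mul_one]
      intro hc
      push_cast at hc
      linarith [hc.2, min_le_left δ (1 : ℝ)]
    rw [periodize, hfl, e1, e2, sub_add_cancel, sub_add_cancel]

theorem periodize_contDiff (hv : ℓ v = 1) {G : ℝ × ℝ → ℝ × ℝ} (hG : SlabSupported ℓ G)
    (hc : ContDiff ℝ ∞ G) : ContDiff ℝ ∞ (periodize ℓ v G) := by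
  rw [contDiff_iff_contDiffAt]
  intro x
  refine ContDiffAt.congr_of_eventuallyEq ?_ (periodize_eventuallyEq hv hG x)
  exact (hc.comp (contDiff_id.sub contDiff_const)).contDiffAt.add contDiffAt_const

theorem periodizePerm_isPlaneDiffeo (hv : ℓ v = 1) {G : Equiv.Perm (ℝ × ℝ)}
    (hG : SlabSupported ℓ G) (hd : IsPlaneDiffeo G) : IsPlaneDiffeo (periodizePerm hv G hG) where
  contDiff := periodize_contDiff hv hG hd.contDiff
  contDiff_symm := periodize_contDiff hv hG.symm hd.contDiff_symm
  det x := by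
    change (fderiv ℝ (periodize ℓ v G) x).det = 1
    rw [(periodize_eventuallyEq hv hG x).fderiv_eq, fderiv_add_const, fderiv_comp_sub]
    exact hd.det _

end Periodize

/-! ### Diffeomorphisms of the strip -/

/-- The group of area-preserving diffeomorphisms of the plane that commute with `R_{1/q}` and are
supported in a closed strip in the interior of `ℝ × [0,1]`. -/
def stripGroup (q : ℕ+) : Subgroup (Equiv.Perm (ℝ × ℝ)) where
  carrier := {F | IsPlaneDiffeo F ∧ (∀ x, F (x + (1 / (q : ℝ), 0)) = F x + (1 / (q : ℝ), 0)) ∧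
    SlabSupported (ContinuousLinearMap.snd ℝ ℝ ℝ) F}
  one_mem' := ⟨IsPlaneDiffeo.one, fun _ => rfl, 1, one_pos, fun _ _ => rfl⟩
  mul_mem' := by
    rintro F G ⟨hF, hF1, δ, hδ, hF2⟩ ⟨hG, hG1, η, hη, hG2⟩
    refine ⟨hF.mul hG, fun x => by
      rw [Equiv.Perm.mul_apply, hG1, hF1, Equiv.Perm.mul_apply], min δ η, lt_min hδ hη, fun x hx => ?_⟩
    have h1 : G x = x := hG2 x fun h =>
      hx ⟨(min_le_right _ _).trans h.1, h.2.trans (by linarith [min_le_right δ η])⟩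
    have h2 : F x = x := hF2 x fun h =>
      hx ⟨(min_le_left _ _).trans h.1, h.2.trans (by linarith [min_le_left δ η])⟩
    rw [Equiv.Perm.mul_apply, h1, h2]
  inv_mem' := by
    rintro F ⟨hF, hF1, hF2⟩
    refine ⟨hF.inv, fun x => ?_, hF2.symm⟩
    rw [Equiv.Perm.inv_eq_iff_eq, hF1]
    rw [perm_apply_inv_self]

namespace stripGroup

variable {q : ℕ+} {F : Equiv.Perm (ℝ × ℝ)}

theorem apply_add_zsmul (hF : F ∈ stripGroup q) (m : ℤ) (x : ℝ × ℝ) :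
    F (x + m • ((1 / (q : ℝ), 0) : ℝ × ℝ)) = F x + m • ((1 / (q : ℝ), 0) : ℝ × ℝ) := by
  induction m using Int.induction_on generalizing x with
  | zero => simp
  | succ n ih => rw [add_smul, one_smul, ← add_assoc, hF.2.1, ih, add_assoc]
  | pred n ih =>
    have := hF.2.1 (x + (-(n : ℤ) - 1) • ((1 / (q : ℝ), 0) : ℝ × ℝ))
    rw [add_assoc, ← add_one_zsmul, sub_add_cancel, ih] at this
    rw [sub_smul, one_smul, ← add_sub_assoc, ← add_sub_assoc, this]
    simp [sub_smul, add_sub_assoc]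

theorem apply_add_int (hF : F ∈ stripGroup q) (m : ℤ) (x : ℝ × ℝ) :
    F (x + ((m : ℝ), 0)) = F x + ((m : ℝ), 0) := by
  have h := apply_add_zsmul hF (m * q) x
  have hq : (q : ℝ) ≠ 0 := by exact_mod_cast q.pos.ne'
  have e : (m * (q : ℤ)) • ((1 / (q : ℝ), 0) : ℝ × ℝ) = ((m : ℝ), 0) := by
    ext
    · simp [hq]
    · simp
  rwa [e] at h

theorem snd_apply_mem (hF : F ∈ stripGroup q) {x : ℝ × ℝ} :
    (F x).2 ∈ Set.Ico (0 : ℝ) 1 ↔ x.2 ∈ Set.Ico (0 : ℝ) 1 := by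
  have key : ∀ y : ℝ × ℝ, y.2 ∈ Set.Ico (0 : ℝ) 1 ↔
      ⌊ContinuousLinearMap.snd ℝ ℝ ℝ y⌋ = 0 := fun y => by
    rw [Int.floor_eq_zero_iff]; rfl
  rw [key, key]
  refine ⟨fun h => ?_, hF.2.2.floor_apply⟩
  have := hF.2.2.symm.floor_apply h
  simpa using this

end stripGroup

/-! ### The coordinate square and the action of strip diffeomorphisms on it -/

/-- The point of the plane with the coordinates of a point of the square. -/
def Sq.pt (x : Sq) : ℝ × ℝ := (x.1, x.2)

/-- Reduction of both coordinates modulo `1`. -/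
noncomputable def Sq.wrap (x : ℝ × ℝ) : Sq :=
  (⟨Int.fract x.1, Int.fract_nonneg _, Int.fract_lt_one _⟩,
    ⟨Int.fract x.2, Int.fract_nonneg _, Int.fract_lt_one _⟩)

theorem Sq.measurable_wrap : Measurable Sq.wrap :=
  ((measurable_fract.comp measurable_fst).subtype_mk).prodMk
    ((measurable_fract.comp measurable_snd).subtype_mk)

theorem Sq.measurable_pt : Measurable Sq.pt :=
  (measurable_subtype_coe.comp measurable_fst).prodMk (measurable_subtype_coe.comp measurable_snd)

theorem Sq.wrap_pt (x : Sq) : Sq.wrap x.pt = x := by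
  ext
  · exact Int.fract_eq_self.2 x.1.2
  · exact Int.fract_eq_self.2 x.2.2

theorem Sq.wrap_add_int (x : ℝ × ℝ) (m : ℤ) : Sq.wrap (x + ((m : ℝ), 0)) = Sq.wrap x := by
  ext <;> simp [Sq.wrap]

theorem Sq.exists_pt_wrap {x : ℝ × ℝ} (hx : x.2 ∈ Set.Ico (0 : ℝ) 1) :
    ∃ m : ℤ, x = (Sq.wrap x).pt + ((m : ℝ), 0) := by
  refine ⟨⌊x.1⌋, ?_⟩
  ext
  · simp [Sq.wrap, Sq.pt]
  · simp [Sq.wrap, Sq.pt, Int.fract_eq_self.2 hx]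

/-- Lebesgue measure on the coordinate square. -/
noncomputable def Sq.vol : Measure Sq :=
  (volume.restrict (Set.Ico (0 : ℝ) 1 ×ˢ Set.Ico (0 : ℝ) 1)).map Sq.wrap

theorem Sq.vol_eq {A : Set Sq} (hA : MeasurableSet A) : Sq.vol A =
    volume (Sq.wrap ⁻¹' A ∩ Set.Ico (0 : ℝ) 1 ×ˢ Set.Ico (0 : ℝ) 1) := by
  rw [Sq.vol, Measure.map_apply Sq.measurable_wrap hA,
    Measure.restrict_apply (Sq.measurable_wrap hA)]

instance Sq.isProbabilityMeasure_vol : IsProbabilityMeasure Sq.vol := by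
  refine ⟨?_⟩
  rw [Sq.vol_eq MeasurableSet.univ, Set.preimage_univ, Set.univ_inter, Measure.volume_eq_prod,
    Measure.prod_prod]
  simp

/-- A map that commutes with integer translations pulls a fundamental domain back to a fundamental
domain. Translation-invariant sets have equal measure in any two of them. -/
theorem isAddFundamentalDomain_preimage_strip {F : Equiv.Perm (ℝ × ℝ)} (hm : Measurable F)
    (hF : ∀ (m : ℤ) (x : ℝ × ℝ), F (x + ((m : ℝ), 0)) = F x + ((m : ℝ), 0)) :
    IsAddFundamentalDomain (AddSubgroup.zmultiples ((1, 0) : ℝ × ℝ))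
      (F ⁻¹' (Set.Ico (0 : ℝ) 1 ×ˢ Set.univ)) volume := by
  refine IsAddFundamentalDomain.mk'
    (hm (measurableSet_Ico.prod MeasurableSet.univ)).nullMeasurableSet fun x => ?_
  have hz : ∀ m : ℤ, m • ((1, 0) : ℝ × ℝ) = ((m : ℝ), 0) := fun m => by ext <;> simp
  have hmem : ∀ m : ℤ, F (((m : ℝ), 0) + x) ∈ Set.Ico (0 : ℝ) 1 ×ˢ (Set.univ : Set ℝ) ↔
      m = -⌊(F x).1⌋ := fun m => by
    rw [add_comm, hF]
    have h1 := Int.floor_eq_iff (a := (F x).1) (z := -m)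
    push_cast at h1
    rw [show m = -⌊(F x).1⌋ ↔ ⌊(F x).1⌋ = -m by omega, h1]
    simp only [Set.mem_prod, Set.mem_Ico, Prod.fst_add, Set.mem_univ, and_true]
    constructor <;> rintro ⟨a, b⟩ <;> constructor <;> linarith
  refine ⟨⟨_, AddSubgroup.mem_zmultiples_iff.2 ⟨-⌊(F x).1⌋, rfl⟩⟩, ?_, ?_⟩
  · change F ((-⌊(F x).1⌋) • ((1, 0) : ℝ × ℝ) + x) ∈ Set.Ico (0 : ℝ) 1 ×ˢ (Set.univ : Set ℝ)
    rw [hz, hmem]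
  · rintro ⟨_, hg⟩ hx
    obtain ⟨m, rfl⟩ := AddSubgroup.mem_zmultiples_iff.1 hg
    have hx' : F (m • ((1, 0) : ℝ × ℝ) + x) ∈ Set.Ico (0 : ℝ) 1 ×ˢ (Set.univ : Set ℝ) := hx
    rw [hz, hmem] at hx'
    simp [hx']

namespace stripGroup

variable {q : ℕ+}

theorem wrap_apply_pt_wrap {F : Equiv.Perm (ℝ × ℝ)} (hF : F ∈ stripGroup q) {x : ℝ × ℝ}
    (hx : x.2 ∈ Set.Ico (0 : ℝ) 1) : Sq.wrap (F (Sq.wrap x).pt) = Sq.wrap (F x) := by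
  obtain ⟨m, hm⟩ := Sq.exists_pt_wrap hx
  conv_rhs => rw [hm, apply_add_int hF, Sq.wrap_add_int]

/-- The permutation of the square induced by a diffeomorphism of the strip. -/
noncomputable def toSq (q : ℕ+) : stripGroup q →* Equiv.Perm Sq where
  toFun F :=
    { toFun := fun x => Sq.wrap (F.1 x.pt)
      invFun := fun x => Sq.wrap (F.1.symm x.pt)
      left_inv := fun x => by
        refine (wrap_apply_pt_wrap (inv_mem F.2) ((snd_apply_mem F.2).2 x.2.2)).trans ?_
        rw [perm_inv_apply_self, Sq.wrap_pt]
      right_inv := fun x => by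
        refine (wrap_apply_pt_wrap F.2 ((snd_apply_mem (inv_mem F.2)).2 x.2.2)).trans ?_
        rw [perm_apply_inv_self, Sq.wrap_pt] }
  map_one' := Equiv.ext Sq.wrap_pt
  map_mul' F G := Equiv.ext fun x =>
    (wrap_apply_pt_wrap F.2 ((snd_apply_mem G.2).2 x.2.2)).symm

theorem toSq_apply (F : stripGroup q) (x : Sq) : toSq q F x = Sq.wrap (F.1 x.pt) := rfl

theorem exists_apply_pt (F : stripGroup q) (x : Sq) :
    ∃ m : ℤ, F.1 x.pt = (toSq q F x).pt + ((m : ℝ), 0) :=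
  Sq.exists_pt_wrap ((snd_apply_mem F.2).2 x.2.2)

theorem measurable_toSq (F : stripGroup q) : Measurable (toSq q F) :=
  Sq.measurable_wrap.comp (F.2.1.contDiff.continuous.measurable.comp Sq.measurable_pt)

/-- The diffeomorphism preserves area in the plane but carries the unit square to another
fundamental domain of the integer translations. The periodic set over `A` has the same area in both.
-/
theorem measurePreserving_toSq (F : stripGroup q) :
    MeasurePreserving (toSq q F) Sq.vol Sq.vol := by
  refine ⟨measurable_toSq F, ?_⟩
  ext A hA
  rw [Measure.map_apply (measurable_toSq F) hA, Sq.vol_eq hA,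
    Sq.vol_eq (measurable_toSq F hA)]
  set Y : Set (ℝ × ℝ) := Set.univ ×ˢ Set.Ico (0 : ℝ) 1 with hY
  set D : Set (ℝ × ℝ) := Set.Ico (0 : ℝ) 1 ×ˢ Set.univ with hD
  set A' : Set (ℝ × ℝ) := Sq.wrap ⁻¹' A ∩ Y with hA'
  have hYm : MeasurableSet Y := MeasurableSet.univ.prod measurableSet_Ico
  have hA'm : MeasurableSet A' := (Sq.measurable_wrap hA).inter hYm
  have hS : Set.Ico (0 : ℝ) 1 ×ˢ Set.Ico (0 : ℝ) 1 = Y ∩ D := by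
    rw [hY, hD, Set.prod_inter_prod, Set.univ_inter, Set.inter_univ]
  have hfd := isAddFundamentalDomain_preimage_strip (F := 1) measurable_id fun m x => rfl
  have hfd' := isAddFundamentalDomain_preimage_strip (F := F.1⁻¹)
    F.2.1.contDiff_symm.continuous.measurable (apply_add_int (inv_mem F.2))
  have hinv := hfd.measure_set_eq hfd' hA'm (fun g => by
    obtain ⟨_, hg⟩ := g
    obtain ⟨m, rfl⟩ := AddSubgroup.mem_zmultiples_iff.1 hg
    ext x
    have e : ((⟨m • ((1, 0) : ℝ × ℝ), hg⟩ : AddSubgroup.zmultiples ((1, 0) : ℝ × ℝ)) +ᵥ x) =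
        x + ((m : ℝ), 0) := by
      change m • ((1, 0) : ℝ × ℝ) + x = _
      rw [add_comm]
      congr 1
      ext <;> simp
    simp only [Set.mem_preimage, e, hA', hY, Set.mem_inter_iff, Sq.wrap_add_int, Set.mem_prod,
      Prod.snd_add, add_zero, Set.mem_univ, true_and])
  have e1 : Sq.wrap ⁻¹' (toSq q F ⁻¹' A) ∩ Set.Ico (0 : ℝ) 1 ×ˢ Set.Ico (0 : ℝ) 1 =
      F.1 ⁻¹' (A' ∩ ⇑(F.1⁻¹) ⁻¹' D) := by
    ext x
    rw [hS]
    simp only [Set.mem_inter_iff, Set.mem_preimage, hA', hY, Set.mem_prod, Set.mem_univ, true_and,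
      snd_apply_mem F.2, perm_inv_apply_self]
    constructor
    · rintro ⟨h1, h2, h3⟩
      exact ⟨⟨by rwa [toSq_apply, wrap_apply_pt_wrap F.2 h2] at h1, h2⟩, h3⟩
    · rintro ⟨⟨h1, h2⟩, h3⟩
      exact ⟨by rwa [toSq_apply, wrap_apply_pt_wrap F.2 h2], h2, h3⟩
  have hDm : MeasurableSet (⇑(F.1⁻¹) ⁻¹' D) :=
    F.2.1.contDiff_symm.continuous.measurable (measurableSet_Ico.prod MeasurableSet.univ)
  rw [e1, F.2.1.measurePreserving.measure_preimage (hA'm.inter hDm).nullMeasurableSet, ← hinv, hS,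
    ← Set.inter_assoc]
  rfl

end stripGroup

/-! ### Transformations approximated by diffeomorphisms of the strip -/

/-- The automorphism of the measurable space `Sq` induced by a diffeomorphism of the strip. -/
noncomputable def stripGroup.toSqEquiv {q : ℕ+} (F : stripGroup q) : Sq ≃ᵐ Sq where
  toEquiv := stripGroup.toSq q F
  measurable_toFun := stripGroup.measurable_toSq F
  measurable_invFun := by
    have h := stripGroup.measurable_toSq F⁻¹
    rwa [map_inv] at h

/-- Arbitrary sets are allowed because the exceptional sets in `approxGroup` involve permutations
that need not be measurable. -/
theorem stripGroup.vol_preimage_toSq {q : ℕ+} (F : stripGroup q) (A : Set Sq) :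
    Sq.vol (stripGroup.toSq q F ⁻¹' A) = Sq.vol A :=
  MeasurePreserving.measure_preimage_equiv (f := stripGroup.toSqEquiv F)
    (stripGroup.measurePreserving_toSq F) A

/-- The group of permutations of the square that agree with a diffeomorphism of the strip, commuting
with `R_{1/q}`, up to sets of arbitrarily small measure. -/
def approxGroup (q : ℕ+) : Subgroup (Equiv.Perm Sq) where
  carrier := {g | ∀ ε : ℝ≥0∞, 0 < ε →
    ∃ F : stripGroup q, Sq.vol {x | stripGroup.toSq q F x ≠ g x} < ε}
  one_mem' := fun ε hε => ⟨1, by simpa using hε⟩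
  mul_mem' := by
    intro g g' hg hg' ε hε
    obtain ⟨F, hF⟩ := hg (ε / 2) (ENNReal.half_pos hε.ne')
    obtain ⟨F', hF'⟩ := hg' (ε / 2) (ENNReal.half_pos hε.ne')
    refine ⟨F * F', ?_⟩
    calc Sq.vol {x | stripGroup.toSq q (F * F') x ≠ (g * g') x}
        ≤ Sq.vol ((stripGroup.toSq q F' ⁻¹' {x | stripGroup.toSq q F x ≠ g x}) ∪
            {x | stripGroup.toSq q F' x ≠ g' x}) := by
          apply measure_mono
          intro x hx
          by_cases h : stripGroup.toSq q F' x = g' x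
          · left
            simp only [Set.mem_preimage, Set.mem_ofPred_eq] at hx ⊢
            rwa [map_mul, Equiv.Perm.mul_apply, Equiv.Perm.mul_apply, ← h] at hx
          · exact Or.inr h
      _ ≤ _ := measure_union_le _ _
      _ < ε / 2 + ε / 2 := by
          rw [stripGroup.vol_preimage_toSq]
          exact ENNReal.add_lt_add hF hF'
      _ = ε := ENNReal.add_halves ε
  inv_mem' := by
    intro g hg ε hε
    obtain ⟨F, hF⟩ := hg ε hε
    refine ⟨F⁻¹, lt_of_le_of_lt ?_ hF⟩
    rw [← stripGroup.vol_preimage_toSq F⁻¹ {x | stripGroup.toSq q F x ≠ g x}]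
    apply measure_mono
    intro x hx h
    apply hx
    rw [map_inv] at h ⊢
    rw [perm_apply_inv_self] at h
    rw [eq_comm, Equiv.Perm.inv_eq_iff_eq]
    exact h

theorem approxGroup_of_ae_eventually {q : ℕ+} {g : Equiv.Perm Sq} (hg : Measurable g)
    (F : ℕ → stripGroup q)
    (h : ∀ᵐ x ∂Sq.vol, ∀ᶠ n in atTop, stripGroup.toSq q (F n) x = g x) : g ∈ approxGroup q := by
  intro ε hε
  have hlim : Tendsto (fun n => Sq.vol {x | stripGroup.toSq q (F n) x ≠ g x}) atTop
      (𝓝 (Sq.vol ∅)) := by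
    refine tendsto_measure_of_ae_tendsto_indicator_of_isFiniteMeasure atTop MeasurableSet.empty
      (fun n => ?_) ?_
    · exact (measurableSet_eq_fun (stripGroup.measurable_toSq (F n)) hg).compl
    · filter_upwards [h] with x hx
      filter_upwards [hx] with n hn
      simp [hn]
  rw [measure_empty] at hlim
  obtain ⟨n, hn⟩ := (hlim.eventually_lt_const hε).exists
  exact ⟨F n, hn⟩

theorem approxGroup_of_ae_eq {q : ℕ+} {g g' : Equiv.Perm Sq} (hg : g ∈ approxGroup q)
    (h : ∀ᵐ x ∂Sq.vol, g x = g' x) : g' ∈ approxGroup q := by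
  intro ε hε
  obtain ⟨F, hF⟩ := hg ε hε
  refine ⟨F, lt_of_le_of_lt (measure_mono_ae ?_) hF⟩
  filter_upwards [h] with x hx hne hc
  exact hne (hc.trans hx)

/-- This discards at once the edges of the square and of all cells, which lie on lines with a
rational coordinate. -/
theorem Sq.ae_irrational : ∀ᵐ x ∂Sq.vol, Irrational (x.1 : ℝ) ∧ Irrational (x.2 : ℝ) := by
  have hc : (Set.range ((↑) : ℚ → ℝ)).Countable := Set.countable_range _
  have hm := hc.measurableSet
  have h0 : volume (Set.range ((↑) : ℚ → ℝ)) = 0 := hc.measure_zero volume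
  rw [ae_iff]
  have hA : {x : Sq | ¬(Irrational (x.1 : ℝ) ∧ Irrational (x.2 : ℝ))} =
      Sq.pt ⁻¹' (Set.range ((↑) : ℚ → ℝ) ×ˢ Set.univ ∪ Set.univ ×ˢ Set.range ((↑) : ℚ → ℝ)) := by
    ext x
    simp only [Irrational, Set.mem_ofPred_eq, Set.mem_preimage, Set.mem_union, Set.mem_prod,
      Set.mem_univ, and_true, true_and, Sq.pt]
    tauto
  have hM : MeasurableSet
      (Set.range ((↑) : ℚ → ℝ) ×ˢ Set.univ ∪ Set.univ ×ˢ Set.range ((↑) : ℚ → ℝ) : Set (ℝ × ℝ)) :=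
    (hm.prod MeasurableSet.univ).union (MeasurableSet.univ.prod hm)
  rw [hA, Sq.vol_eq (Sq.measurable_pt hM)]
  refine measure_mono_null (t := Set.range ((↑) : ℚ → ℝ) ×ˢ Set.univ ∪
    Set.univ ×ˢ Set.range ((↑) : ℚ → ℝ)) ?_ ?_
  · rintro x ⟨hx, hx1, hx2⟩
    have : (Sq.wrap x).pt = x := by
      ext
      · exact Int.fract_eq_self.2 hx1
      · exact Int.fract_eq_self.2 hx2
    rwa [Set.mem_preimage, Set.mem_preimage, this] at hx
  · rw [Measure.volume_eq_prod]
    refine measure_union_null ?_ ?_ <;> rw [Measure.prod_prod, h0] <;> simp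

theorem measurable_splitIco (r : ℕ+) : Measurable (splitIco r) := by
  have h : Measurable fun x : Set.Ico (0 : ℝ) 1 => (r : ℝ) * x :=
    measurable_const.mul measurable_subtype_coe
  refine Measurable.prodMk (measurable_to_countable' fun i => ?_)
    (measurable_fract.comp h).subtype_mk
  have : (fun x : Set.Ico (0 : ℝ) 1 => (splitIco r x).1) ⁻¹' {i} =
      (fun x : Set.Ico (0 : ℝ) 1 => ⌊(r : ℝ) * x⌋₊) ⁻¹' {(i : ℕ)} := by
    ext x
    simp only [Set.mem_preimage, Set.mem_singleton_iff, Fin.ext_iff]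
    rfl
  exact this ▸ (Nat.measurable_floor.comp h) (measurableSet_singleton _)

theorem measurable_splitIco_symm (r : ℕ+) : Measurable (splitIco r).symm := by
  refine Measurable.subtype_mk (Measurable.div_const (Measurable.add ?_ ?_) _)
  · exact (measurable_from_top (f := fun i : Fin r => ((i : ℕ) : ℝ))).comp measurable_fst
  · exact measurable_subtype_coe.comp measurable_snd

theorem measurable_sqRot (t : ℝ) : Measurable (sqRot t) := by
  refine Measurable.prodMk ?_ measurable_snd
  exact (measurable_fract.comp
    ((measurable_subtype_coe.comp measurable_fst).add_const t)).subtype_mk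

theorem shear_mem_stripGroup (q : ℕ+) {φ : ℝ → ℝ} (hφ : ContDiff ℝ ∞ φ) {δ : ℝ} (hδ : 0 < δ)
    (h : ∀ y, ¬(δ ≤ y ∧ y ≤ 1 - δ) → φ y = 0) : shear φ ∈ stripGroup q := by
  refine ⟨shear_isPlaneDiffeo hφ, fun x => ?_, δ, hδ, fun x hx => ?_⟩
  · ext <;> simp [shear, add_right_comm]
  · ext <;> simp [shear, h x.2 hx]

/-- Rotations of the square are limits of diffeomorphisms of the strip. -/
theorem sqRot_mem_approxGroup (q : ℕ+) (t : ℝ) : sqRot t ∈ approxGroup q := by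
  -- The shear equals the rotation where the distance to both boundary lines is at least `2 / (n +
  -- 1)`, and is the identity within `1 / (n + 1)` of them.
  set χ : ℕ → ℝ → ℝ := fun n y => t * (Real.smoothTransition ((n + 1) * y - 1) *
    Real.smoothTransition ((n + 1) * (1 - y) - 1)) with hχdef
  have hχ : ∀ n, ContDiff ℝ ∞ (χ n) := fun n => by
    have := Real.smoothTransition.contDiff (n := ⊤)
    exact contDiff_const.mul ((this.comp (by fun_prop)).mul (this.comp (by fun_prop)))
  have hn : ∀ n : ℕ, (0 : ℝ) < n + 1 := fun n => by positivity
  have hχ0 : ∀ (n : ℕ) (y : ℝ), ¬(1 / ((n : ℝ) + 1) ≤ y ∧ y ≤ 1 - 1 / ((n : ℝ) + 1)) →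
      χ n y = 0 := by
    intro n y hy
    rw [not_and_or, not_le, not_le] at hy
    rcases hy with hy | hy
    · have : (n + 1) * y - 1 ≤ 0 := by
        rw [lt_div_iff₀ (hn n)] at hy
        linarith
      simp only [hχdef]
      rw [Real.smoothTransition.zero_of_nonpos this]
      ring
    · have : (n + 1) * (1 - y) - 1 ≤ 0 := by
        have hy' : 1 - y < 1 / ((n : ℝ) + 1) := by linarith
        rw [lt_div_iff₀ (hn n)] at hy'
        linarith
      simp only [hχdef]
      rw [Real.smoothTransition.zero_of_nonpos this]
      ring
  refine approxGroup_of_ae_eventually (measurable_sqRot t) (fun n => ⟨shear (χ n),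
    shear_mem_stripGroup q (hχ n) (one_div_pos.2 (hn n)) (hχ0 n)⟩) ?_
  filter_upwards [Sq.ae_irrational] with x hx
  have hpos : (0 : ℝ) < x.2 := lt_of_le_of_ne x.2.2.1 fun h => hx.2 ⟨0, by simpa using h⟩
  have hlim : ∀ c : ℝ, 0 < c → Tendsto (fun n : ℕ => ((n : ℝ) + 1) * c) atTop atTop :=
    fun c hc => (tendsto_atTop_add_const_right _ 1 tendsto_natCast_atTop_atTop).atTop_mul_const hc
  filter_upwards [(hlim _ hpos).eventually_ge_atTop 2,
    (hlim _ (sub_pos.2 x.2.2.2)).eventually_ge_atTop 2] with n h1 h2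
  have hval : χ n x.2 = t := by
    simp only [hχdef]
    rw [Real.smoothTransition.one_of_one_le (by linarith),
      Real.smoothTransition.one_of_one_le (by linarith)]
    ring
  rw [stripGroup.toSq_apply]
  ext
  · change Int.fract ((x.1 : ℝ) + χ n x.2) = Int.fract ((x.1 : ℝ) + t)
    rw [hval]
  · exact Int.fract_eq_self.2 x.2.2

/-! ### Reflections of rectangles -/

/-- The open rectangle with lower left corner `lo` and upper right corner `hi`. -/
def InBox (lo hi y : ℝ × ℝ) : Prop :=
  (lo.1 < y.1 ∧ y.1 < hi.1) ∧ lo.2 < y.2 ∧ y.2 < hi.2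

theorem InBox.reflect {lo hi y : ℝ × ℝ} (h : InBox lo hi y) : InBox lo hi (lo + hi - y) := by
  obtain ⟨⟨h1, h2⟩, h3, h4⟩ := h
  refine ⟨⟨?_, ?_⟩, ?_, ?_⟩ <;> simp only [Prod.fst_sub, Prod.fst_add, Prod.snd_sub, Prod.snd_add]
    <;> linarith

/-- The rectangle lies in the unit square. -/
structure BoxInSquare (lo hi : ℝ × ℝ) : Prop where
  lo_fst : 0 ≤ lo.1
  lo_snd : 0 ≤ lo.2
  hi_fst : hi.1 ≤ 1
  hi_snd : hi.2 ≤ 1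

theorem BoxInSquare.pt_wrap {lo hi : ℝ × ℝ} (h : BoxInSquare lo hi) {y : ℝ × ℝ}
    (hy : InBox lo hi y) : (Sq.wrap y).pt = y := by
  obtain ⟨⟨h1, h2⟩, h3, h4⟩ := hy
  ext
  · exact Int.fract_eq_self.2 ⟨h.lo_fst.trans h1.le, h2.trans_le h.hi_fst⟩
  · exact Int.fract_eq_self.2 ⟨h.lo_snd.trans h3.le, h4.trans_le h.hi_snd⟩

open Classical in
/-- The point reflection of a rectangle in the unit square, extended by the identity. -/
noncomputable def boxTurn (lo hi : ℝ × ℝ) (h : BoxInSquare lo hi) : Equiv.Perm Sq :=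
  Function.Involutive.toPerm
    (fun x => if InBox lo hi x.pt then Sq.wrap (lo + hi - x.pt) else x) (by
      intro x
      by_cases hx : InBox lo hi x.pt
      · have e := h.pt_wrap hx.reflect
        simp only [if_pos hx, e, if_pos hx.reflect, sub_sub_cancel, Sq.wrap_pt]
      · simp only [if_neg hx])

theorem boxTurn_pt_of_mem {lo hi : ℝ × ℝ} (h : BoxInSquare lo hi) {x : Sq}
    (hx : InBox lo hi x.pt) : (boxTurn lo hi h x).pt = lo + hi - x.pt := by
  have : boxTurn lo hi h x = Sq.wrap (lo + hi - x.pt) := if_pos hx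
  rw [this, h.pt_wrap hx.reflect]

theorem boxTurn_of_notMem {lo hi : ℝ × ℝ} (h : BoxInSquare lo hi) {x : Sq}
    (hx : ¬InBox lo hi x.pt) : boxTurn lo hi h x = x := if_neg hx

theorem measurable_boxTurn {lo hi : ℝ × ℝ} (h : BoxInSquare lo hi) :
    Measurable (boxTurn lo hi h) := by
  have ho : IsOpen {y : ℝ × ℝ | InBox lo hi y} :=
    ((isOpen_lt continuous_const continuous_fst).inter
      (isOpen_lt continuous_fst continuous_const)).inter
      ((isOpen_lt continuous_const continuous_snd).inter
        (isOpen_lt continuous_snd continuous_const))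
  exact Measurable.ite (Sq.measurable_pt ho.measurableSet)
    (Sq.measurable_wrap.comp (measurable_const.sub Sq.measurable_pt)) measurable_id

/-! ### Transformations repeated in vertical strips -/

/-- The square as the union of `q` copies of itself, compressed horizontally. -/
noncomputable def columnEquiv (q : ℕ+) : Sq ≃ Fin q × Sq :=
  (Equiv.prodCongr (splitIco q) (Equiv.refl _)).trans (Equiv.prodAssoc _ _ _)

/-- The transformation that acts in each of `q` vertical strips like `g` on the square. -/
noncomputable def inColumns (q : ℕ+) : Equiv.Perm Sq →* Equiv.Perm Sq where
  toFun g := (columnEquiv q).trans ((Equiv.prodCongr (Equiv.refl _) g).trans (columnEquiv q).symm)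
  map_one' := by ext x <;> simp
  map_mul' g g' := Equiv.ext fun x => by simp [Prod.map]

theorem inColumns_apply (q : ℕ+) (g : Equiv.Perm Sq) (x : Sq) :
    inColumns q g x = (columnEquiv q).symm ((columnEquiv q x).1, g (columnEquiv q x).2) := rfl

theorem measurable_columnEquiv (q : ℕ+) : Measurable (columnEquiv q) :=
  MeasurableEquiv.prodAssoc.measurable.comp
    (((measurable_splitIco q).comp measurable_fst).prodMk measurable_snd)

theorem measurable_columnEquiv_symm (q : ℕ+) : Measurable (columnEquiv q).symm :=
  (((measurable_splitIco_symm q).comp measurable_fst).prodMk measurable_snd).comp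
    MeasurableEquiv.prodAssoc.symm.measurable

theorem measurable_inColumns (q : ℕ+) {g : Equiv.Perm Sq} (hg : Measurable g) :
    Measurable (inColumns q g) :=
  (measurable_columnEquiv_symm q).comp
    ((measurable_fst.comp (measurable_columnEquiv q)).prodMk
      (hg.comp (measurable_snd.comp (measurable_columnEquiv q))))

theorem pt_columnEquiv_symm (q : ℕ+) (i : Fin q) (y : Sq) :
    ((columnEquiv q).symm (i, y)).pt = (((i : ℕ) + y.pt.1) / q, y.pt.2) := rfl

theorem pt_eq_of_columnEquiv (q : ℕ+) (x : Sq) :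
    x.pt = ((((columnEquiv q x).1 : ℕ) + (columnEquiv q x).2.pt.1) / q,
      (columnEquiv q x).2.pt.2) := by
  conv_lhs => rw [← (columnEquiv q).symm_apply_apply x]
  rfl

/-- The affine map `(ξ, η) ↦ (c₁ + h₁ ξ, c₂ + h₂ η)`. -/
noncomputable def scaleShift (c h : ℝ × ℝ) (h1 : h.1 ≠ 0) (h2 : h.2 ≠ 0) :
    Equiv.Perm (ℝ × ℝ) where
  toFun x := (c.1 + h.1 * x.1, c.2 + h.2 * x.2)
  invFun x := ((x.1 - c.1) / h.1, (x.2 - c.2) / h.2)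
  left_inv x := by ext <;> simp [h1, h2]
  right_inv x := by
    ext
    · simp only; field_simp; ring
    · simp only; field_simp; ring

theorem scaleShift_conj_isPlaneDiffeo (c h : ℝ × ℝ) (h1 : h.1 ≠ 0) (h2 : h.2 ≠ 0)
    {E : Equiv.Perm (ℝ × ℝ)} (hE : IsPlaneDiffeo E) :
    IsPlaneDiffeo (scaleShift c h h1 h2 * E * (scaleShift c h h1 h2)⁻¹) := by
  refine hE.conj (c := h.1 * h.2) ?_ ?_ fun x => ?_
  · change ContDiff ℝ ∞ fun x : ℝ × ℝ => (c.1 + h.1 * x.1, c.2 + h.2 * x.2)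
    fun_prop
  · change ContDiff ℝ ∞ fun x : ℝ × ℝ => ((x.1 - c.1) / h.1, (x.2 - c.2) / h.2)
    fun_prop
  · have hd : HasFDerivAt (fun x : ℝ × ℝ => (c.1 + h.1 * x.1, c.2 + h.2 * x.2))
        (planeMatrix h.1 0 0 h.2) x := by
      refine ((((hasFDerivAt_fst (𝕜 := ℝ) (p := x)).const_mul h.1).const_add c.1).prodMk
        (((hasFDerivAt_snd (𝕜 := ℝ) (p := x)).const_mul h.2).const_add c.2)).congr_fderiv ?_
      ext <;> simp [planeMatrix]
    have e : ⇑(scaleShift c h h1 h2) =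
        fun x : ℝ × ℝ => (c.1 + h.1 * x.1, c.2 + h.2 * x.2) := rfl
    rw [e, hd.fderiv, det_planeMatrix]
    ring

/-- Reflections of rectangles, performed in each of `q` vertical strips, are limits of
diffeomorphisms of the strip. -/
theorem inColumns_boxTurn_mem_approxGroup (q : ℕ+) {lo hi : ℝ × ℝ} (hb : BoxInSquare lo hi)
    (hlt1 : lo.1 < hi.1) (hlt2 : lo.2 < hi.2) :
    inColumns q (boxTurn lo hi hb) ∈ approxGroup q := by
  obtain ⟨E, hE, hEsupp, hElim⟩ := exists_squareHalfTurn
  have hq : (0 : ℝ) < q := by exact_mod_cast q.pos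
  -- Half side lengths `w` and centre `c` of the rectangle after compression into the first of the
  -- `q` vertical strips.
  set w : ℝ × ℝ := ((hi.1 - lo.1) / 2 / q, (hi.2 - lo.2) / 2) with hw
  set c : ℝ × ℝ := ((lo.1 + hi.1) / 2 / q, (lo.2 + hi.2) / 2) with hc
  have hw1 : 0 < w.1 := by simp only [hw]; have := sub_pos.2 hlt1; positivity
  have hw2 : 0 < w.2 := by simp only [hw]; have := sub_pos.2 hlt2; positivity
  set A := scaleShift c w hw1.ne' hw2.ne' with hA
  set G : ℕ → Equiv.Perm (ℝ × ℝ) := fun n => A * E n * A⁻¹ with hG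
  have hAinv : ∀ x : ℝ × ℝ, A⁻¹ x = ((x.1 - c.1) / w.1, (x.2 - c.2) / w.2) := fun x => rfl
  have hAapp : ∀ x : ℝ × ℝ, A x = (c.1 + w.1 * x.1, c.2 + w.2 * x.2) := fun x => rfl
  have hGd : ∀ n, IsPlaneDiffeo (G n) := fun n =>
    scaleShift_conj_isPlaneDiffeo c w hw1.ne' hw2.ne' (hE n)
  have hGfix : ∀ n x, E n (A⁻¹ x) = A⁻¹ x → G n x = x := fun n x hx => by
    simp only [hG, Equiv.Perm.mul_apply]
    rw [hx, perm_apply_inv_self]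
  -- With this `ℓ` the slab `0 ≤ ℓ ≤ 1` is one vertical strip of width `1/q`, and periodization
  -- copies the half-turn into all of them, commuting with `R_{1/q}`.
  set ℓ : ℝ × ℝ →L[ℝ] ℝ := (q : ℝ) • ContinuousLinearMap.fst ℝ ℝ ℝ with hℓ
  set v : ℝ × ℝ := (1 / (q : ℝ), 0) with hv
  have hℓv : ℓ v = 1 := by simp [hℓ, hv, hq.ne']
  have hℓx : ∀ x : ℝ × ℝ, ℓ x = q * x.1 := fun x => rfl
  have hlo : lo.1 = q * (c.1 - w.1) := by simp only [hc, hw]; field_simp; ring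
  have hhi : hi.1 = q * (c.1 + w.1) := by simp only [hc, hw]; field_simp; ring
  have hlo' : lo.2 = c.2 - w.2 := by simp only [hc, hw]; ring
  have hhi' : hi.2 = c.2 + w.2 := by simp only [hc, hw]; ring
  have hGsupp : ∀ n, ∃ δ > 0, ∀ x : ℝ × ℝ,
      (1 - δ < |(x.1 - c.1) / w.1| ∨ 1 - δ < |(x.2 - c.2) / w.2|) → G n x = x := fun n => by
    obtain ⟨δ, hδ, h⟩ := hEsupp n
    refine ⟨δ, hδ, fun x hx => hGfix n x (h _ ?_)⟩
    rw [Prod.norm_def, lt_max_iff, hAinv, Real.norm_eq_abs, Real.norm_eq_abs]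
    exact hx
  have hfar : ∀ δ a b t : ℝ, 0 < b → ¬(a - b + b * δ ≤ t ∧ t ≤ a + b - b * δ) →
      1 - δ < |(t - a) / b| := fun δ a b t hb hn => by
    rw [lt_abs, lt_div_iff₀ hb, ← neg_div, lt_div_iff₀ hb]
    by_contra hcon
    rw [not_or, not_lt, not_lt] at hcon
    exact hn ⟨by linarith [hcon.2], by linarith [hcon.1]⟩
  have hslab : ∀ n, SlabSupported ℓ (G n) := fun n => by
    obtain ⟨δ, hδ, h⟩ := hGsupp n
    refine ⟨q * (w.1 * δ), by positivity, fun x hx => h x (Or.inl (hfar _ _ _ _ hw1 ?_))⟩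
    rintro ⟨h1, h2⟩
    have h0 := hb.lo_fst
    have h3 := hb.hi_fst
    rw [hlo] at h0
    rw [hhi] at h3
    refine hx ⟨?_, ?_⟩ <;> rw [hℓx]
    · have := mul_le_mul_of_nonneg_left h1 hq.le
      linarith
    · have := mul_le_mul_of_nonneg_left h2 hq.le
      linarith
  have hslab2 : ∀ n, SlabSupported (ContinuousLinearMap.snd ℝ ℝ ℝ) (G n) := fun n => by
    obtain ⟨δ, hδ, h⟩ := hGsupp n
    refine ⟨w.2 * δ, by positivity, fun x hx => h x (Or.inr (hfar _ _ _ _ hw2 ?_))⟩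
    rintro ⟨h1, h2⟩
    have h0 := hb.lo_snd
    have h3 := hb.hi_snd
    rw [hlo'] at h0
    rw [hhi'] at h3
    exact hx ⟨by simp only [ContinuousLinearMap.coe_snd']; linarith,
      by simp only [ContinuousLinearMap.coe_snd']; linarith⟩
  have hFmem : ∀ n, periodizePerm hℓv (G n) (hslab n) ∈ stripGroup q := fun n => by
    refine ⟨periodizePerm_isPlaneDiffeo hℓv (hslab n) (hGd n), periodize_add hℓv (G n), ?_⟩
    obtain ⟨δ, hδ, h⟩ := hslab2 n
    refine ⟨δ, hδ, fun x hx => ?_⟩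
    change periodize ℓ v (G n) x = x
    rw [periodize, h, sub_add_cancel]
    simpa [hv] using hx
  refine approxGroup_of_ae_eventually (measurable_inColumns q (measurable_boxTurn hb))
    (fun n => ⟨_, hFmem n⟩) (Eventually.of_forall fun x => ?_)
  set i := (columnEquiv q x).1 with hi_def
  set y := (columnEquiv q x).2 with hy
  have hx : x.pt = (((i : ℕ) + y.pt.1) / q, y.pt.2) := pt_eq_of_columnEquiv q x
  have hfloor : ⌊ℓ x.pt⌋ = (i : ℕ) := by
    rw [hℓx, hx, Int.floor_eq_iff]
    simp only [Int.cast_natCast]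
    rw [mul_div_cancel₀ _ hq.ne']
    exact ⟨by linarith [y.1.2.1, show y.pt.1 = y.1 from rfl],
      by linarith [y.1.2.2, show y.pt.1 = y.1 from rfl]⟩
  have hF : ∀ n, periodizePerm hℓv (G n) (hslab n) x.pt =
      G n (y.pt.1 / q, y.pt.2) + ((i : ℕ) / (q : ℝ), 0) := fun n => by
    change periodize ℓ v (G n) x.pt = _
    rw [periodize, hfloor, hx]
    congr 2
    · ext
      · simp [hv]; ring
      · simp [hv]
    · ext
      · simp [hv]; ring
      · simp [hv]
  by_cases hbox : InBox lo hi y.pt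
  · have hnorm : ‖A⁻¹ (y.pt.1 / q, y.pt.2)‖ < 1 := by
      obtain ⟨⟨h1, h2⟩, h3, h4⟩ := hbox
      rw [hlo] at h1
      rw [hhi] at h2
      rw [hlo'] at h3
      rw [hhi'] at h4
      rw [norm_lt_one_iff, hAinv]
      simp only
      rw [abs_div, abs_of_pos hw1, div_lt_one hw1, abs_div, abs_of_pos hw2, div_lt_one hw2, abs_lt,
        abs_lt]
      have e1 : c.1 - w.1 < y.pt.1 / q := by rw [lt_div_iff₀ hq]; linarith
      have e2 : y.pt.1 / q < c.1 + w.1 := by rw [div_lt_iff₀ hq]; linarith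
      exact ⟨⟨by linarith, by linarith⟩, by linarith, by linarith⟩
    filter_upwards [hElim _ hnorm] with n hn
    rw [stripGroup.toSq_apply, ← Sq.wrap_pt (inColumns q (boxTurn lo hi hb) x)]
    congr 1
    rw [inColumns_apply, pt_columnEquiv_symm, ← hy, boxTurn_pt_of_mem hb hbox, hF n]
    have e : G n (y.pt.1 / q, y.pt.2) = A (-A⁻¹ (y.pt.1 / q, y.pt.2)) := by
      rw [← hn]; rfl
    rw [e, hAinv, hAapp]
    ext
    · simp only [Prod.fst_add, Prod.fst_neg, Prod.fst_sub]
      rw [mul_neg, mul_div_cancel₀ _ hw1.ne', hlo, hhi, ← hi_def]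
      field_simp
      ring
    · simp only [Prod.snd_add, Prod.snd_neg, Prod.snd_sub]
      rw [mul_neg, mul_div_cancel₀ _ hw2.ne', hlo', hhi']
      ring
  -- Off the open rectangle, edges included, every `G n` is the identity, so no null set has to be
  -- removed.
  · refine Eventually.of_forall fun n => ?_
    have hfix : G n (y.pt.1 / q, y.pt.2) = (y.pt.1 / q, y.pt.2) := by
      obtain ⟨δ, hδ, h⟩ := hGsupp n
      apply h
      by_contra hcon
      rw [not_or, not_lt, not_lt, abs_le, abs_le, le_div_iff₀ hw1, div_le_iff₀ hw1,
        le_div_iff₀ hw2, div_le_iff₀ hw2] at hcon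
      obtain ⟨⟨h1, h2⟩, h3, h4⟩ := hcon
      simp only at h1 h2 h3 h4
      have hp1 := mul_pos hw1 hδ
      have hp2 := mul_pos hw2 hδ
      have e1 : c.1 - w.1 < y.pt.1 / q := by linarith
      have e2 : y.pt.1 / q < c.1 + w.1 := by linarith
      rw [lt_div_iff₀ hq] at e1
      rw [div_lt_iff₀ hq] at e2
      refine hbox ⟨⟨?_, ?_⟩, ?_, ?_⟩
      · rw [hlo]; linarith
      · rw [hhi]; linarith
      · rw [hlo']; linarith
      · rw [hhi']; linarith
    rw [stripGroup.toSq_apply, inColumns_apply, ← hy, boxTurn_of_notMem hb hbox, hy,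
      Prod.mk.eta, Equiv.symm_apply_apply, ← Sq.wrap_pt x]
    congr 1
    rw [Sq.wrap_pt, hF n, hfix, hx]
    ext
    · simp only [Prod.fst_add]; ring
    · simp

/-! ### Permutations of the cells of a grid -/

/-- The cell of a point of the square in the `k × s` grid, with the position inside the cell. -/
noncomputable def gridEquiv (k s : ℕ+) : Sq ≃ (Fin k × Fin s) × Sq :=
  (Equiv.prodCongr (splitIco k) (splitIco s)).trans (Equiv.prodProdProdComm _ _ _ _)

/-- The transformation that permutes the cells of the `k × s` grid by translations. -/
noncomputable def gridPerm (k s : ℕ+) : Equiv.Perm (Fin k × Fin s) →* Equiv.Perm Sq where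
  toFun σ := (gridEquiv k s).trans ((Equiv.prodCongr σ (Equiv.refl _)).trans (gridEquiv k s).symm)
  map_one' := by ext x <;> simp
  map_mul' g g' := Equiv.ext fun x => by simp [Prod.map]

theorem gridPerm_symm_apply (k s : ℕ+) (σ : Equiv.Perm (Fin k × Fin s)) (c : Fin k × Fin s)
    (t : Sq) : gridPerm k s σ ((gridEquiv k s).symm (c, t)) = (gridEquiv k s).symm (σ c, t) := by
  simp [gridPerm]

theorem pt_gridEquiv_symm (k s : ℕ+) (c : Fin k × Fin s) (t : Sq) :
    ((gridEquiv k s).symm (c, t)).pt =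
      (((c.1 : ℕ) + t.pt.1) / k, ((c.2 : ℕ) + t.pt.2) / s) := rfl

theorem Sq.pt_injective : Function.Injective Sq.pt := fun x y h => by
  rw [← Sq.wrap_pt x, h, Sq.wrap_pt]

/-- Two adjacent rectangles are exchanged by three point reflections. -/
theorem boxTurn_exchange {lo hi e : ℝ × ℝ} (hA : BoxInSquare lo hi)
    (hB : BoxInSquare (lo + e) (hi + e)) (hR : BoxInSquare lo (hi + e)) (he : 0 ≤ e)
    (hd : ∀ y, InBox lo hi y → ¬InBox (lo + e) (hi + e) y) (x : Sq) :
    (InBox lo hi x.pt → ((boxTurn _ _ hR * boxTurn _ _ hB * boxTurn _ _ hA) x).pt = x.pt + e) ∧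
    (InBox (lo + e) (hi + e) x.pt →
      ((boxTurn _ _ hR * boxTurn _ _ hB * boxTurn _ _ hA) x).pt = x.pt - e) ∧
    (¬InBox lo (hi + e) x.pt → (boxTurn _ _ hR * boxTurn _ _ hB * boxTurn _ _ hA) x = x) := by
  have he1 : 0 ≤ e.1 := he.1
  have he2 : 0 ≤ e.2 := he.2
  have hAR : ∀ y, InBox lo hi y → InBox lo (hi + e) y := fun y hy =>
    ⟨⟨hy.1.1, by rw [Prod.fst_add]; linarith [hy.1.2]⟩, hy.2.1,
      by rw [Prod.snd_add]; linarith [hy.2.2]⟩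
  have hBR : ∀ y, InBox (lo + e) (hi + e) y → InBox lo (hi + e) y := fun y hy =>
    ⟨⟨by have := hy.1.1; rw [Prod.fst_add] at this; linarith, hy.1.2⟩,
      by have := hy.2.1; rw [Prod.snd_add] at this; linarith, hy.2.2⟩
  simp only [Equiv.Perm.mul_apply]
  refine ⟨fun hx => ?_, fun hx => ?_, fun hx => ?_⟩
  -- Reflection in the first rectangle followed by reflection in the union is the translation by
  -- `e`; the reflection in the second rectangle does not move the point in between.
  · have e1 := boxTurn_pt_of_mem hA hx
    have m1 : InBox lo hi (boxTurn _ _ hA x).pt := e1 ▸ hx.reflect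
    rw [boxTurn_of_notMem hB (hd _ m1), boxTurn_pt_of_mem hR (hAR _ m1), e1]
    abel
  · rw [boxTurn_of_notMem hA fun h => hd _ h hx]
    have e1 := boxTurn_pt_of_mem hB hx
    have m1 : InBox (lo + e) (hi + e) (boxTurn _ _ hB x).pt := e1 ▸ hx.reflect
    rw [boxTurn_pt_of_mem hR (hBR _ m1), e1]
    abel
  · rw [boxTurn_of_notMem hA fun h => hx (hAR _ h), boxTurn_of_notMem hB fun h => hx (hBR _ h),
      boxTurn_of_notMem hR hx]

/-- The exchange of two adjacent cells of a grid, performed in each of `q` vertical strips. -/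
theorem inColumns_gridPerm_swap_adjacent (q k s : ℕ+) (a b : Fin k × Fin s)
    (hab : ((b.1 : ℕ) = a.1 + 1 ∧ (b.2 : ℕ) = a.2) ∨ ((b.1 : ℕ) = a.1 ∧ (b.2 : ℕ) = a.2 + 1)) :
    inColumns q (gridPerm k s (Equiv.swap a b)) ∈ approxGroup q := by
  have hk : (0 : ℝ) < k := by exact_mod_cast k.pos
  have hs : (0 : ℝ) < s := by exact_mod_cast s.pos
  have hq : (0 : ℝ) < q := by exact_mod_cast q.pos
  set d : ℝ × ℝ := (((b.1 : ℕ) : ℝ) - (a.1 : ℕ), ((b.2 : ℕ) : ℝ) - (a.2 : ℕ)) with hd_def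
  have hd : d = (1, 0) ∨ d = (0, 1) := by
    rcases hab with ⟨h1, h2⟩ | ⟨h1, h2⟩
    · left; simp [hd_def, h1, h2]
    · right; simp [hd_def, h1, h2]
  set lo : ℝ × ℝ := (((a.1 : ℕ) : ℝ) / k, ((a.2 : ℕ) : ℝ) / s) with hlo
  set hi : ℝ × ℝ := ((((a.1 : ℕ) : ℝ) + 1) / k, (((a.2 : ℕ) : ℝ) + 1) / s) with hhi
  set e : ℝ × ℝ := (d.1 / k, d.2 / s) with he_def
  have hd1 : 0 ≤ d.1 := by rcases hd with h | h <;> simp [h]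
  have hd2 : 0 ≤ d.2 := by rcases hd with h | h <;> simp [h]
  have he : 0 ≤ e := ⟨div_nonneg hd1 hk.le, div_nonneg hd2 hs.le⟩
  have hlo0 : 0 ≤ lo := ⟨by positivity, by positivity⟩
  have hb1 : ((b.1 : ℕ) : ℝ) + 1 ≤ k := by exact_mod_cast b.1.2
  have hb2 : ((b.2 : ℕ) : ℝ) + 1 ≤ s := by exact_mod_cast b.2.2
  have hie1 : (hi + e).1 = (((b.1 : ℕ) : ℝ) + 1) / k := by
    simp only [hhi, he_def, hd_def, Prod.fst_add]; ring
  have hie2 : (hi + e).2 = (((b.2 : ℕ) : ℝ) + 1) / s := by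
    simp only [hhi, he_def, hd_def, Prod.snd_add]; ring
  have hie1' : (hi + e).1 ≤ 1 := by rw [hie1, div_le_one hk]; exact hb1
  have hie2' : (hi + e).2 ≤ 1 := by rw [hie2, div_le_one hs]; exact hb2
  have hle1 : (lo + e).1 = ((b.1 : ℕ) : ℝ) / k := by
    simp only [hlo, he_def, hd_def, Prod.fst_add]; ring
  have hle2 : (lo + e).2 = ((b.2 : ℕ) : ℝ) / s := by
    simp only [hlo, he_def, hd_def, Prod.snd_add]; ring
  have hR : BoxInSquare lo (hi + e) := ⟨hlo0.1, hlo0.2, hie1', hie2'⟩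
  have hA : BoxInSquare lo hi := ⟨hlo0.1, hlo0.2, by
    have := he.1; simp only [Prod.fst_add, Prod.fst_zero] at this hie1'; linarith, by
    have := he.2; simp only [Prod.snd_add, Prod.snd_zero] at this hie2'; linarith⟩
  have hB : BoxInSquare (lo + e) (hi + e) :=
    ⟨by rw [hle1]; positivity, by rw [hle2]; positivity, hie1', hie2'⟩
  have hdisj : ∀ y, InBox lo hi y → ¬InBox (lo + e) (hi + e) y := by
    rintro y ⟨⟨-, h2⟩, -, h4⟩ ⟨⟨h5, -⟩, h7, -⟩
    simp only [Prod.fst_add, Prod.snd_add, hlo, hhi, he_def] at h2 h4 h5 h7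
    rcases hd with h | h <;> simp only [h] at h5 h7
    · rw [← add_div] at h5; linarith
    · rw [← add_div] at h7; linarith
  have hlt1 : lo.1 < hi.1 := div_lt_div_of_pos_right (by linarith) hk
  have hlt2 : lo.2 < hi.2 := div_lt_div_of_pos_right (by linarith) hs
  have hmem : inColumns q (boxTurn _ _ hR * boxTurn _ _ hB * boxTurn _ _ hA) ∈ approxGroup q := by
    rw [map_mul, map_mul]
    refine mul_mem (mul_mem ?_ ?_) ?_
    · exact inColumns_boxTurn_mem_approxGroup q hR
        (hlt1.trans_le (le_add_of_nonneg_right he.1)) (hlt2.trans_le (le_add_of_nonneg_right he.2))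
    · exact inColumns_boxTurn_mem_approxGroup q hB (add_lt_add_left hlt1 _)
        (add_lt_add_left hlt2 _)
    · exact inColumns_boxTurn_mem_approxGroup q hA hlt1 hlt2
  -- Reflections act on open rectangles, the swap on half-open cells. The two maps agree off the
  -- edges of the cells.
  refine approxGroup_of_ae_eq hmem ?_
  filter_upwards [Sq.ae_irrational] with x hx
  rw [inColumns_apply, inColumns_apply]
  congr 2
  obtain ⟨⟨c, t⟩, hct⟩ := (gridEquiv k s).symm.surjective (columnEquiv q x).2
  have hxpt := pt_eq_of_columnEquiv q x
  rw [← hct, pt_gridEquiv_symm] at hxpt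
  have ht1 : 0 < t.pt.1 := lt_of_le_of_ne t.1.2.1 fun h0 => hx.1 ⟨
    ((((columnEquiv q x).1 : ℕ) : ℚ) + ((c.1 : ℕ) : ℚ) / (k : ℕ)) / (q : ℕ), by
      have h1 := congrArg Prod.fst hxpt
      simp only at h1
      rw [show (x.1 : ℝ) = x.pt.1 from rfl, h1, show t.pt.1 = 0 from h0.symm]
      push_cast
      ring⟩
  have ht2 : 0 < t.pt.2 := lt_of_le_of_ne t.2.2.1 fun h0 => hx.2 ⟨((c.2 : ℕ) : ℚ) / (s : ℕ), by
      have h1 := congrArg Prod.snd hxpt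
      simp only at h1
      rw [show (x.2 : ℝ) = x.pt.2 from rfl, h1, show t.pt.2 = 0 from h0.symm]
      push_cast
      ring⟩
  have ht1' : t.pt.1 < 1 := t.1.2.2
  have ht2' : t.pt.2 < 1 := t.2.2.2
  obtain ⟨hcA, hcB, hcR⟩ := boxTurn_exchange hA hB hR he hdisj ((gridEquiv k s).symm (c, t))
  rw [← hct, gridPerm_symm_apply]
  have hkpos : ∀ u v : ℝ, u / k < v / k ↔ u < v := fun u v => div_lt_div_iff_of_pos_right hk
  have hspos : ∀ u v : ℝ, u / s < v / s ↔ u < v := fun u v => div_lt_div_iff_of_pos_right hs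
  by_cases hca : c = a
  · subst hca
    rw [Equiv.swap_apply_left]
    apply Sq.pt_injective
    rw [hcA, pt_gridEquiv_symm, pt_gridEquiv_symm]
    · ext
      · simp only [he_def, hd_def, Prod.fst_add]; ring
      · simp only [he_def, hd_def, Prod.snd_add]; ring
    · rw [pt_gridEquiv_symm]
      refine ⟨⟨?_, ?_⟩, ?_, ?_⟩ <;> simp only [hlo, hhi, hkpos, hspos] <;> linarith
  by_cases hcb : c = b
  · subst hcb
    rw [Equiv.swap_apply_right]
    apply Sq.pt_injective
    rw [hcB, pt_gridEquiv_symm, pt_gridEquiv_symm]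
    · ext
      · simp only [he_def, hd_def, Prod.fst_sub]; ring
      · simp only [he_def, hd_def, Prod.snd_sub]; ring
    · rw [pt_gridEquiv_symm]
      refine ⟨⟨?_, ?_⟩, ?_, ?_⟩
      · rw [hle1, hkpos]; linarith
      · rw [hie1, hkpos]; linarith
      · rw [hle2, hspos]; linarith
      · rw [hie2, hspos]; linarith
  · rw [Equiv.swap_apply_of_ne_of_ne hca hcb]
    apply hcR
    rw [pt_gridEquiv_symm]
    rintro ⟨⟨h1, h2⟩, h3, h4⟩
    rw [hie1, hkpos] at h2
    rw [hie2, hspos] at h4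
    simp only [hlo, hkpos, hspos] at h1 h3
    have g1 : ((a.1 : ℕ) : ℝ) < (c.1 : ℕ) + 1 := by linarith
    have g2 : ((c.1 : ℕ) : ℝ) < (b.1 : ℕ) + 1 := by linarith
    have g3 : ((a.2 : ℕ) : ℝ) < (c.2 : ℕ) + 1 := by linarith
    have g4 : ((c.2 : ℕ) : ℝ) < (b.2 : ℕ) + 1 := by linarith
    norm_cast at g1 g2 g3 g4
    have hca' : ¬((c.1 : ℕ) = a.1 ∧ (c.2 : ℕ) = a.2) := fun h =>
      hca (Prod.ext (Fin.ext h.1) (Fin.ext h.2))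
    have hcb' : ¬((c.1 : ℕ) = b.1 ∧ (c.2 : ℕ) = b.2) := fun h =>
      hcb (Prod.ext (Fin.ext h.1) (Fin.ext h.2))
    omega

/-- Transpositions in a subgroup of permutations: `swap a b` and `swap b c` give `swap a c`. -/
theorem swap_mem_trans {α : Type*} [DecidableEq α] {S : Subgroup (Equiv.Perm α)} {a b c : α}
    (h1 : Equiv.swap a b ∈ S) (h2 : Equiv.swap b c ∈ S) : Equiv.swap a c ∈ S := by
  by_cases hab : a = b
  · rwa [hab]
  by_cases hac : a = c
  · rw [hac, Equiv.swap_self]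
    exact S.one_mem
  · have := Equiv.swap_mul_swap_mul_swap hab hac
    rw [Equiv.swap_comm, ← this]
    exact mul_mem (mul_mem h2 h1) h2

/-- A subgroup that contains the exchanges of adjacent cells of a grid contains all permutations. -/
theorem eq_top_of_adjacent_swaps {k s : ℕ+} {S : Subgroup (Equiv.Perm (Fin k × Fin s))}
    (h : ∀ a b : Fin k × Fin s, ((b.1 : ℕ) = a.1 + 1 ∧ (b.2 : ℕ) = a.2) ∨
      ((b.1 : ℕ) = a.1 ∧ (b.2 : ℕ) = a.2 + 1) → Equiv.swap a b ∈ S) (σ) : σ ∈ S := by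
  have hrow : ∀ (i : ℕ) (hi : i < k) (j : Fin s),
      Equiv.swap ((⟨0, k.pos⟩, j) : Fin k × Fin s) (⟨i, hi⟩, j) ∈ S := by
    intro i
    induction i with
    | zero => intro hi j; rw [Equiv.swap_self]; exact S.one_mem
    | succ i ih => exact fun hi j => swap_mem_trans (ih (by omega) j) (h _ _ (Or.inl ⟨rfl, rfl⟩))
  have hcol : ∀ (j : ℕ) (hj : j < s),
      Equiv.swap ((⟨0, k.pos⟩, ⟨0, s.pos⟩) : Fin k × Fin s) (⟨0, k.pos⟩, ⟨j, hj⟩) ∈ S := by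
    intro j
    induction j with
    | zero => intro hj; rw [Equiv.swap_self]; exact S.one_mem
    | succ j ih => exact fun hj => swap_mem_trans (ih (by omega)) (h _ _ (Or.inr ⟨rfl, rfl⟩))
  have hall : ∀ a : Fin k × Fin s, Equiv.swap (⟨0, k.pos⟩, ⟨0, s.pos⟩) a ∈ S := fun a =>
    swap_mem_trans (hcol a.2 a.2.2) (hrow a.1 a.1.2 a.2)
  induction σ using Equiv.Perm.swap_induction_on with
  | one => exact S.one_mem
  | swap_mul f x y _ ih =>
    refine mul_mem (swap_mem_trans ?_ (hall y)) ih
    rw [Equiv.swap_comm]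
    exact hall x

theorem inColumns_gridPerm_mem_approxGroup (q k s : ℕ+) (σ : Equiv.Perm (Fin k × Fin s)) :
    inColumns q (gridPerm k s σ) ∈ approxGroup q :=
  eq_top_of_adjacent_swaps
    (S := (approxGroup q).comap ((inColumns q).comp (gridPerm k s)))
    (fun a b hab => inColumns_gridPerm_swap_adjacent q k s a b hab) σ

/-! ### Equivariant permutations of cells -/

theorem Fin.val_nsmul_one {n : ℕ} [NeZero n] (a : Fin n) : (a : ℕ) • (1 : Fin n) = a := by
  have h : ∀ m : ℕ, ((m • (1 : Fin n) : Fin n) : ℕ) = m % n := fun m => by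
    induction m with
    | zero => simp
    | succ m ih => rw [succ_nsmul, Fin.val_add, ih, Fin.val_one', Nat.mod_add_mod, Nat.add_mod_mod]
  exact Fin.ext (by rw [h, Nat.mod_eq_of_lt a.2])

section Index

variable (q k s : ℕ+)

/-- `cellPerm` as a homomorphism. -/
noncomputable def cellHom : Equiv.Perm ((Fin q × Fin k) × Fin s) →* Equiv.Perm Sq where
  toFun := cellPerm q k s
  map_one' := by ext x <;> simp [cellPerm]
  map_mul' g g' := Equiv.ext fun x => by simp [cellPerm, Prod.map]

variable {k s}

/-- A permutation of the cells of the fundamental domain, extended equivariantly. -/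
def fiberPerm (σ : Equiv.Perm (Fin k × Fin s)) : Equiv.Perm ((Fin q × Fin k) × Fin s) :=
  (Equiv.prodAssoc _ _ _).trans
    ((Equiv.prodCongr (Equiv.refl _) σ).trans (Equiv.prodAssoc _ _ _).symm)

variable {q}

/-- The permutation of the cells that moves the `i`-th column of each fundamental domain by `m i`
fundamental domains. -/
def shiftPerm (m : Fin k → Fin q) : Equiv.Perm ((Fin q × Fin k) × Fin s) where
  toFun x := ((x.1.1 + m x.1.2, x.1.2), x.2)
  invFun x := ((x.1.1 - m x.1.2, x.1.2), x.2)
  left_inv x := by simp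
  right_inv x := by simp

theorem shiftPerm_add (m m' : Fin k → Fin q) :
    shiftPerm (s := s) (m + m') = shiftPerm m * shiftPerm m' := by
  ext x <;> simp [shiftPerm, add_comm, add_left_comm]

/-- Conjugation by a permutation of columns carries the shift of one column to the shift of any
other. -/
theorem shiftPerm_conj (m : Fin k → Fin q) (c : Equiv.Perm (Fin k)) :
    shiftPerm (s := s) (m ∘ c) = (fiberPerm q (Equiv.prodCongr c (Equiv.refl _)))⁻¹ *
      shiftPerm m * fiberPerm q (Equiv.prodCongr c (Equiv.refl _)) := by
  rw [mul_assoc, eq_inv_mul_iff_mul_eq]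
  exact Equiv.ext fun _ => rfl

/-- Rotation by one column width permutes the columns of each fundamental domain cyclically, except
that the last column arrives at position `0` of the next domain. The shift of column `0` makes this
correction. -/
theorem sqRot_eq_cellHom : sqRot (1 / ((q : ℝ) * k)) =
    cellHom q k s (shiftPerm (Pi.single 0 1) *
      fiberPerm q (Equiv.prodCongr (Equiv.addRight 1) (Equiv.refl _))) := by
  have hk : (0 : ℝ) < k := by exact_mod_cast k.pos
  have hq : (0 : ℝ) < q := by exact_mod_cast q.pos
  refine Equiv.ext fun x => ?_
  obtain ⟨⟨⟨⟨i, i'⟩, j⟩, t⟩, rfl⟩ := (cellEquiv q k s).symm.surjective x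
  have e : cellHom q k s (shiftPerm (Pi.single 0 1) *
      fiberPerm q (Equiv.prodCongr (Equiv.addRight 1) (Equiv.refl _)))
        ((cellEquiv q k s).symm (((i, i'), j), t)) = (cellEquiv q k s).symm
        (((i + (Pi.single 0 1 : Fin k → Fin q) (i' + 1), i' + 1), j), t) := by
    simp [cellHom, cellPerm, shiftPerm, fiberPerm]
  rw [e]
  refine Prod.ext ?_ rfl
  apply Subtype.ext
  set y : Set.Ico (0 : ℝ) 1 := ((cellEquiv q k s).symm
        (((i + (Pi.single 0 1 : Fin k → Fin q) (i' + 1), i' + 1), j), t)).1 with hy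
  have hy' : (y : ℝ) = (((i + (Pi.single 0 1 : Fin k → Fin q) (i' + 1) : Fin q) : ℕ) +
      (((i' + 1 : Fin k) : ℕ) + (t.1 : ℝ)) / k) / q := rfl
  change Int.fract ((((i : ℕ) : ℝ) + (((i' : ℕ) : ℝ) + (t.1 : ℝ)) / k) / q + 1 / ((q : ℝ) * k)) = y
  rw [Int.fract_eq_iff]
  refine ⟨y.2.1, y.2.2, ?_⟩
  rw [hy']
  have hval : ((i' + 1 : Fin k) : ℕ) = ((i' : ℕ) + 1) % k := by
    rw [Fin.val_add, Fin.val_one', Nat.add_mod_mod]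
  rcases Nat.lt_or_ge ((i' : ℕ) + 1) k with hlt | hge
  · rw [Nat.mod_eq_of_lt hlt] at hval
    have hne : i' + 1 ≠ 0 := fun h0 => by
      rw [h0] at hval
      simp at hval
    refine ⟨0, ?_⟩
    rw [Pi.single_eq_of_ne hne, add_zero, hval]
    push_cast
    field_simp
    ring
  · have hk' : (i' : ℕ) + 1 = k := le_antisymm i'.2 hge
    have h0 : i' + 1 = 0 := Fin.ext (by rw [hval, hk', Nat.mod_self]; simp)
    have hk'' : ((i' : ℕ) : ℝ) = k - 1 := by rw [eq_sub_iff_add_eq]; exact_mod_cast hk'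
    rw [h0, Pi.single_eq_same, hk'']
    have hval' : ((i + 1 : Fin q) : ℕ) = ((i : ℕ) + 1) % q := by
      rw [Fin.val_add, Fin.val_one', Nat.add_mod_mod]
    rcases Nat.lt_or_ge ((i : ℕ) + 1) q with hlt | hge
    · rw [Nat.mod_eq_of_lt hlt] at hval'
      refine ⟨0, ?_⟩
      rw [hval']
      push_cast [Fin.val_zero]
      field_simp
      ring
    · have hq' : (i : ℕ) + 1 = q := le_antisymm i.2 hge
      have hq'' : ((i : ℕ) : ℝ) = q - 1 := by rw [eq_sub_iff_add_eq]; exact_mod_cast hq'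
      -- Only the last column of the last fundamental domain passes the point `1` of the circle, so
      -- here the integer part is `1`.
      refine ⟨1, ?_⟩
      rw [hval', hq', Nat.mod_self, hq'']
      push_cast [Fin.val_zero]
      field_simp
      ring

/-- Cancelling a permutation inside the fundamental domains from an approximable rotation leaves the
shift of column `0` by one domain. Its conjugates shift the other columns, and products of these
give every `m`. -/
theorem cellHom_shiftPerm_mem_approxGroup (m : Fin k → Fin q) :
    cellHom q k s (shiftPerm m) ∈ approxGroup q := by
  set S := (approxGroup q).comap (cellHom q k s) with hS
  have hfib : ∀ σ : Equiv.Perm (Fin k × Fin s), fiberPerm q σ ∈ S :=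
    inColumns_gridPerm_mem_approxGroup q k s
  have hadd : ∀ m m' : Fin k → Fin q, shiftPerm m ∈ S → shiftPerm m' ∈ S →
      shiftPerm (m + m') ∈ S := fun m m' h h' => by
    rw [shiftPerm_add]
    exact mul_mem h h'
  have hzero : shiftPerm (0 : Fin k → Fin q) ∈ S := by
    have : shiftPerm (s := s) (0 : Fin k → Fin q) = 1 := by ext x <;> simp [shiftPerm]
    rw [this]
    exact S.one_mem
  have h0 : shiftPerm (Pi.single 0 1 : Fin k → Fin q) ∈ S := by
    have h1 := sqRot_mem_approxGroup q (1 / ((q : ℝ) * k))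
    rw [sqRot_eq_cellHom (s := s)] at h1
    exact (Subgroup.mul_mem_cancel_right S (hfib _)).1 h1
  have h1 : ∀ i : Fin k, shiftPerm (Pi.single i 1 : Fin k → Fin q) ∈ S := fun i => by
    have e : (Pi.single i 1 : Fin k → Fin q) = Pi.single 0 1 ∘ Equiv.swap 0 i := by
      funext i'
      simp only [Function.comp_apply, Pi.single_apply]
      congr 1
      rw [Equiv.swap_apply_eq_iff, Equiv.swap_apply_left]
    rw [e, shiftPerm_conj]
    exact mul_mem (mul_mem (inv_mem (hfib _)) h0) (hfib _)
  have h2 : ∀ (i : Fin k) (n : ℕ), shiftPerm (n • Pi.single i 1 : Fin k → Fin q) ∈ S :=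
    fun i n => by
    induction n with
    | zero => rw [zero_smul]; exact hzero
    | succ n ih => rw [succ_nsmul]; exact hadd _ _ ih (h1 i)
  have h3 : ∀ T : Finset (Fin k),
      shiftPerm (∑ i ∈ T, ((m i : Fin q) : ℕ) • Pi.single i 1 : Fin k → Fin q) ∈ S := fun T => by
    induction T using Finset.induction_on with
    | empty => exact hzero
    | insert a T ha ih => rw [Finset.sum_insert ha]; exact hadd _ _ (h2 a _) ih
  have e : m = ∑ i, ((m i : Fin q) : ℕ) • Pi.single i 1 := by
    conv_lhs => rw [← Finset.univ_sum_single m]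
    refine Finset.sum_congr rfl fun i _ => ?_
    rw [← Pi.single_smul, Fin.val_nsmul_one]
  rw [e]
  exact h3 Finset.univ

end Index

/-- The conjugation maps of a twisted AbC construction are approximated by diffeomorphisms. -/
theorem TwistedAbC.h_mem_approxGroup (P : TwistedAbC) (n : ℕ) : P.h n ∈ approxGroup (P.q n) :=
  mul_mem (inColumns_gridPerm_mem_approxGroup (P.q n) (P.k n) (P.s (n + 1)) (P.σ n))
    (cellHom_shiftPerm_mem_approxGroup (s := P.s (n + 1))
      fun i => Fin.ofNat (P.q n) (P.a n ((i : ℕ) / (P.C n : ℕ))))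

/-! ### Polar coordinates -/

/-- The point `√r e^{2πiθ}` of the plane. -/
noncomputable def polarMap (x : ℝ × ℝ) : ℝ × ℝ := Surface.planeRot x.1 (Real.sqrt x.2, 0)

theorem polarMap_eq (x : ℝ × ℝ) : polarMap x =
    (Real.cos (2 * Real.pi * x.1) * Real.sqrt x.2, Real.sin (2 * Real.pi * x.1) * Real.sqrt x.2) := by
  simp [polarMap, Surface.planeRot]

theorem polarMap_normSq {x : ℝ × ℝ} (hx : 0 ≤ x.2) :
    (polarMap x).1 ^ 2 + (polarMap x).2 ^ 2 = x.2 := by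
  rw [polarMap, Surface.planeRot_normSq]
  simp [Real.sq_sqrt hx]

theorem planeRot_planeRot (s t : ℝ) (p : ℝ × ℝ) :
    Surface.planeRot s (Surface.planeRot t p) = Surface.planeRot (s + t) p := by
  simp only [Surface.planeRot, mul_add, Real.cos_add, Real.sin_add]
  ext <;> simp only <;> ring

theorem planeRot_polarMap (t : ℝ) (x : ℝ × ℝ) :
    Surface.planeRot t (polarMap x) = polarMap (x + (t, 0)) := by
  rw [polarMap, planeRot_planeRot, polarMap]
  simp [add_comm]

theorem planeRot_int (m : ℤ) (p : ℝ × ℝ) : Surface.planeRot m p = p := by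
  have h : 2 * Real.pi * (m : ℝ) = m * (2 * Real.pi) := by ring
  have h1 : Real.cos (2 * Real.pi * m) = 1 := by rw [h, Real.cos_int_mul_two_pi]
  have h2 : Real.sin (2 * Real.pi * m) = 0 := by
    rw [show 2 * Real.pi * (m : ℝ) = ((2 * m : ℤ) : ℝ) * Real.pi by push_cast; ring,
      Real.sin_int_mul_pi]
  simp [Surface.planeRot, h1, h2]

theorem polarMap_add_int (x : ℝ × ℝ) (m : ℤ) : polarMap (x + ((m : ℝ), 0)) = polarMap x := by
  rw [← planeRot_polarMap, planeRot_int]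

theorem exists_polarMap_eq (p : ℝ × ℝ) :
    ∃ x : ℝ × ℝ, x.2 = p.1 ^ 2 + p.2 ^ 2 ∧ polarMap x = p := by
  set z : ℂ := ⟨p.1, p.2⟩ with hz
  refine ⟨(Complex.arg z / (2 * Real.pi), p.1 ^ 2 + p.2 ^ 2), rfl, ?_⟩
  have hn : ‖z‖ = Real.sqrt (p.1 ^ 2 + p.2 ^ 2) := by
    rw [Complex.norm_def, Complex.normSq_apply]
    congr 1
    simp only [hz]
    ring
  rw [polarMap_eq]
  simp only
  rw [mul_div_cancel₀ _ (by have := Real.pi_pos; positivity), ← hn, mul_comm, Complex.norm_mul_cos_arg,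
    mul_comm, Complex.norm_mul_sin_arg]

theorem polarMap_eq_iff {x y : ℝ × ℝ} (hx : 0 < x.2) (hy : 0 ≤ y.2)
    (h : polarMap x = polarMap y) : ∃ m : ℤ, x = y + ((m : ℝ), 0) := by
  have h2 : x.2 = y.2 := by rw [← polarMap_normSq hx.le, h, polarMap_normSq hy]
  rw [polarMap_eq, polarMap_eq, ← h2, Prod.mk.injEq] at h
  have hs : Real.sqrt x.2 ≠ 0 := (Real.sqrt_pos.2 hx).ne'
  have hc := mul_right_cancel₀ hs h.1
  have hsin := mul_right_cancel₀ hs h.2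
  obtain ⟨m, hm⟩ := Real.Angle.angle_eq_iff_two_pi_dvd_sub.1 (Real.Angle.cos_sin_inj hc hsin)
  refine ⟨m, Prod.ext ?_ (by simp [h2])⟩
  have : 2 * Real.pi * (x.1 - y.1) = 2 * Real.pi * m := by linarith
  have := mul_left_cancel₀ (by have := Real.pi_pos; positivity) this
  simp only [Prod.fst_add]
  linarith

theorem hasFDerivAt_polarMap {x : ℝ × ℝ} (hx : 0 < x.2) :
    HasFDerivAt polarMap (planeMatrix
      (-Real.sin (2 * Real.pi * x.1) * (2 * Real.pi) * Real.sqrt x.2)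
      (Real.cos (2 * Real.pi * x.1) * (1 / (2 * Real.sqrt x.2)))
      (Real.cos (2 * Real.pi * x.1) * (2 * Real.pi) * Real.sqrt x.2)
      (Real.sin (2 * Real.pi * x.1) * (1 / (2 * Real.sqrt x.2)))) x := by
  have ha : HasFDerivAt (fun x : ℝ × ℝ => 2 * Real.pi * x.1)
      ((2 * Real.pi) • ContinuousLinearMap.fst ℝ ℝ ℝ) x :=
    (hasFDerivAt_fst (𝕜 := ℝ) (p := x)).const_mul _
  have hs : HasFDerivAt (fun x : ℝ × ℝ => Real.sqrt x.2)
      ((1 / (2 * Real.sqrt x.2)) • ContinuousLinearMap.snd ℝ ℝ ℝ) x :=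
    (hasFDerivAt_snd (𝕜 := ℝ) (p := x)).sqrt hx.ne'
  have h := (ha.cos.mul hs).prodMk (ha.sin.mul hs)
  rw [show polarMap = _ from funext polarMap_eq]
  refine h.congr_fderiv ?_
  ext <;> simp [planeMatrix] <;> ring

/-- The square root of the radial variable makes the Jacobian constant, so normalized area on the
disk becomes `dθ dr`. -/
theorem det_fderiv_polarMap {x : ℝ × ℝ} (hx : 0 < x.2) :
    (fderiv ℝ polarMap x).det = -Real.pi := by
  rw [(hasFDerivAt_polarMap hx).fderiv, det_planeMatrix]
  have := (Real.sqrt_pos.2 hx).ne'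
  field_simp
  linear_combination -Real.sin_sq_add_cos_sq (2 * Real.pi * x.1)

theorem polarMap_contDiffAt {x : ℝ × ℝ} (hx : 0 < x.2) : ContDiffAt ℝ ∞ polarMap x := by
  rw [show polarMap = _ from funext polarMap_eq]
  have hs : ContDiffAt ℝ ∞ (fun x : ℝ × ℝ => Real.sqrt x.2) x := contDiffAt_snd.sqrt hx.ne'
  have ha : ContDiffAt ℝ ∞ (fun x : ℝ × ℝ => 2 * Real.pi * x.1) x :=
    contDiffAt_const.mul contDiffAt_fst
  exact (ha.cos.mul hs).prodMk (ha.sin.mul hs)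

/-- Inverse function theorem. The global section `polarSection` comes from choice and has no
regularity, so smoothness away from the centre is checked with this local section. -/
theorem exists_polarMap_localInverse {x : ℝ × ℝ} (hx : 0 < x.2) :
    ∃ g : ℝ × ℝ → ℝ × ℝ, ContDiffAt ℝ ∞ g (polarMap x) ∧ g (polarMap x) = x ∧
      ∀ᶠ p in 𝓝 (polarMap x), polarMap (g p) = p := by
  have hc := polarMap_contDiffAt hx
  have hdet : (fderiv ℝ polarMap x).det ≠ 0 := by
    rw [det_fderiv_polarMap hx]
    exact neg_ne_zero.2 Real.pi_ne_zero
  have hd : HasFDerivAt polarMap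
      (((fderiv ℝ polarMap x).toContinuousLinearEquivOfDetNeZero hdet : (ℝ × ℝ) ≃L[ℝ] ℝ × ℝ) :
        ℝ × ℝ →L[ℝ] ℝ × ℝ) x := by
    rw [ContinuousLinearMap.coe_toContinuousLinearEquivOfDetNeZero]
    exact (hc.differentiableAt (by simp)).hasFDerivAt
  refine ⟨hc.localInverse hd (by simp), hc.to_localInverse hd (by simp),
    hc.localInverse_apply_image hd (by simp), ?_⟩
  exact (hc.hasStrictFDerivAt' hd (by simp)).eventually_right_inverse

/-! ### Lifts of diffeomorphisms of a surface to the plane -/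

namespace Surface

/-- Invariance of a self-map of the plane that reduces estimates to a compact set: it commutes with
integer translations, or, for the disk, it has compact support. -/
def Tame : Surface → (ℝ × ℝ → ℝ × ℝ) → Prop
  | torus => fun L => ∀ (m n : ℤ) (x : ℝ × ℝ), L (x + ((m : ℝ), (n : ℝ))) = L x + ((m : ℝ), (n : ℝ))
  | annulus => fun L =>
    ∀ (m n : ℤ) (x : ℝ × ℝ), L (x + ((m : ℝ), (n : ℝ))) = L x + ((m : ℝ), (n : ℝ))
  | disk => fun L => ∀ x, 2 < ‖x‖ → L x = x

/-- The group of diffeomorphisms of the plane that preserve the universal cover and induce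
diffeomorphisms of the surface. -/
def liftGroup (M : Surface) : Subgroup (Equiv.Perm (ℝ × ℝ)) where
  carrier := {L | ContDiff ℝ ∞ L ∧ ContDiff ℝ ∞ L.symm ∧ (∀ x, L x ∈ M.cover ↔ x ∈ M.cover) ∧
    M.Tame L}
  one_mem' := ⟨contDiff_id, contDiff_id, fun _ => Iff.rfl, by
    cases M <;> simp [Tame]⟩
  mul_mem' := by
    rintro F G ⟨hF, hF', hFc, hFt⟩ ⟨hG, hG', hGc, hGt⟩
    refine ⟨hF.comp hG, hG'.comp hF', fun x => (hFc _).trans (hGc x), ?_⟩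
    cases M
    · exact fun m n x => by rw [Equiv.Perm.mul_apply, hGt m n, hFt m n, Equiv.Perm.mul_apply]
    · exact fun m n x => by rw [Equiv.Perm.mul_apply, hGt m n, hFt m n, Equiv.Perm.mul_apply]
    · exact fun x hx => by rw [Equiv.Perm.mul_apply, hGt x hx, hFt x hx]
  inv_mem' := by
    rintro F ⟨hF, hF', hFc, hFt⟩
    refine ⟨hF', hF, fun x => ?_, ?_⟩
    · rw [← hFc, perm_apply_inv_self]
    · cases M
      · exact fun m n x => by rw [Equiv.Perm.inv_eq_iff_eq, hFt m n, perm_apply_inv_self]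
      · exact fun m n x => by rw [Equiv.Perm.inv_eq_iff_eq, hFt m n, perm_apply_inv_self]
      · exact fun x hx => by rw [Equiv.Perm.inv_eq_iff_eq, hFt x hx]

theorem coe_unitAddCircle_eq_iff {x y : ℝ} :
    (x : UnitAddCircle) = y ↔ ∃ m : ℤ, x = y + m := by
  rw [← sub_eq_zero, ← AddCircle.coe_sub, AddCircle.coe_eq_zero_iff]
  refine exists_congr fun m => ?_
  rw [zsmul_one, eq_comm, sub_eq_iff_eq_add, add_comm]

theorem proj_surjective (M : Surface) : Function.Surjective M.proj := by
  cases M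
  · rintro ⟨a, b⟩
    obtain ⟨x, rfl⟩ := QuotientAddGroup.mk_surjective a
    obtain ⟨y, rfl⟩ := QuotientAddGroup.mk_surjective b
    exact ⟨⟨(x, y), Set.mem_univ _⟩, rfl⟩
  · rintro ⟨a, b⟩
    obtain ⟨x, rfl⟩ := QuotientAddGroup.mk_surjective a
    exact ⟨⟨(x, b), b.2⟩, rfl⟩
  · rintro ⟨x, hx⟩
    exact ⟨⟨x, hx⟩, rfl⟩

/-- Points of one fibre differ by an integer translation, with which tame maps commute; on the disk
fibres are single points. -/
theorem proj_congr (M : Surface) {L : Equiv.Perm (ℝ × ℝ)} (hL : L ∈ M.liftGroup) {x y : M.cover}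
    (h : M.proj x = M.proj y) : M.proj ⟨L x, (hL.2.2.1 _).2 x.2⟩ =
      M.proj ⟨L y, (hL.2.2.1 _).2 y.2⟩ := by
  obtain ⟨⟨x1, x2⟩, hx⟩ := x
  obtain ⟨⟨y1, y2⟩, hy⟩ := y
  obtain ⟨-, -, -, ht⟩ := hL
  cases M
  · obtain ⟨h1, h2⟩ := Prod.mk.inj h
    obtain ⟨m, hm⟩ := coe_unitAddCircle_eq_iff.1 h1
    obtain ⟨n, hn⟩ := coe_unitAddCircle_eq_iff.1 h2
    simp only at hm hn
    have e := ht m n (y1, y2)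
    rw [Prod.mk_add_mk, ← hm, ← hn] at e
    refine Prod.ext (coe_unitAddCircle_eq_iff.2 ⟨m, ?_⟩) (coe_unitAddCircle_eq_iff.2 ⟨n, ?_⟩) <;>
    simp [e]
  · obtain ⟨h1, h2⟩ := Prod.mk.inj h
    obtain ⟨m, hm⟩ := coe_unitAddCircle_eq_iff.1 h1
    have hn : x2 = y2 := congrArg Subtype.val h2
    simp only at hm
    have e := ht m 0 (y1, y2)
    rw [Prod.mk_add_mk, ← hm, Int.cast_zero, add_zero, ← hn] at e
    subst hn
    refine Prod.ext (coe_unitAddCircle_eq_iff.2 ⟨m, by simp [e]⟩) (Subtype.ext ?_)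
    change (L (x1, x2)).2 = (L (y1, x2)).2
    rw [e, Prod.snd_add, add_zero]
  · have : (x1, x2) = (y1, y2) := congrArg Subtype.val h
    simp only [this]

/-- The map of the surface induced by a map of the plane. -/
noncomputable def descendFun (M : Surface) (L : M.liftGroup) (p : M.Pt) : M.Pt :=
  M.proj ⟨L.1 (Function.surjInv M.proj_surjective p : M.cover),
    (L.2.2.2.1 _).2 (Function.surjInv M.proj_surjective p : M.cover).2⟩

theorem descendFun_proj (M : Surface) (L : M.liftGroup) (x : M.cover) :
    M.descendFun L (M.proj x) = M.proj ⟨L.1 x, (L.2.2.2.1 _).2 x.2⟩ :=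
  M.proj_congr L.2 (Function.surjInv_eq M.proj_surjective (M.proj x))

theorem descendFun_mul (M : Surface) (L L' : M.liftGroup) (p : M.Pt) :
    M.descendFun (L * L') p = M.descendFun L (M.descendFun L' p) := by
  obtain ⟨x, rfl⟩ := M.proj_surjective p
  rw [descendFun_proj, descendFun_proj, descendFun_proj]
  rfl

theorem descendFun_one (M : Surface) (p : M.Pt) : M.descendFun 1 p = p := by
  obtain ⟨x, rfl⟩ := M.proj_surjective p
  rw [descendFun_proj]
  rfl

/-- The homomorphism from lifts to permutations of the surface. -/
noncomputable def descend (M : Surface) : M.liftGroup →* Equiv.Perm M.Pt where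
  toFun L :=
    { toFun := M.descendFun L
      invFun := M.descendFun L⁻¹
      left_inv := fun p => by rw [← descendFun_mul, inv_mul_cancel, descendFun_one]
      right_inv := fun p => by rw [← descendFun_mul, mul_inv_cancel, descendFun_one] }
  map_one' := Equiv.ext M.descendFun_one
  map_mul' L L' := Equiv.ext (M.descendFun_mul L L')

theorem descend_proj (M : Surface) (L : M.liftGroup) (x : M.cover) :
    M.descend L (M.proj x) = M.proj ⟨L.1 x, (L.2.2.2.1 _).2 x.2⟩ := M.descendFun_proj L x

theorem isSmoothLift_descend (M : Surface) (L : M.liftGroup) :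
    M.IsSmoothLift L.1 (M.descend L) :=
  ⟨L.2.1.contDiffOn, fun x => ⟨_, M.descend_proj L x⟩⟩

theorem isSmoothLift_descend_symm (M : Surface) (L : M.liftGroup) :
    M.IsSmoothLift L.1.symm (M.descend L).symm := by
  have h := M.isSmoothLift_descend L⁻¹
  rwa [map_inv] at h

/-! ### Lifts of the rotations -/

/-- A smooth cutoff function that is `1` on the unit disk, as a function of the squared norm. -/
noncomputable def diskCutoff (r : ℝ) : ℝ := Real.smoothTransition ((4 - r) / 3)

theorem diskCutoff_contDiff : ContDiff ℝ ∞ diskCutoff :=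
  (Real.smoothTransition.contDiff (n := ⊤)).comp (by fun_prop)

theorem diskCutoff_of_le {r : ℝ} (h : r ≤ 1) : diskCutoff r = 1 :=
  Real.smoothTransition.one_of_one_le (by rw [le_div_iff₀ three_pos]; linarith)

theorem diskCutoff_of_ge {r : ℝ} (h : 4 ≤ r) : diskCutoff r = 0 :=
  Real.smoothTransition.zero_of_nonpos (div_nonpos_of_nonpos_of_nonneg (by linarith) three_pos.le)

/-- A lift of the circle action to an action of `ℝ` on the plane. -/
noncomputable def rotLift : Surface → ℝ → Equiv.Perm (ℝ × ℝ)
  | torus => fun t => shear fun _ => t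
  | annulus => fun t => shear fun _ => t
  | disk => fun t => twistMap fun r => t * diskCutoff r

theorem rotLift_disk_apply (t : ℝ) (x : ℝ × ℝ) :
    disk.rotLift t x = planeRot (t * diskCutoff (x.1 ^ 2 + x.2 ^ 2)) x := rfl

theorem four_lt_of_two_lt_norm {x : ℝ × ℝ} (hx : 2 < ‖x‖) : 4 < x.1 ^ 2 + x.2 ^ 2 := by
  rw [Prod.norm_def, lt_max_iff, Real.norm_eq_abs, Real.norm_eq_abs] at hx
  rcases hx with h | h
  · have : 2 ^ 2 < |x.1| ^ 2 := pow_lt_pow_left₀ h two_pos.le two_ne_zero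
    rw [sq_abs] at this
    nlinarith [sq_nonneg x.2]
  · have : 2 ^ 2 < |x.2| ^ 2 := pow_lt_pow_left₀ h two_pos.le two_ne_zero
    rw [sq_abs] at this
    nlinarith [sq_nonneg x.1]

theorem rotLift_mem (M : Surface) (t : ℝ) : M.rotLift t ∈ M.liftGroup := by
  cases M
  · have h := shear_isPlaneDiffeo (φ := fun _ => t) contDiff_const
    refine ⟨h.contDiff, h.contDiff_symm, fun x => Iff.rfl, fun m n x => ?_⟩
    ext <;> simp [rotLift, shear, add_right_comm]
  · have h := shear_isPlaneDiffeo (φ := fun _ => t) contDiff_const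
    refine ⟨h.contDiff, h.contDiff_symm, fun x => Iff.rfl, fun m n x => ?_⟩
    ext <;> simp [rotLift, shear, add_right_comm]
  · have h := twistMap_isPlaneDiffeo (χ := fun r => t * diskCutoff r)
      (contDiff_const.mul diskCutoff_contDiff)
    refine ⟨h.contDiff, h.contDiff_symm, fun x => ?_, fun x hx => ?_⟩
    · change (disk.rotLift t x).1 ^ 2 + (disk.rotLift t x).2 ^ 2 ≤ 1 ↔ x.1 ^ 2 + x.2 ^ 2 ≤ 1
      rw [rotLift_disk_apply, planeRot_normSq]
    · rw [rotLift_disk_apply, diskCutoff_of_ge (four_lt_of_two_lt_norm hx).le]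
      simp [planeRot]

/-- On the disk the cutoff depends only on the radius, which rotations preserve, so the cut-off
rotations still form an action. -/
theorem rotLift_add (M : Surface) (s t : ℝ) : M.rotLift (s + t) = M.rotLift s * M.rotLift t := by
  cases M
  · ext x <;> simp [rotLift, shear, add_comm s t, add_assoc]
  · ext x <;> simp [rotLift, shear, add_comm s t, add_assoc]
  · refine Equiv.ext fun x => ?_
    rw [Equiv.Perm.mul_apply, rotLift_disk_apply s, rotLift_disk_apply t, planeRot_normSq,
      planeRot_planeRot, rotLift_disk_apply, add_mul]

theorem rotLift_contDiff (M : Surface) :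
    ContDiff ℝ ∞ fun p : ℝ × (ℝ × ℝ) => M.rotLift p.1 p.2 := by
  cases M
  · change ContDiff ℝ ∞ fun p : ℝ × (ℝ × ℝ) => (p.2.1 + p.1, p.2.2)
    fun_prop
  · change ContDiff ℝ ∞ fun p : ℝ × (ℝ × ℝ) => (p.2.1 + p.1, p.2.2)
    fun_prop
  · change ContDiff ℝ ∞ fun p : ℝ × (ℝ × ℝ) =>
      planeRot (p.1 * diskCutoff (p.2.1 ^ 2 + p.2.2 ^ 2)) p.2
    unfold planeRot
    have h1 := Real.contDiff_cos (n := ∞)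
    have h2 := Real.contDiff_sin (n := ∞)
    have h3 := diskCutoff_contDiff
    fun_prop

theorem descend_rotLift (M : Surface) (t : ℝ) : M.descend ⟨M.rotLift t, M.rotLift_mem t⟩ = M.rot t := by
  refine Equiv.ext fun p => ?_
  obtain ⟨x, rfl⟩ := M.proj_surjective p
  rw [descend_proj]
  cases M
  · rfl
  · rfl
  · apply Subtype.ext
    change disk.rotLift t (x : ℝ × ℝ) = planeRot t x
    rw [rotLift_disk_apply, diskCutoff_of_le x.2, mul_one]

end Surface

/-! ### Lifts of diffeomorphisms of the strip -/

namespace stripGroup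

variable {q : ℕ+} {F : Equiv.Perm (ℝ × ℝ)}

theorem apply_of_le_zero (hF : F ∈ stripGroup q) {x : ℝ × ℝ} (hx : x.2 ≤ 0) : F x = x := by
  obtain ⟨δ, hδ, h⟩ := hF.2.2
  refine h x fun hc => ?_
  have h1 : δ ≤ x.2 := hc.1
  linarith

theorem apply_of_one_le (hF : F ∈ stripGroup q) {x : ℝ × ℝ} (hx : 1 ≤ x.2) : F x = x := by
  obtain ⟨δ, hδ, h⟩ := hF.2.2
  refine h x fun hc => ?_
  have h1 : x.2 ≤ 1 - δ := hc.2
  linarith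

theorem snd_apply_pos (hF : F ∈ stripGroup q) {x : ℝ × ℝ} (hx : 0 < x.2) : 0 < (F x).2 := by
  by_contra h
  have := F.injective (apply_of_le_zero hF (not_lt.1 h))
  rw [this] at h
  exact h hx

theorem snd_apply_nonneg (hF : F ∈ stripGroup q) {x : ℝ × ℝ} (hx : 0 ≤ x.2) : 0 ≤ (F x).2 := by
  rcases hx.eq_or_lt with h | h
  · rw [apply_of_le_zero hF h.symm.le]; exact hx
  · exact (snd_apply_pos hF h).le

theorem snd_apply_le_one (hF : F ∈ stripGroup q) {x : ℝ × ℝ} (hx : x.2 ≤ 1) : (F x).2 ≤ 1 := by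
  by_contra h
  have := F.injective (apply_of_one_le hF (not_le.1 h).le)
  rw [this] at h
  exact h hx

theorem snd_apply_le_one_iff (hF : F ∈ stripGroup q) {x : ℝ × ℝ} : (F x).2 ≤ 1 ↔ x.2 ≤ 1 := by
  refine ⟨fun h => ?_, snd_apply_le_one hF⟩
  have := snd_apply_le_one (inv_mem hF) h
  rwa [perm_inv_apply_self] at this

end stripGroup

/-- The extension of a diffeomorphism of the strip that commutes with integer translations. -/
noncomputable def verticalLift {q : ℕ+} (F : stripGroup q) : Equiv.Perm (ℝ × ℝ) :=
  periodizePerm (ℓ := ContinuousLinearMap.snd ℝ ℝ ℝ) (v := (0, 1)) rfl F.1 F.2.2.2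

section VerticalLift

variable {q : ℕ+}

theorem verticalLift_apply (F : stripGroup q) (x : ℝ × ℝ) : verticalLift F x =
    F.1 (x - (⌊x.2⌋ : ℝ) • ((0, 1) : ℝ × ℝ)) + (⌊x.2⌋ : ℝ) • ((0, 1) : ℝ × ℝ) := rfl

theorem verticalLift_of_mem (F : stripGroup q) {x : ℝ × ℝ} (hx : x.2 ∈ Set.Icc (0 : ℝ) 1) :
    verticalLift F x = F.1 x := by
  -- On the upper edge the floor is already `1`, and the periodization reads the lower edge instead;
  -- the map is the identity on both.
  rcases hx.2.eq_or_lt with h | h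
  · rw [verticalLift_apply, h, Int.floor_one, stripGroup.apply_of_le_zero F.2 (by simp [h]),
      stripGroup.apply_of_one_le F.2 h.ge, sub_add_cancel]
  · rw [verticalLift_apply, Int.floor_eq_zero_iff.2 ⟨hx.1, h⟩]
    simp

theorem verticalLift_add_fst (F : stripGroup q) {t : ℝ}
    (ht : ∀ x, F.1 (x + (t, 0)) = F.1 x + (t, 0)) (x : ℝ × ℝ) :
    verticalLift F (x + (t, 0)) = verticalLift F x + (t, 0) := by
  rw [verticalLift_apply, verticalLift_apply, Prod.snd_add, add_zero, add_sub_right_comm, ht,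
    add_right_comm]

theorem verticalLift_add_int (F : stripGroup q) (m n : ℤ) (x : ℝ × ℝ) :
    verticalLift F (x + ((m : ℝ), (n : ℝ))) = verticalLift F x + ((m : ℝ), (n : ℝ)) := by
  have e : x + ((m : ℝ), (n : ℝ)) = (x + (0, (n : ℝ))) + ((m : ℝ), 0) := by
    ext <;> simp
  rw [e, verticalLift_add_fst F (stripGroup.apply_add_int F.2 m)]
  have e2 : verticalLift F (x + (0, (n : ℝ))) = verticalLift F x + (0, (n : ℝ)) := by
    rw [verticalLift_apply, verticalLift_apply]
    simp only [Prod.snd_add, Int.floor_add_intCast, Int.cast_add]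
    have e3 : x + (0, (n : ℝ)) - ((⌊x.2⌋ : ℝ) + n) • ((0, 1) : ℝ × ℝ) =
        x - (⌊x.2⌋ : ℝ) • ((0, 1) : ℝ × ℝ) := by ext <;> simp
    rw [e3, add_assoc]
    congr 1
    ext <;> simp
  rw [e2, add_assoc]
  congr 1
  ext <;> simp

theorem verticalLift_snd_mem (F : stripGroup q) {x : ℝ × ℝ} (hx : x.2 ∈ Set.Icc (0 : ℝ) 1) :
    (verticalLift F x).2 ∈ Set.Icc (0 : ℝ) 1 := by
  rw [verticalLift_of_mem F hx]
  exact ⟨stripGroup.snd_apply_nonneg F.2 hx.1, stripGroup.snd_apply_le_one F.2 hx.2⟩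

theorem verticalLift_snd_mem_iff (F : stripGroup q) (x : ℝ × ℝ) :
    (verticalLift F x).2 ∈ Set.Icc (0 : ℝ) 1 ↔ x.2 ∈ Set.Icc (0 : ℝ) 1 := by
  refine ⟨fun h => ?_, verticalLift_snd_mem F⟩
  have h2 := verticalLift_snd_mem F⁻¹ h
  have e : verticalLift F⁻¹ (verticalLift F x) = x := (verticalLift F).symm_apply_apply x
  rwa [e] at h2

theorem verticalLift_isPlaneDiffeo (F : stripGroup q) : IsPlaneDiffeo (verticalLift F) :=
  periodizePerm_isPlaneDiffeo _ F.2.2.2 F.2.1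

end VerticalLift

/-! ### Strip diffeomorphisms in polar coordinates -/

/-- Polar coordinates of a point of the plane. -/
noncomputable def polarSection (p : ℝ × ℝ) : ℝ × ℝ := (exists_polarMap_eq p).choose

theorem polarSection_snd (p : ℝ × ℝ) : (polarSection p).2 = p.1 ^ 2 + p.2 ^ 2 :=
  (exists_polarMap_eq p).choose_spec.1

theorem polarSection_snd_nonneg (p : ℝ × ℝ) : 0 ≤ (polarSection p).2 := by
  rw [polarSection_snd]; positivity

theorem polarMap_polarSection (p : ℝ × ℝ) : polarMap (polarSection p) = p :=
  (exists_polarMap_eq p).choose_spec.2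

section PolarLift

variable {q : ℕ+}

/-- The result does not depend on the chosen polar coordinates: away from the centre two choices
differ by an integer in `θ`, and at the centre, where `θ` is arbitrary, `F` is the identity. -/
theorem polarMap_apply_polarSection (F : stripGroup q) {x : ℝ × ℝ} (hx : 0 ≤ x.2) :
    polarMap (F.1 (polarSection (polarMap x))) = polarMap (F.1 x) := by
  rcases hx.eq_or_lt with h | h
  · have h1 : (polarSection (polarMap x)).2 = 0 := by
      rw [polarSection_snd, polarMap_normSq hx, h]
    rw [stripGroup.apply_of_le_zero F.2 h1.le, stripGroup.apply_of_le_zero F.2 h.ge,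
      polarMap_polarSection]
  · have h1 : 0 < (polarSection (polarMap x)).2 := by
      rwa [polarSection_snd, polarMap_normSq hx]
    obtain ⟨m, hm⟩ := polarMap_eq_iff h1 hx (polarMap_polarSection _)
    rw [hm, stripGroup.apply_add_int F.2, polarMap_add_int]

/-- The diffeomorphism of the plane that is a given diffeomorphism of the strip in polar
coordinates. -/
noncomputable def polarLift (F : stripGroup q) : Equiv.Perm (ℝ × ℝ) where
  toFun p := polarMap (F.1 (polarSection p))
  invFun p := polarMap (F.1.symm (polarSection p))
  left_inv p := by
    have h := polarMap_apply_polarSection F⁻¹ (x := F.1 (polarSection p))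
      (stripGroup.snd_apply_nonneg F.2 (polarSection_snd_nonneg p))
    refine h.trans ?_
    change polarMap (F.1⁻¹ (F.1 (polarSection p))) = p
    rw [perm_inv_apply_self, polarMap_polarSection]
  right_inv p := by
    have h := polarMap_apply_polarSection F (x := F.1.symm (polarSection p))
      (stripGroup.snd_apply_nonneg (inv_mem F.2) (polarSection_snd_nonneg p))
    refine h.trans ?_
    rw [Equiv.apply_symm_apply, polarMap_polarSection]

theorem polarLift_polarMap (F : stripGroup q) {x : ℝ × ℝ} (hx : 0 ≤ x.2) :
    polarLift F (polarMap x) = polarMap (F.1 x) := polarMap_apply_polarSection F hx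

theorem polarLift_symm (F : stripGroup q) : (polarLift F).symm = polarLift F⁻¹ :=
  Equiv.ext fun _ => rfl

theorem polarLift_of_one_le (F : stripGroup q) {p : ℝ × ℝ} (hp : 1 ≤ p.1 ^ 2 + p.2 ^ 2) :
    polarLift F p = p := by
  change polarMap (F.1 (polarSection p)) = p
  rw [stripGroup.apply_of_one_le F.2 (by rwa [polarSection_snd]), polarMap_polarSection]

theorem polarLift_normSq (F : stripGroup q) (p : ℝ × ℝ) :
    (polarLift F p).1 ^ 2 + (polarLift F p).2 ^ 2 = (F.1 (polarSection p)).2 :=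
  polarMap_normSq (stripGroup.snd_apply_nonneg F.2 (polarSection_snd_nonneg p))

/-- Near the centre the map is the identity, because `F` is the identity for small `r`. Elsewhere it
is `polarMap ∘ F ∘ g` with a smooth local section `g`. -/
theorem polarLift_contDiff (F : stripGroup q) : ContDiff ℝ ∞ (polarLift F) := by
  rw [contDiff_iff_contDiffAt]
  intro p
  rcases (polarSection_snd_nonneg p).eq_or_lt with h | h
  · obtain ⟨δ, hδ, hsupp⟩ := F.2.2.2
    refine contDiffAt_id.congr_of_eventuallyEq ?_
    have ho : IsOpen {p : ℝ × ℝ | p.1 ^ 2 + p.2 ^ 2 < δ} := isOpen_lt (by fun_prop) continuous_const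
    have hp : p ∈ {p : ℝ × ℝ | p.1 ^ 2 + p.2 ^ 2 < δ} := by
      change p.1 ^ 2 + p.2 ^ 2 < δ
      rw [← polarSection_snd, ← h]
      exact hδ
    filter_upwards [ho.mem_nhds hp] with p' hp'
    change polarMap (F.1 (polarSection p')) = p'
    rw [hsupp, polarMap_polarSection]
    intro hc
    have h1 : δ ≤ (polarSection p').2 := hc.1
    rw [polarSection_snd] at h1
    exact absurd hp' (not_lt.2 h1)
  · obtain ⟨g, hg, hgx, hinv⟩ := exists_polarMap_localInverse h
    rw [polarMap_polarSection] at hg hgx hinv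
    have hFd : ContDiffAt ℝ ∞ F.1 (g p) := F.2.1.contDiff.contDiffAt
    have hPd : ContDiffAt ℝ ∞ polarMap ((F.1 ∘ g) p) := by
      refine polarMap_contDiffAt (stripGroup.snd_apply_pos F.2 ?_)
      rw [hgx]
      exact h
    refine ContDiffAt.congr_of_eventuallyEq (hPd.comp p (hFd.comp p hg)) ?_
    have hpos : ∀ᶠ p' in 𝓝 p, 0 < (g p').2 := by
      have hc : ContinuousAt (fun p' => (g p').2) p := hg.continuousAt.snd
      refine hc.eventually_const_lt ?_
      change 0 < (g p).2
      rw [hgx]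
      exact h
    filter_upwards [hinv, hpos] with p' hp' hpos'
    conv_lhs => rw [← hp']
    exact polarLift_polarMap F hpos'.le

end PolarLift

/-! ### Strip diffeomorphisms on the three surfaces -/

namespace Surface

/-- The lift to the plane of the diffeomorphism of a surface that is a given diffeomorphism of the
strip in the coordinates `(θ, r)`. -/
noncomputable def stripLiftPerm {q : ℕ+} (F : stripGroup q) : Surface → Equiv.Perm (ℝ × ℝ)
  | torus => verticalLift F
  | annulus => verticalLift F
  | disk => polarLift F

theorem stripLiftPerm_mem {q : ℕ+} (F : stripGroup q) (M : Surface) :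
    M.stripLiftPerm F ∈ M.liftGroup := by
  cases M
  · exact ⟨(verticalLift_isPlaneDiffeo F).contDiff, (verticalLift_isPlaneDiffeo F).contDiff_symm,
      fun _ => Iff.rfl, verticalLift_add_int F⟩
  · exact ⟨(verticalLift_isPlaneDiffeo F).contDiff, (verticalLift_isPlaneDiffeo F).contDiff_symm,
      verticalLift_snd_mem_iff F, verticalLift_add_int F⟩
  · refine ⟨polarLift_contDiff F, ?_, fun p => ?_, fun p hp => ?_⟩
    · change ContDiff ℝ ∞ (polarLift F).symm
      rw [polarLift_symm]
      exact polarLift_contDiff F⁻¹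
    · change (polarLift F p).1 ^ 2 + (polarLift F p).2 ^ 2 ≤ 1 ↔ p.1 ^ 2 + p.2 ^ 2 ≤ 1
      rw [polarLift_normSq, stripGroup.snd_apply_le_one_iff F.2, polarSection_snd]
    · exact polarLift_of_one_le F (by linarith [four_lt_of_two_lt_norm hp])

/-- `stripLiftPerm` as an element of the group of lifts. -/
noncomputable def stripLift (M : Surface) {q : ℕ+} (F : stripGroup q) : M.liftGroup :=
  ⟨M.stripLiftPerm F, M.stripLiftPerm_mem F⟩

/-- The lift of a rotation as an element of the group of lifts. -/
noncomputable def rotL (M : Surface) (t : ℝ) : M.liftGroup := ⟨M.rotLift t, M.rotLift_mem t⟩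

theorem rotL_add (M : Surface) (s t : ℝ) : M.rotL (s + t) = M.rotL s * M.rotL t :=
  Subtype.ext (M.rotLift_add s t)

theorem descend_rotL (M : Surface) (t : ℝ) : M.descend (M.rotL t) = M.rot t :=
  M.descend_rotLift t

/-- Outside the unit disk the lifted rotation is no longer rigid, but the lift of `F` is the
identity there and commutation is trivial. -/
theorem stripLift_commute (M : Surface) {q : ℕ+} (F : stripGroup q) :
    Commute (M.stripLift F) (M.rotL (1 / (q : ℝ))) := by
  refine Subtype.ext (Equiv.ext fun x => ?_)
  cases M
  · simpa [stripLift, rotL, stripLiftPerm, rotLift, shear, Prod.add_def] using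
      verticalLift_add_fst F F.2.2.1 x
  · simpa [stripLift, rotL, stripLiftPerm, rotLift, shear, Prod.add_def] using
      verticalLift_add_fst F F.2.2.1 x
  · change polarLift F (disk.rotLift (1 / (q : ℝ)) x) = disk.rotLift (1 / (q : ℝ)) (polarLift F x)
    rcases le_or_gt (x.1 ^ 2 + x.2 ^ 2) 1 with h | h
    · have h1 : (F.1 (polarSection x)).2 ≤ 1 :=
        stripGroup.snd_apply_le_one F.2 (by rwa [polarSection_snd])
      have h0 := polarSection_snd_nonneg x
      rw [rotLift_disk_apply, rotLift_disk_apply, polarLift_normSq, diskCutoff_of_le h,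
        diskCutoff_of_le h1, mul_one]
      conv_lhs => rw [← polarMap_polarSection x]
      rw [planeRot_polarMap, polarLift_polarMap F (by simpa using h0), F.2.2.1,
        ← planeRot_polarMap]
      rfl
    · rw [polarLift_of_one_le F h.le, polarLift_of_one_le F]
      rw [rotLift_disk_apply, planeRot_normSq]
      exact h.le

/-- The point of the cover with the coordinates `(θ, r)`. -/
noncomputable def coverPt : (M : Surface) → Sq → M.cover
  | torus => fun x => ⟨x.pt, Set.mem_univ _⟩
  | annulus => fun x => ⟨x.pt, x.2.2.1, x.2.2.2.le⟩
  | disk => fun x => ⟨polarMap x.pt, by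
      change (polarMap x.pt).1 ^ 2 + (polarMap x.pt).2 ^ 2 ≤ 1
      rw [polarMap_normSq x.2.2.1]
      exact x.2.2.2.le⟩

theorem proj_coverPt (M : Surface) (x : Sq) : M.proj (M.coverPt x) = M.param x := by
  cases M <;> rfl

theorem descend_stripLift_param (M : Surface) {q : ℕ+} (F : stripGroup q) (x : Sq) :
    M.descend (M.stripLift F) (M.param x) = M.param (stripGroup.toSq q F x) := by
  obtain ⟨m, hm⟩ := stripGroup.exists_apply_pt F x
  rw [← proj_coverPt, descend_proj, ← proj_coverPt]
  cases M
  · have e : verticalLift F x.pt = (stripGroup.toSq q F x).pt + ((m : ℝ), 0) := by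
      rw [verticalLift_of_mem F ⟨x.2.2.1, x.2.2.2.le⟩, hm]
    refine Prod.ext (coe_unitAddCircle_eq_iff.2 ⟨m, ?_⟩) (coe_unitAddCircle_eq_iff.2 ⟨0, ?_⟩)
    · exact congrArg Prod.fst e
    · rw [Int.cast_zero]
      exact congrArg Prod.snd e
  · have e : verticalLift F x.pt = (stripGroup.toSq q F x).pt + ((m : ℝ), 0) := by
      rw [verticalLift_of_mem F ⟨x.2.2.1, x.2.2.2.le⟩, hm]
    refine Prod.ext (coe_unitAddCircle_eq_iff.2 ⟨m, ?_⟩) (Subtype.ext ?_)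
    · exact congrArg Prod.fst e
    · exact (congrArg Prod.snd e).trans (add_zero _)
  · apply Subtype.ext
    change polarLift F (polarMap x.pt) = polarMap (stripGroup.toSq q F x).pt
    rw [polarLift_polarMap F x.2.2.1, hm, polarMap_add_int]

theorem rot_param (M : Surface) (t : ℝ) (x : Sq) :
    M.rot t (M.param x) = M.param (sqRot t x) := by
  cases M
  · refine Prod.ext ?_ rfl
    change ((x.1 : ℝ) : UnitAddCircle) + (t : UnitAddCircle) =
      ((Int.fract ((x.1 : ℝ) + t) : ℝ) : UnitAddCircle)
    rw [← AddCircle.coe_add, coe_unitAddCircle_eq_iff]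
    exact ⟨⌊(x.1 : ℝ) + t⌋, (Int.fract_add_floor _).symm⟩
  · refine Prod.ext ?_ rfl
    change ((x.1 : ℝ) : UnitAddCircle) + (t : UnitAddCircle) =
      ((Int.fract ((x.1 : ℝ) + t) : ℝ) : UnitAddCircle)
    rw [← AddCircle.coe_add, coe_unitAddCircle_eq_iff]
    exact ⟨⌊(x.1 : ℝ) + t⌋, (Int.fract_add_floor _).symm⟩
  · apply Subtype.ext
    change planeRot t (polarMap x.pt) = polarMap (sqRot t x).pt
    have e : x.pt + (t, 0) = (sqRot t x).pt + (((⌊(x.1 : ℝ) + t⌋ : ℤ) : ℝ), 0) := by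
      ext
      · exact (Int.fract_add_floor _).symm
      · rfl
    rw [planeRot_polarMap, e, polarMap_add_int]

end Surface

/-! ### The coordinates as an isomorphism of measure spaces -/

namespace Surface

theorem isClosed_disk : IsClosed {x : ℝ × ℝ | x.1 ^ 2 + x.2 ^ 2 ≤ 1} :=
  isClosed_le (by fun_prop) continuous_const

theorem isCompact_disk : IsCompact {x : ℝ × ℝ | x.1 ^ 2 + x.2 ^ 2 ≤ 1} := by
  refine Metric.isCompact_of_isClosed_isBounded isClosed_disk ?_
  refine (Metric.isBounded_closedBall (x := (0 : ℝ × ℝ)) (r := 2)).subset fun p hp => ?_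
  rw [mem_closedBall_zero_iff]
  by_contra h
  have h1 := four_lt_of_two_lt_norm (not_le.1 h)
  have h2 : p.1 ^ 2 + p.2 ^ 2 ≤ 1 := hp
  linarith

instance instBorelSpacePt : (M : Surface) → BorelSpace M.Pt
  | torus => inferInstanceAs (BorelSpace (UnitAddCircle × UnitAddCircle))
  | annulus => inferInstanceAs (BorelSpace (UnitAddCircle × Set.Icc (0 : ℝ) 1))
  | disk => inferInstanceAs (BorelSpace {x : ℝ × ℝ // x.1 ^ 2 + x.2 ^ 2 ≤ 1})

instance instCompactSpacePt : (M : Surface) → CompactSpace M.Pt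
  | torus => inferInstanceAs (CompactSpace (UnitAddCircle × UnitAddCircle))
  | annulus => inferInstanceAs (CompactSpace (UnitAddCircle × Set.Icc (0 : ℝ) 1))
  | disk => isCompact_iff_compactSpace.1 isCompact_disk

theorem measurable_param (M : Surface) : Measurable M.param := by
  have h1 : Measurable fun x : Sq => (x.1 : ℝ) := measurable_subtype_coe.comp measurable_fst
  have h2 : Measurable fun x : Sq => (x.2 : ℝ) := measurable_subtype_coe.comp measurable_snd
  cases M
  · exact (AddCircle.measurable_mk'.comp h1).prodMk (AddCircle.measurable_mk'.comp h2)
  · exact (AddCircle.measurable_mk'.comp h1).prodMk h2.subtype_mk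
  · refine Measurable.subtype_mk ?_
    change Measurable fun x : Sq => polarMap x.pt
    simp only [polarMap_eq, Sq.pt]
    fun_prop

/-- The edge `r = 0` is left out because on the disk it collapses to the centre. -/
theorem param_injOn (M : Surface) : Set.InjOn M.param {x | 0 < (x.2 : ℝ)} := by
  intro x hx y hy h
  have key : ∀ m n : ℤ, x.pt = y.pt + ((m : ℝ), (n : ℝ)) → x = y := fun m n e => by
    rw [← Sq.wrap_pt x, ← Sq.wrap_pt y, e]
    ext <;> simp [Sq.wrap]
  cases M
  · obtain ⟨h1, h2⟩ := Prod.mk.inj h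
    obtain ⟨m, hm⟩ := coe_unitAddCircle_eq_iff.1 h1
    obtain ⟨n, hn⟩ := coe_unitAddCircle_eq_iff.1 h2
    exact key m n (Prod.ext hm hn)
  · obtain ⟨h1, h2⟩ := Prod.mk.inj h
    obtain ⟨m, hm⟩ := coe_unitAddCircle_eq_iff.1 h1
    have hn : (x.2 : ℝ) = y.2 := Subtype.mk.inj h2
    exact key m 0 (Prod.ext hm (by simpa [Sq.pt] using hn))
  · have h' : polarMap x.pt = polarMap y.pt := congrArg Subtype.val h
    obtain ⟨m, hm⟩ := polarMap_eq_iff (x := x.pt) hx y.2.2.1 h'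
    exact key m 0 (by simpa using hm)

theorem measurable_polarMap : Measurable polarMap := by
  simp only [funext polarMap_eq]
  fun_prop

theorem volume_image_polarMap {E : Set (ℝ × ℝ)} (hE : MeasurableSet E)
    (hsub : E ⊆ Set.Ico (0 : ℝ) 1 ×ˢ Set.Ioc (0 : ℝ) 1) :
    volume (polarMap '' E) = ENNReal.ofReal Real.pi * volume E := by
  have hinj : Set.InjOn polarMap E := by
    intro x hx y hy h
    obtain ⟨hx1, hx2⟩ := hsub hx
    obtain ⟨hy1, hy2⟩ := hsub hy
    obtain ⟨m, hm⟩ := polarMap_eq_iff hx2.1 hy2.1.le h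
    have h1 : x.1 = y.1 + m := congrArg Prod.fst hm
    have hm0 : m = 0 := by
      have a : (m : ℝ) < 1 := by linarith [hx1.2, hy1.1]
      have b : (-1 : ℝ) < m := by linarith [hx1.1, hy1.2]
      have a' : m < 1 := by exact_mod_cast a
      have b' : -1 < m := by exact_mod_cast b
      omega
    rw [hm, hm0]
    simp
  rw [← lintegral_abs_det_fderiv_eq_addHaar_image volume hE (f' := fun x => fderiv ℝ polarMap x)
    (fun x hx => (((polarMap_contDiffAt (hsub hx).2.1).differentiableAt
      (by simp)).hasFDerivAt).hasFDerivWithinAt) hinj]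
  rw [setLIntegral_congr_fun hE (g := fun _ => ENNReal.ofReal Real.pi) fun x hx => by
    simp only
    rw [det_fderiv_polarMap (hsub hx).2.1, abs_neg, abs_of_pos Real.pi_pos]]
  rw [setLIntegral_const]

/-- Trades the edge `r = 0`, where `polarMap` is not injective, for the edge `r = 1`. On the new
domain the map is injective and its image misses only the centre of the closed disk. -/
theorem restrict_square_eq : (volume.restrict (Set.Ico (0 : ℝ) 1 ×ˢ Set.Ico (0 : ℝ) 1)) =
    (volume.restrict (Set.Ico (0 : ℝ) 1 ×ˢ Set.Ioc (0 : ℝ) 1) : Measure (ℝ × ℝ)) := by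
  rw [Measure.volume_eq_prod, ← Measure.prod_restrict, ← Measure.prod_restrict,
    restrict_Ico_eq_restrict_Ioc]

theorem vol_disk_image {A : Set disk.Pt} (hA : MeasurableSet A) :
    volume ((Subtype.val : {x : ℝ × ℝ // x.1 ^ 2 + x.2 ^ 2 ≤ 1} → ℝ × ℝ) '' A) =
      ENNReal.ofReal Real.pi * Sq.vol (disk.param ⁻¹' A) := by
  set A' : Set (ℝ × ℝ) := (Subtype.val : {x : ℝ × ℝ // x.1 ^ 2 + x.2 ^ 2 ≤ 1} → ℝ × ℝ) '' A
  set U : Set (ℝ × ℝ) := Set.Ico (0 : ℝ) 1 ×ˢ Set.Ioc (0 : ℝ) 1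
  have hA' : MeasurableSet A' := isClosed_disk.measurableSet.subtype_image hA
  have hU : MeasurableSet U := measurableSet_Ico.prod measurableSet_Ioc
  have hS : Sq.vol (disk.param ⁻¹' A) = volume (polarMap ⁻¹' A' ∩ U) := by
    rw [Sq.vol_eq (disk.measurable_param hA), ← Measure.restrict_apply (measurable_polarMap hA'),
      ← restrict_square_eq, Measure.restrict_apply (measurable_polarMap hA')]
    congr 1
    ext x
    simp only [Set.mem_inter_iff, Set.mem_preimage, and_congr_left_iff]
    rintro ⟨hx1, hx2⟩
    have e : (Sq.wrap x).pt = x := by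
      ext
      · exact Int.fract_eq_self.2 hx1
      · exact Int.fract_eq_self.2 hx2
    have e' : (disk.param (Sq.wrap x)).1 = polarMap x := by
      change polarMap (Sq.wrap x).pt = _
      rw [e]
    rw [← e']
    exact (Subtype.val_injective.mem_set_image).symm
  rw [hS, ← volume_image_polarMap ((measurable_polarMap hA').inter hU) Set.inter_subset_right]
  have hsub : polarMap '' (polarMap ⁻¹' A' ∩ U) ⊆ A' := by
    rintro _ ⟨x, hx, rfl⟩
    exact hx.1
  refine le_antisymm ?_ (measure_mono hsub)
  have hcov : A' ⊆ polarMap '' (polarMap ⁻¹' A' ∩ U) ∪ {0} := by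
    rintro p hp
    by_cases hp0 : p = 0
    · exact Or.inr hp0
    · left
      have hle : p.1 ^ 2 + p.2 ^ 2 ≤ 1 := by
        obtain ⟨z, -, rfl⟩ := hp
        exact z.2
      have hpos : 0 < p.1 ^ 2 + p.2 ^ 2 := by
        by_contra h
        have h1 : p.1 ^ 2 = 0 := by nlinarith [sq_nonneg p.1, sq_nonneg p.2]
        have h2 : p.2 ^ 2 = 0 := by nlinarith [sq_nonneg p.1, sq_nonneg p.2]
        exact hp0 (Prod.ext (pow_eq_zero_iff two_ne_zero |>.1 h1)
          (pow_eq_zero_iff two_ne_zero |>.1 h2))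
      set x := polarSection p
      have hx : polarMap (Int.fract x.1, x.2) = p := by
        have e : x = (Int.fract x.1, x.2) + ((⌊x.1⌋ : ℝ), 0) := by
          ext
          · exact (Int.fract_add_floor _).symm
          · exact (add_zero _).symm
        rw [← polarMap_add_int _ ⌊x.1⌋, ← e]
        exact polarMap_polarSection p
      refine ⟨(Int.fract x.1, x.2), ⟨?_, ⟨Int.fract_nonneg _, Int.fract_lt_one _⟩, ?_⟩, hx⟩
      · rw [Set.mem_preimage, hx]
        exact hp
      · change x.2 ∈ _
        rw [show x.2 = _ from polarSection_snd p]
        exact ⟨hpos, hle⟩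
  calc volume A' ≤ volume (polarMap '' (polarMap ⁻¹' A' ∩ U) ∪ {0}) := measure_mono hcov
    _ ≤ volume (polarMap '' (polarMap ⁻¹' A' ∩ U)) + volume {(0 : ℝ × ℝ)} := measure_union_le _ _
    _ = _ := by rw [measure_singleton, add_zero]

theorem measurePreserving_param (M : Surface) : MeasurePreserving M.param Sq.vol M.vol := by
  refine ⟨M.measurable_param, ?_⟩
  have hmk : MeasurePreserving (fun x : ℝ => (x : UnitAddCircle))
      (volume.restrict (Set.Ico (0 : ℝ) 1)) volume := by
    have h := UnitAddCircle.measurePreserving_mk 0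
    rwa [zero_add, ← restrict_Ico_eq_restrict_Ioc] at h
  have hcoe : ∀ x : ℝ, ((Int.fract x : ℝ) : UnitAddCircle) = x := fun x =>
    coe_unitAddCircle_eq_iff.2 ⟨-⌊x⌋, by push_cast; rw [Int.fract]; ring⟩
  cases M
  · rw [Sq.vol, Measure.map_map (measurable_param torus) Sq.measurable_wrap]
    have h := hmk.prod hmk
    rw [Measure.prod_restrict] at h
    refine Eq.trans ?_ h.map_eq
    congr 1
    funext x
    exact Prod.ext (hcoe _) (hcoe _)
  · rw [Sq.vol, Measure.map_map (measurable_param annulus) Sq.measurable_wrap]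
    have hI : MeasurePreserving (Set.projIcc (0 : ℝ) 1 zero_le_one)
        (volume.restrict (Set.Ico (0 : ℝ) 1)) volume := by
      have hv : MeasurePreserving ((↑) : Set.Icc (0 : ℝ) 1 → ℝ) volume
          (volume.restrict (Set.Icc (0 : ℝ) 1)) :=
        measurePreserving_subtype_coe measurableSet_Icc
      refine ⟨continuous_projIcc.measurable, ?_⟩
      rw [Measure.restrict_congr_set Ico_ae_eq_Icc, ← hv.map_eq,
        Measure.map_map continuous_projIcc.measurable hv.measurable]
      have : Set.projIcc (0 : ℝ) 1 zero_le_one ∘ ((↑) : Set.Icc (0 : ℝ) 1 → ℝ) = id :=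
        funext fun x => Set.projIcc_val zero_le_one x
      rw [this, Measure.map_id]
    have h := hmk.prod hI
    rw [Measure.prod_restrict] at h
    refine Eq.trans ?_ h.map_eq
    apply Measure.map_congr
    filter_upwards [ae_restrict_mem (measurableSet_Ico.prod measurableSet_Ico)] with x hx
    refine Prod.ext (hcoe _) (Subtype.ext ?_)
    change Int.fract x.2 = Set.projIcc (0 : ℝ) 1 zero_le_one x.2
    rw [Set.projIcc_of_mem zero_le_one ⟨hx.2.1, hx.2.2.le⟩]
    exact Int.fract_eq_self.2 hx.2
  · ext A hA
    rw [Measure.map_apply (measurable_param disk) hA]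
    -- The normalizing constant comes from the same change of variables, applied to the whole disk.
    have hvol : volume {x : ℝ × ℝ | x.1 ^ 2 + x.2 ^ 2 ≤ 1} = ENNReal.ofReal Real.pi := by
      have h := vol_disk_image (A := Set.univ) MeasurableSet.univ
      rw [Set.preimage_univ, measure_univ, mul_one] at h
      rw [← h]
      congr 1
      exact (Subtype.coe_image_univ _).symm
    have key : ∀ B : Set {x : ℝ × ℝ // x.1 ^ 2 + x.2 ^ 2 ≤ 1}, MeasurableSet B →
        ((volume {x : ℝ × ℝ | x.1 ^ 2 + x.2 ^ 2 ≤ 1})⁻¹ •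
          Measure.comap (Subtype.val : {x : ℝ × ℝ // x.1 ^ 2 + x.2 ^ 2 ≤ 1} → ℝ × ℝ) volume) B =
        (ENNReal.ofReal Real.pi)⁻¹ * volume (Subtype.val '' B) := fun B hB => by
      rw [Measure.smul_apply, hvol, smul_eq_mul]
      congr 1
      exact Measure.comap_apply (Subtype.val : {x : ℝ × ℝ // x.1 ^ 2 + x.2 ^ 2 ≤ 1} → ℝ × ℝ)
        Subtype.val_injective (fun s hs => isClosed_disk.measurableSet.subtype_image hs) volume hB
    refine Eq.trans ?_ (key A hA).symm
    refine Eq.trans ?_ (congrArg _ (vol_disk_image hA)).symm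
    rw [← mul_assoc, ENNReal.inv_mul_cancel, one_mul]
    · simpa using Real.pi_pos
    · exact ENNReal.ofReal_ne_top

instance isProbabilityMeasure_vol (M : Surface) : IsProbabilityMeasure M.vol :=
  ⟨by rw [← M.measurePreserving_param.measure_preimage MeasurableSet.univ.nullMeasurableSet,
    Set.preimage_univ, measure_univ]⟩

/-- The coordinates are almost everywhere invertible. -/
theorem exists_param_inverse (M : Surface) : ∃ κ : M.Pt → Sq, MeasurePreserving κ M.vol Sq.vol ∧
    (∀ᵐ x ∂Sq.vol, κ (M.param x) = x) ∧ ∀ᵐ y ∂M.vol, M.param (κ y) = y := by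
  have hD : MeasurableSet {x : Sq | 0 < (x.2 : ℝ)} :=
    measurableSet_lt measurable_const (measurable_subtype_coe.comp measurable_snd)
  have : StandardBorelSpace (Set.Ico (0 : ℝ) 1) := measurableSet_Ico.standardBorel
  have : StandardBorelSpace {x : Sq | 0 < (x.2 : ℝ)} := hD.standardBorel
  -- Lusin–Souslin: an injective measurable map on a standard Borel space is a measurable embedding,
  -- so its inverse is measurable without being computed.
  have hemb : MeasurableEmbedding fun x : {x : Sq | 0 < (x.2 : ℝ)} => M.param x :=
    (M.measurable_param.comp measurable_subtype_coe).measurableEmbedding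
      fun x y h => Subtype.ext (M.param_injOn x.2 y.2 h)
  obtain ⟨κ, hκ, hκ'⟩ := hemb.exists_measurable_extend
    (measurable_subtype_coe (p := fun x : Sq => 0 < (x.2 : ℝ)))
    fun _ => ⟨(⟨0, le_rfl, one_pos⟩, ⟨0, le_rfl, one_pos⟩)⟩
  have h1 : ∀ᵐ x ∂Sq.vol, κ (M.param x) = x := by
    filter_upwards [Sq.ae_irrational] with x hx
    have hpos : (0 : ℝ) < x.2 := lt_of_le_of_ne x.2.2.1 fun h => hx.2 ⟨0, by simpa using h⟩
    exact congrFun hκ' ⟨x, hpos⟩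
  refine ⟨κ, ⟨hκ, ?_⟩, h1, ?_⟩
  · rw [← M.measurePreserving_param.map_eq, Measure.map_map hκ M.measurable_param,
      Measure.map_congr (f := κ ∘ M.param) (g := id) h1, Measure.map_id]
  · have hm : MeasurableSet {y | M.param (κ y) = y} :=
      measurableSet_eq_fun (M.measurable_param.comp hκ) measurable_id
    rw [← M.measurePreserving_param.map_eq, ae_map_iff M.measurable_param.aemeasurable hm]
    filter_upwards [h1] with x hx
    rw [hx]

end Surface

/-! ### Groups of measure-preserving permutations -/

/-- The group of invertible measure-preserving transformations. -/
def mpGroup {X : Type*} [MeasurableSpace X] (μ : Measure X) : Subgroup (Equiv.Perm X) where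
  carrier := {g | MeasurePreserving g μ μ ∧ MeasurePreserving g.symm μ μ}
  one_mem' := ⟨MeasurePreserving.id μ, MeasurePreserving.id μ⟩
  mul_mem' := fun hf hg => ⟨hf.1.comp hg.1, hg.2.comp hf.2⟩
  inv_mem' := fun hf => ⟨hf.2, hf.1⟩

theorem mem_mpGroup_of_measurable {X : Type*} [MeasurableSpace X] {μ : Measure X}
    {g : Equiv.Perm X} (hg : MeasurePreserving g μ μ) (hs : Measurable g.symm) : g ∈ mpGroup μ := by
  refine ⟨hg, hs, ?_⟩
  conv_lhs => rw [← hg.map_eq, Measure.map_map hs hg.measurable]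
  rw [show ⇑g.symm ∘ ⇑g = id from funext g.symm_apply_apply, Measure.map_id]

theorem mpGroup_measure_preimage {X : Type*} [MeasurableSpace X] {μ : Measure X}
    {g : Equiv.Perm X} (hg : g ∈ mpGroup μ) (A : Set X) : μ (g ⁻¹' A) = μ A :=
  MeasurePreserving.measure_preimage_equiv (f := ⟨g, hg.1.measurable, hg.2.measurable⟩) hg.1 A

theorem stripGroup.toSq_mem_mpGroup {q : ℕ+} (F : stripGroup q) :
    stripGroup.toSq q F ∈ mpGroup Sq.vol :=
  mem_mpGroup_of_measurable (stripGroup.measurePreserving_toSq F)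
    (stripGroup.toSqEquiv F).symm.measurable

/-- Approximation gives `vol (g⁻¹ A) ≤ vol A`; the same inequality for the complement gives
equality, the total mass being `1`. Rotations and cell permutations are shown to preserve measure in
this way. -/
theorem measurePreserving_of_mem_approxGroup {q : ℕ+} {g : Equiv.Perm Sq} (hg : Measurable g)
    (h : g ∈ approxGroup q) : MeasurePreserving g Sq.vol Sq.vol := by
  have hle : ∀ A : Set Sq, Sq.vol (g ⁻¹' A) ≤ Sq.vol A := fun A => by
    refine ENNReal.le_of_forall_pos_le_add fun ε hε _ => ?_
    obtain ⟨F, hF⟩ := h ε (by exact_mod_cast hε)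
    calc Sq.vol (g ⁻¹' A) ≤ Sq.vol (stripGroup.toSq q F ⁻¹' A ∪ {x | stripGroup.toSq q F x ≠ g x}) := by
          refine measure_mono fun x hx => ?_
          by_cases hc : stripGroup.toSq q F x = g x
          · left
            rwa [Set.mem_preimage, hc]
          · exact Or.inr hc
      _ ≤ _ := measure_union_le _ _
      _ ≤ Sq.vol A + ε := by
          rw [stripGroup.vol_preimage_toSq]
          gcongr
  refine ⟨hg, ?_⟩
  ext A hA
  rw [Measure.map_apply hg hA]
  refine le_antisymm (hle A) ?_
  have h1 := hle Aᶜ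
  rw [Set.preimage_compl, measure_compl (hg hA) (measure_ne_top _ _),
    measure_compl hA (measure_ne_top _ _), measure_univ] at h1
  exact (ENNReal.sub_le_sub_iff_left prob_le_one ENNReal.one_ne_top).1 h1

theorem mem_mpGroup_of_mem_approxGroup {q : ℕ+} {g : Equiv.Perm Sq} (hg : Measurable g)
    (hg' : Measurable g.symm) (h : g ∈ approxGroup q) : g ∈ mpGroup Sq.vol :=
  mem_mpGroup_of_measurable (measurePreserving_of_mem_approxGroup hg h) hg'

theorem sqRot_symm (t : ℝ) : (sqRot t).symm = sqRot (-t) := by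
  ext x <;> rfl

theorem sqRot_mem_mpGroup (t : ℝ) : sqRot t ∈ mpGroup Sq.vol :=
  mem_mpGroup_of_mem_approxGroup (measurable_sqRot t) (sqRot_symm t ▸ measurable_sqRot (-t))
    (sqRot_mem_approxGroup 1 t)

theorem measurable_cellEquiv (q k s : ℕ+) : Measurable (cellEquiv q k s) := by
  have h1 : Measurable fun x : Sq => splitIco q x.1 := (measurable_splitIco q).comp measurable_fst
  have h2 : Measurable fun x : Sq => splitIco k (splitIco q x.1).2 :=
    (measurable_splitIco k).comp (measurable_snd.comp h1)
  have h3 : Measurable fun x : Sq => splitIco s x.2 := (measurable_splitIco s).comp measurable_snd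
  exact (((measurable_fst.comp h1).prodMk (measurable_fst.comp h2)).prodMk
    (measurable_fst.comp h3)).prodMk ((measurable_snd.comp h2).prodMk (measurable_snd.comp h3))

theorem measurable_cellEquiv_symm (q k s : ℕ+) : Measurable (cellEquiv q k s).symm := by
  refine Measurable.prodMk ((measurable_splitIco_symm q).comp (Measurable.prodMk ?_
    ((measurable_splitIco_symm k).comp (Measurable.prodMk ?_ ?_))))
    ((measurable_splitIco_symm s).comp (Measurable.prodMk ?_ ?_)) <;> fun_prop

theorem measurable_cellPerm (q k s : ℕ+) (π : Equiv.Perm ((Fin q × Fin k) × Fin s)) :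
    Measurable (cellPerm q k s π) := by
  refine (measurable_cellEquiv_symm q k s).comp (Measurable.comp ?_ (measurable_cellEquiv q k s))
  exact ((measurable_of_countable π).comp measurable_fst).prodMk measurable_snd

theorem measurable_cellPerm_symm (q k s : ℕ+) (π : Equiv.Perm ((Fin q × Fin k) × Fin s)) :
    Measurable (cellPerm q k s π).symm :=
  measurable_cellPerm q k s π.symm

theorem measurable_cellPerm_mul (q k s : ℕ+) (π π' : Equiv.Perm ((Fin q × Fin k) × Fin s)) :
    Measurable (cellPerm q k s π * cellPerm q k s π') :=
  (measurable_cellPerm q k s π).comp (measurable_cellPerm q k s π')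

theorem measurable_cellPerm_mul_symm (q k s : ℕ+)
    (π π' : Equiv.Perm ((Fin q × Fin k) × Fin s)) :
    Measurable (cellPerm q k s π * cellPerm q k s π').symm :=
  (measurable_cellPerm_symm q k s π').comp (measurable_cellPerm_symm q k s π)

namespace TwistedAbC

variable (P : TwistedAbC)

theorem h_mem_mpGroup (n : ℕ) : P.h n ∈ mpGroup Sq.vol :=
  mem_mpGroup_of_mem_approxGroup
    (measurable_cellPerm_mul _ _ _ _ _) (measurable_cellPerm_mul_symm _ _ _ _ _)
    (P.h_mem_approxGroup n)

theorem H_mem_mpGroup (n : ℕ) : P.H n ∈ mpGroup Sq.vol := by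
  induction n with
  | zero => exact one_mem _
  | succ n ih => exact mul_mem ih (P.h_mem_mpGroup n)

theorem T_mem_mpGroup (n : ℕ) : P.T n ∈ mpGroup Sq.vol :=
  mul_mem (mul_mem (P.H_mem_mpGroup n) (sqRot_mem_mpGroup _)) (inv_mem (P.H_mem_mpGroup n))

end TwistedAbC

/-! ### Limits of measure-preserving transformations -/

section Limits

/-- The limits of two sequences of mutually inverse transformations are mutually inverse. -/
theorem ae_leftInverse_of_eventually_eq {X : Type*} [MeasurableSpace X] {μ : Measure X}
    {K K' : ℕ → X → X} {L L' : X → X}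
    (hL : MeasurePreserving L μ μ) (hKL : ∀ᵐ x ∂μ, ∀ᶠ n in atTop, K n x = L x)
    (hKL' : ∀ᵐ x ∂μ, ∀ᶠ n in atTop, K' n x = L' x) (hinv : ∀ n x, K' n (K n x) = x) :
    ∀ᵐ x ∂μ, L' (L x) = x := by
  filter_upwards [hKL, hL.quasiMeasurePreserving.ae hKL'] with x hx hx'
  obtain ⟨n, hn, hn'⟩ := (hx.and hx').exists
  rw [← hn', ← hn, hinv]

variable {X : Type*} [TopologicalSpace X] [TopologicalSpace.MetrizableSpace X]
  [MeasurableSpace X] [BorelSpace X] {μ : Measure X} [IsFiniteMeasure μ]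

theorem eventually_eq_const_of_eventually_succ {Y : Type*} {u : ℕ → Y}
    (h : ∀ᶠ n in atTop, u (n + 1) = u n) : ∃ y, ∀ᶠ n in atTop, u n = y := by
  obtain ⟨N, hN⟩ := eventually_atTop.1 h
  refine ⟨u N, eventually_atTop.2 ⟨N, fun n hn => ?_⟩⟩
  induction n, hn using Nat.le_induction with
  | base => rfl
  | succ n hn ih => rw [hN n hn, ih]

/-- A sequence of measure-preserving transformations with summable changes is almost everywhere
eventually equal to a measure-preserving transformation. -/
theorem exists_measurePreserving_eventually_eq {K : ℕ → X → X}
    (hK : ∀ n, MeasurePreserving (K n) μ μ) (hsum : ∑' n, μ {x | K (n + 1) x ≠ K n x} ≠ ⊤) :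
    ∃ L : X → X, MeasurePreserving L μ μ ∧ ∀ᵐ x ∂μ, ∀ᶠ n in atTop, K n x = L x := by
  have hev : ∀ᵐ x ∂μ, ∃ y, ∀ᶠ n in atTop, K n x = y := by
    -- Borel–Cantelli: almost every point lies in only finitely many of the sets where a change
    -- occurs.
    filter_upwards [ae_eventually_notMem hsum] with x hx
    refine eventually_eq_const_of_eventually_succ ?_
    filter_upwards [hx] with n hn
    by_contra hc
    exact hn hc
  obtain ⟨L, hL, hlim⟩ := measurable_limit_of_tendsto_metrizable_ae (μ := μ) (L := atTop)
    (f := K) (fun n => (hK n).measurable.aemeasurable) (by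
      filter_upwards [hev] with x ⟨y, hy⟩
      exact ⟨y, tendsto_const_nhds.congr' (hy.mono fun n hn => hn.symm)⟩)
  have hL' : ∀ᵐ x ∂μ, ∀ᶠ n in atTop, K n x = L x := by
    filter_upwards [hev, hlim] with x ⟨y, hy⟩ hx
    have : y = L x := tendsto_nhds_unique
      (tendsto_const_nhds.congr' (hy.mono fun n hn => hn.symm)) hx
    exact this ▸ hy
  refine ⟨L, ⟨hL, ?_⟩, hL'⟩
  ext A hA
  rw [Measure.map_apply hL hA]
  have ht : Tendsto (fun n => μ (K n ⁻¹' A)) atTop (𝓝 (μ (L ⁻¹' A))) := by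
    refine tendsto_measure_of_ae_tendsto_indicator_of_isFiniteMeasure atTop (hL hA)
      (fun n => (hK n).measurable hA) ?_
    filter_upwards [hL'] with x hx
    filter_upwards [hx] with n hn
    rw [Set.mem_preimage, Set.mem_preimage, hn]
  refine tendsto_nhds_unique ht (tendsto_const_nhds.congr fun n => ?_)
  rw [(hK n).measure_preimage hA.nullMeasurableSet]

variable [SecondCountableTopology X]

theorem tendsto_measure_ne_zero {K : ℕ → X → X} {L : X → X}
    (hK : ∀ n, Measurable (K n)) (hL : Measurable L)
    (h : ∀ᵐ x ∂μ, ∀ᶠ n in atTop, K n x = L x) :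
    Tendsto (fun n => μ {x | K n x ≠ L x}) atTop (𝓝 0) := by
  have := tendsto_measure_of_ae_tendsto_indicator_of_isFiniteMeasure (μ := μ) (A := ∅)
    (As := fun n => {x | K n x ≠ L x}) atTop MeasurableSet.empty
    (fun n => (measurableSet_eq_fun (hK n) hL).compl) (by
      filter_upwards [h] with x hx
      filter_upwards [hx] with n hn
      simp [hn])
  rwa [measure_empty] at this

/-- If `K n` conjugates `T n` to `S n` up to `ι`, `K n → L` and `S n → S` pointwise and `T n → T'`
weakly, then `L` conjugates `T'` to `S`. -/
theorem ae_intertwines_of_tendsto {Y : Type*} [TopologicalSpace Y] [T1Space Y]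
    [SecondCountableTopology Y] [MeasurableSpace Y] [BorelSpace Y] {ι : X → Y} (hι : Measurable ι)
    {K T : ℕ → X → X} {L T' : X → X} {S : ℕ → Y → Y} {S' : Y → Y}
    (hK : ∀ n, Measurable (K n)) (hL : Measurable L)
    (hT : ∀ n, MeasurePreserving (T n) μ μ)
    (hKL : ∀ᵐ x ∂μ, ∀ᶠ n in atTop, K n x = L x)
    (hS : ∀ y, Tendsto (fun n => S n y) atTop (𝓝 (S' y)))
    (hKT : ∀ n x, ι (K n (T n x)) = S n (ι (K n x)))
    (hweak : ∀ A, MeasurableSet A → Tendsto (fun n => μ (T n ⁻¹' A \ T' ⁻¹' A)) atTop (𝓝 0)) :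
    ∀ᵐ x ∂μ, ι (L (T' x)) = S' (ι (L x)) := by
  have hlim : ∀ᵐ x ∂μ, Tendsto (fun n => ι (K n (T n x))) atTop (𝓝 (S' (ι (L x)))) := by
    filter_upwards [hKL] with x hx
    refine (hS (ι (L x))).congr' ?_
    filter_upwards [hx] with n hn
    rw [hKT, hn]
  -- Weak convergence says nothing about single points, so the two sides are compared through a
  -- countable base. An implication in one direction is enough to identify points of a T1 space.
  have hU : ∀ U ∈ TopologicalSpace.countableBasis Y,
      ∀ᵐ x ∂μ, S' (ι (L x)) ∈ U → ι (L (T' x)) ∈ U := by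
    intro U hU
    have hUo := TopologicalSpace.isOpen_of_mem_countableBasis hU
    set A : Set X := (fun x => ι (L x)) ⁻¹' U
    have hA : MeasurableSet A := (hι.comp hL) hUo.measurableSet
    -- Almost every point that violates the implication lies in `G n` for all large `n`, while `μ (G
    -- n)` tends to `0`: up to the set where `K n ≠ L`, pulled back by `T n`, weak convergence for
    -- `A` controls it.
    set G : ℕ → Set X := fun n => {x | ι (K n (T n x)) ∈ U} \ T' ⁻¹' A with hG
    have hGlim : Tendsto (fun n => μ (G n)) atTop (𝓝 0) := by
      have h1 := (tendsto_measure_ne_zero hK hL hKL).add (hweak A hA)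
      rw [add_zero] at h1
      refine tendsto_of_tendsto_of_tendsto_of_le_of_le tendsto_const_nhds h1
        (fun n => zero_le) fun n => ?_
      have h2 : μ {x | K n x ≠ L x} = μ (T n ⁻¹' {x | K n x ≠ L x}) :=
        ((hT n).measure_preimage (measurableSet_eq_fun (hK n) hL).compl.nullMeasurableSet).symm
      simp only
      rw [h2]
      refine (measure_mono ?_).trans (measure_union_le _ _)
      rintro x ⟨hx, hx'⟩
      by_cases hc : K n (T n x) = L (T n x)
      · right
        refine ⟨?_, hx'⟩
        change ι (L (T n x)) ∈ U
        rw [← hc]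
        exact hx
      · exact Or.inl hc
    have hnull : μ (⋃ N, ⋂ n ≥ N, G n) = 0 := by
      refine measure_iUnion_null fun N => ?_
      refine le_antisymm (ge_of_tendsto hGlim ?_) zero_le
      filter_upwards [eventually_ge_atTop N] with n hn
      exact measure_mono (Set.biInter_subset_of_mem hn)
    filter_upwards [hlim, measure_eq_zero_iff_ae_notMem.1 hnull] with x hx hx' hxU
    by_contra hc
    refine hx' ?_
    obtain ⟨N, hN⟩ := eventually_atTop.1 (hx.eventually_mem (hUo.mem_nhds hxU))
    exact Set.mem_iUnion.2 ⟨N, Set.mem_iInter₂.2 fun n hn => ⟨hN n hn, hc⟩⟩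
  have hU' := (ae_ball_iff (TopologicalSpace.countable_countableBasis Y)).2 hU
  filter_upwards [hU'] with x hx
  by_contra hc
  obtain ⟨U, hUb, hxU, hsub⟩ := (TopologicalSpace.isBasis_countableBasis Y).exists_subset_of_mem_open
    (show S' (ι (L x)) ∈ ({ι (L (T' x))} : Set Y)ᶜ from fun h => hc h.symm) isOpen_compl_singleton
  exact hsub (hx U hUb hxU) rfl

end Limits

/-! ### Isomorphism of the abstract and the smooth construction -/

/-- The product `f 0 * f 1 * ⋯ * f (n - 1)`. -/
def prodUpTo {G : Type*} [Monoid G] (f : ℕ → G) : ℕ → G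
  | 0 => 1
  | n + 1 => prodUpTo f n * f n

theorem prodUpTo_succ {G : Type*} [Monoid G] (f : ℕ → G) (n : ℕ) :
    prodUpTo f (n + 1) = prodUpTo f n * f n := rfl

theorem map_prodUpTo {G G' : Type*} [Monoid G] [Monoid G'] (φ : G →* G') (f : ℕ → G) (n : ℕ) :
    φ (prodUpTo f n) = prodUpTo (fun i => φ (f i)) n := by
  induction n with
  | zero => exact map_one φ
  | succ n ih => rw [prodUpTo_succ, map_mul, ih, prodUpTo_succ]

theorem prodUpTo_mem {G : Type*} [Group G] {S : Subgroup G} {f : ℕ → G} (hf : ∀ n, f n ∈ S)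
    (n : ℕ) : prodUpTo f n ∈ S := by
  induction n with
  | zero => exact one_mem _
  | succ n ih => exact mul_mem ih (hf n)

theorem TwistedAbC.H_eq_prodUpTo (P : TwistedAbC) (n : ℕ) : P.H n = prodUpTo P.h n := by
  induction n with
  | zero => rfl
  | succ n ih => rw [TwistedAbC.H, ih, prodUpTo_succ]

theorem smoothH_eq_prodUpTo {M : Surface} (hs : ℕ → Equiv.Perm M.Pt) (n : ℕ) :
    smoothH hs n = prodUpTo hs n := by
  induction n with
  | zero => rfl
  | succ n ih => rw [smoothH, ih, prodUpTo_succ]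

/-- Write `x` as the image of `y` under the product of `g 0, …, g n`. The two values are then the
images of `f n y` and `g n y` under one injective map, and the substitution preserves measure. -/
theorem measure_prodUpTo_ne {X : Type*} [MeasurableSpace X] {μ : Measure X}
    {f g : ℕ → Equiv.Perm X} (hg : ∀ n, g n ∈ mpGroup μ) (n : ℕ) :
    μ {x | (prodUpTo f (n + 1) * (prodUpTo g (n + 1))⁻¹) x ≠ (prodUpTo f n * (prodUpTo g n)⁻¹) x} =
      μ {x | f n x ≠ g n x} := by
  rw [← mpGroup_measure_preimage (inv_mem (prodUpTo_mem hg (n + 1))) {x | f n x ≠ g n x}]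
  congr 1
  ext x
  have e : (prodUpTo g n)⁻¹ x = g n ((prodUpTo g (n + 1))⁻¹ x) := by
    rw [prodUpTo_succ, mul_inv_rev, Equiv.Perm.mul_apply, perm_apply_inv_self]
  rw [Set.mem_preimage, Set.mem_ofPred_eq, Set.mem_ofPred_eq, Equiv.Perm.mul_apply,
    Equiv.Perm.mul_apply, e, prodUpTo_succ f, Equiv.Perm.mul_apply,
    (prodUpTo f n).injective.ne_iff]

/-- Convergence in the weak topology, in terms of preimages in the coordinate square. -/
theorem TwistedAbC.IsWeakLimit.tendsto_preimage {M : Surface} {P : TwistedAbC} {T : M.Pt ≃ᵐ M.Pt}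
    (hT : MeasurePreserving T M.vol M.vol) (hlim : P.IsWeakLimit M T) {κ : M.Pt → Sq}
    (hκ : MeasurePreserving κ M.vol Sq.vol) (hκι : ∀ᵐ x ∂Sq.vol, κ (M.param x) = x)
    (hικ : ∀ᵐ y ∂M.vol, M.param (κ y) = y) {A : Set Sq} (hA : MeasurableSet A) :
    Tendsto (fun n => Sq.vol (P.T n ⁻¹' A \ (fun x => κ (T (M.param x))) ⁻¹' A)) atTop (𝓝 0) := by
  have hι := M.measurePreserving_param
  have hT' : MeasurePreserving T.symm M.vol M.vol := hT.symm T
  set D : Set Sq := {x | κ (M.param x) = x}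
  have hD : MeasurableSet D := measurableSet_eq_fun (hκ.measurable.comp hι.measurable) measurable_id
  -- The weak limit is expressed by images under `param`, which need not be injective. Hence `B`
  -- keeps only points that `κ` recovers, together with all their images under the `P.T n`.
  set B : Set Sq := ((fun x => κ (T (M.param x))) ⁻¹' A ∩ D) ∩ ⋂ n, P.T n ⁻¹' D with hB
  have hTm : ∀ n, MeasurePreserving (P.T n) Sq.vol Sq.vol := fun n => (P.T_mem_mpGroup n).1
  have hBm : MeasurableSet B :=
    (((hκ.measurable.comp (T.measurable.comp hι.measurable)) hA).inter hD).inter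
      (MeasurableSet.iInter fun n => (hTm n).measurable hD)
  have hgood : ∀ᵐ x ∂Sq.vol, x ∈ D ∩ ⋂ n, P.T n ⁻¹' D := by
    have h1 : ∀ᵐ x ∂Sq.vol, ∀ n, P.T n x ∈ D :=
      ae_all_iff.2 fun n => (hTm n).quasiMeasurePreserving.ae hκι
    filter_upwards [hκι, h1] with x hx hx'
    exact ⟨hx, Set.mem_iInter.2 hx'⟩
  refine tendsto_of_tendsto_of_tendsto_of_le_of_le tendsto_const_nhds (hlim B hBm)
    (fun n => zero_le) fun n => ?_
  simp only
  set E := symmDiff (M.param '' (P.T n '' B)) (T '' (M.param '' B))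
  -- The set `E` is built from images and is not known to be measurable, so the inequality passes
  -- through a measurable hull.
  have hE : Sq.vol (M.param ⁻¹' E) ≤ M.vol E := by
    rw [← measure_toMeasurable E,
      ← hι.measure_preimage (measurableSet_toMeasurable M.vol E).nullMeasurableSet]
    exact measure_mono (Set.preimage_mono (subset_toMeasurable _ _))
  refine le_trans ?_ hE
  -- After transport by `P.T n` the set consists of points of `A`. Almost every such point has a
  -- `T`-preimage in `B` but is not the `P.T n`-image of a point of `B`, so its `param`-image lies
  -- in `E`.
  rw [← mpGroup_measure_preimage (inv_mem (P.T_mem_mpGroup n))]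
  have hz : MeasurePreserving (fun x => κ (T.symm (M.param x))) Sq.vol Sq.vol :=
    hκ.comp (hT'.comp hι)
  refine measure_mono_ae ?_
  filter_upwards [hκι, (hT'.comp hι).quasiMeasurePreserving.ae hικ,
    hz.quasiMeasurePreserving.ae hgood] with x hx hx2 hx3 hxA
  obtain ⟨hxA, hxB⟩ := hxA
  rw [Set.mem_preimage, perm_apply_inv_self] at hxA
  simp only [Function.comp_apply] at hx2
  set z := κ (T.symm (M.param x)) with hzdef
  right
  refine ⟨⟨M.param z, ⟨z, ⟨⟨?_, hx3.1⟩, hx3.2⟩, rfl⟩, ?_⟩, ?_⟩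
  · rw [Set.mem_preimage, hx2, T.apply_symm_apply, hx]
    exact hxA
  · rw [hx2, T.apply_symm_apply]
  · rintro ⟨w, ⟨u, hu, rfl⟩, hw⟩
    have h1 : κ (M.param (P.T n u)) = P.T n u := Set.mem_iInter.1 hu.2 n
    have h2 : P.T n u = x := by rw [← h1, hw, hx]
    refine hxB ?_
    rw [Set.mem_preimage, ← h2, perm_inv_apply_self]
    exact hu.1.1

/-- If the maps `f n` differ from the maps `h n` on sets of summable measure, and the conjugates of
the rotations by the partial products of `f` are given on the surface by a pointwise convergent
sequence, then its limit is isomorphic to the weak limit of the abstract construction. -/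
theorem TwistedAbC.IsWeakLimit.measureIsomorphic {M : Surface} {P : TwistedAbC} {T : M.Pt ≃ᵐ M.Pt}
    (hT : MeasurePreserving T M.vol M.vol) (hlim : P.IsWeakLimit M T) {f : ℕ → Equiv.Perm Sq}
    (hf : ∀ n, f n ∈ mpGroup Sq.vol) (hsum : ∑' n, Sq.vol {x | f n x ≠ P.h n x} ≠ ⊤)
    {Ts : ℕ → M.Pt → M.Pt} {Tlim : M.Pt → M.Pt}
    (hTs : ∀ n x, Ts n (M.param x) =
      M.param ((prodUpTo f n * sqRot (P.α n) * (prodUpTo f n)⁻¹) x))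
    (hconv : ∀ y, Tendsto (fun n => Ts n y) atTop (𝓝 (Tlim y))) :
    MeasureIsomorphic M.vol T M.vol Tlim := by
  obtain ⟨κ, hκ, hκι, hικ⟩ := M.exists_param_inverse
  have hι := M.measurePreserving_param
  -- This map conjugates `P.T n` to the conjugate of the same rotation by the partial product of
  -- `f`.
  set K : ℕ → Equiv.Perm Sq := fun n => prodUpTo f n * (prodUpTo P.h n)⁻¹ with hKdef
  have hh := P.h_mem_mpGroup
  have hK : ∀ n, K n ∈ mpGroup Sq.vol := fun n =>
    mul_mem (prodUpTo_mem hf n) (inv_mem (prodUpTo_mem hh n))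
  obtain ⟨L, hL, hKL⟩ := exists_measurePreserving_eventually_eq (μ := Sq.vol)
    (K := fun n => K n) (fun n => (hK n).1) (by
      simp only [hKdef, measure_prodUpTo_ne hh]
      exact hsum)
  -- Inverting `K n` exchanges the roles of `f` and `P.h`, so the inverses change on sets of the
  -- same measures.
  obtain ⟨L', hL', hKL'⟩ := exists_measurePreserving_eventually_eq (μ := Sq.vol)
    (K := fun n => ⇑(K n)⁻¹) (fun n => (hK n).2) (by
      simp only [hKdef, mul_inv_rev, inv_inv, measure_prodUpTo_ne hf]
      simpa only [ne_comm] using hsum)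
  have hLL' := ae_leftInverse_of_eventually_eq hL hKL hKL' fun n x => perm_inv_apply_self (K n) x
  have hL'L := ae_leftInverse_of_eventually_eq hL' hKL' hKL fun n x => perm_apply_inv_self (K n) x
  have hLT := ae_intertwines_of_tendsto (μ := Sq.vol) hι.measurable (K := fun n => K n)
    (T := fun n => P.T n) (T' := fun x => κ (T (M.param x))) (S := Ts) (S' := Tlim)
    (fun n => (hK n).1.measurable) hL.measurable (fun n => (P.T_mem_mpGroup n).1) hKL hconv
    (fun n x => by
      rw [hTs, ← Equiv.Perm.mul_apply, ← Equiv.Perm.mul_apply]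
      congr 2
      simp only [hKdef, TwistedAbC.T, P.H_eq_prodUpTo]
      group)
    (fun A hA => hlim.tendsto_preimage hT hκ hκι hικ hA)
  refine ⟨fun y => M.param (L (κ y)), fun y => M.param (L' (κ y)), hι.comp (hL.comp hκ),
    hι.comp (hL'.comp hκ), ?_, ?_, ?_⟩
  · filter_upwards [(hL.comp hκ).quasiMeasurePreserving.ae hκι, hκ.quasiMeasurePreserving.ae hLL',
      hικ] with y h1 h2 h3
    simp only [Function.comp_apply] at h1
    rw [h1, h2, h3]
  · filter_upwards [(hL'.comp hκ).quasiMeasurePreserving.ae hκι, hκ.quasiMeasurePreserving.ae hL'L,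
      hικ] with y h1 h2 h3
    simp only [Function.comp_apply] at h1
    rw [h1, h2, h3]
  · filter_upwards [hκ.quasiMeasurePreserving.ae hLT, hικ] with y h1 h2
    rw [← h1, h2]

/-! ### Continuity and invariance of measure on the surface -/

namespace Surface

theorem isQuotientMap_proj (M : Surface) : IsQuotientMap M.proj := by
  have hmk : IsOpenQuotientMap (fun x : ℝ => (x : UnitAddCircle)) :=
    QuotientAddGroup.isOpenQuotientMap_mk
  cases M
  · exact ((hmk.prodMap hmk).comp
      (Homeomorph.Set.univ (ℝ × ℝ)).isOpenQuotientMap).isQuotientMap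
  · let e : annulus.cover ≃ₜ ℝ × Set.Icc (0 : ℝ) 1 :=
      { toFun := fun x => ((x : ℝ × ℝ).1, ⟨(x : ℝ × ℝ).2, x.2⟩)
        invFun := fun y => ⟨(y.1, y.2), y.2.2⟩
        left_inv := fun x => rfl
        right_inv := fun y => rfl
        continuous_toFun := by
          refine Continuous.prodMk (by fun_prop) (Continuous.subtype_mk (by fun_prop) _)
        continuous_invFun := Continuous.subtype_mk (by fun_prop) _ }
    exact ((hmk.prodMap IsOpenQuotientMap.id).comp e.isOpenQuotientMap).isQuotientMap
  · exact (Homeomorph.refl {x : ℝ × ℝ // x.1 ^ 2 + x.2 ^ 2 ≤ 1}).isQuotientMap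

theorem continuous_descend (M : Surface) (L : M.liftGroup) : Continuous (M.descend L) := by
  rw [M.isQuotientMap_proj.continuous_iff]
  rw [show ⇑(M.descend L) ∘ M.proj = _ from funext (M.descend_proj L)]
  exact M.isQuotientMap_proj.continuous.comp
    (Continuous.subtype_mk (L.2.1.continuous.comp continuous_subtype_val) _)

theorem dist_coe_unitAddCircle_le (x y : ℝ) :
    dist (x : UnitAddCircle) (y : UnitAddCircle) ≤ dist x y := by
  rw [dist_eq_norm, dist_eq_norm, ← AddCircle.coe_sub]
  exact QuotientAddGroup.norm_mk_le_norm

theorem dist_proj_le (M : Surface) (x y : M.cover) :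
    dist (M.proj x) (M.proj y) ≤ dist (x : ℝ × ℝ) y := by
  cases M
  · exact max_le_max (dist_coe_unitAddCircle_le _ _) (dist_coe_unitAddCircle_le _ _)
  · exact max_le_max (dist_coe_unitAddCircle_le _ _) le_rfl
  · exact le_rfl

/-- A permutation of the surface is given by a permutation of the square in the coordinates. -/
def Models (M : Surface) (f : Equiv.Perm M.Pt) (g : Equiv.Perm Sq) : Prop :=
  ∀ x, f (M.param x) = M.param (g x)

variable {M : Surface} {f f' : Equiv.Perm M.Pt} {g g' : Equiv.Perm Sq}

theorem Models.mul (h : M.Models f g) (h' : M.Models f' g') : M.Models (f * f') (g * g') :=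
  fun x => by rw [Equiv.Perm.mul_apply, h', h, Equiv.Perm.mul_apply]

theorem Models.inv (h : M.Models f g) : M.Models f⁻¹ g⁻¹ := fun x => by
  rw [Equiv.Perm.inv_eq_iff_eq, h, perm_apply_inv_self]

theorem Models.prodUpTo {f : ℕ → Equiv.Perm M.Pt} {g : ℕ → Equiv.Perm Sq}
    (h : ∀ n, M.Models (f n) (g n)) (n : ℕ) : M.Models (prodUpTo f n) (prodUpTo g n) := by
  induction n with
  | zero => exact fun _ => rfl
  | succ n ih => exact ih.mul (h n)

theorem Models.measurePreserving (h : M.Models f g) (hf : Measurable f)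
    (hg : MeasurePreserving g Sq.vol Sq.vol) : MeasurePreserving f M.vol M.vol := by
  refine ⟨hf, ?_⟩
  conv_lhs => rw [← M.measurePreserving_param.map_eq, Measure.map_map hf M.measurable_param]
  rw [show ⇑f ∘ M.param = M.param ∘ g from funext h, ← Measure.map_map M.measurable_param
    hg.measurable, hg.map_eq, M.measurePreserving_param.map_eq]

theorem isAreaDiffeo_descend {L : M.liftGroup}
    (h : MeasurePreserving (M.descend L) M.vol M.vol) : M.IsAreaDiffeo (M.descend L) :=
  ⟨⟨_, M.isSmoothLift_descend L⟩, ⟨_, M.isSmoothLift_descend_symm L⟩, h⟩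

theorem models_descend_stripLift (M : Surface) {q : ℕ+} (F : stripGroup q) :
    M.Models (M.descend (M.stripLift F)) (stripGroup.toSq q F) := M.descend_stripLift_param F

theorem isAreaDiffeo_descend_stripLift (M : Surface) {q : ℕ+} (F : stripGroup q) :
    M.IsAreaDiffeo (M.descend (M.stripLift F)) :=
  isAreaDiffeo_descend ((M.models_descend_stripLift F).measurePreserving
    (M.continuous_descend _).measurable (stripGroup.measurePreserving_toSq F))

end Surface

/-- A continuous pointwise limit of measure-preserving transformations is measure-preserving. -/
theorem measurePreserving_of_tendsto {Y : Type*} [TopologicalSpace Y] [HasOuterApproxClosed Y]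
    [MeasurableSpace Y] [BorelSpace Y] {ν : Measure Y} [IsFiniteMeasure ν] {f : ℕ → Y → Y}
    {g : Y → Y} (hf : ∀ n, MeasurePreserving (f n) ν ν) (hg : Measurable g)
    (h : ∀ y, Tendsto (fun n => f n y) atTop (𝓝 (g y))) : MeasurePreserving g ν ν := by
  refine ⟨hg, ?_⟩
  have : IsFiniteMeasure (ν.map g) := Measure.isFiniteMeasure_map ν g
  refine ext_of_forall_integral_eq_of_IsFiniteMeasure fun φ => ?_
  have hφ := φ.continuous.measurable
  rw [integral_map hg.aemeasurable hφ.aestronglyMeasurable]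
  have ht : Tendsto (fun n => ∫ y, φ (f n y) ∂ν) atTop (𝓝 (∫ y, φ (g y) ∂ν)) := by
    refine tendsto_integral_of_dominated_convergence (fun _ => ‖φ‖)
      (fun n => (hφ.comp (hf n).measurable).aestronglyMeasurable) (integrable_const _)
      (fun n => Eventually.of_forall fun y => φ.norm_coe_le_norm _) ?_
    exact Eventually.of_forall fun y => (φ.continuous.tendsto _).comp (h y)
  refine tendsto_nhds_unique ht (tendsto_const_nhds.congr fun n => ?_)
  conv_lhs => rw [← (hf n).map_eq]
  rw [integral_map (hf n).measurable.aemeasurable hφ.aestronglyMeasurable]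

/-! ### Uniform distance of derivatives -/

/-- The derivatives of orders `0, …, k` of `F` and `G` differ by at most `C`. -/
def CkClose {E : Type*} [NormedAddCommGroup E] [NormedSpace ℝ E] (k : ℕ) (C : ℝ) (F G : E → E) :
    Prop :=
  ∀ j ≤ k, ∀ x, ‖iteratedFDeriv ℝ j (F - G) x‖ ≤ C

section CkClose

variable {E : Type*} [NormedAddCommGroup E] [NormedSpace ℝ E]

theorem CkClose.norm_sub_le {k : ℕ} {C : ℝ} {F G : E → E} (h : CkClose k C F G) (x : E) :
    ‖F x - G x‖ ≤ C := by
  have := h 0 (Nat.zero_le k) x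
  rwa [norm_iteratedFDeriv_zero] at this

theorem CkClose.mono {k k' : ℕ} {C C' : ℝ} {F G : E → E} (h : CkClose k C F G) (hk : k' ≤ k)
    (hC : C ≤ C') : CkClose k' C' F G :=
  fun j hj x => (h j (hj.trans hk) x).trans hC

theorem CkClose.symm {k : ℕ} {C : ℝ} {F G : E → E} (h : CkClose k C F G) : CkClose k C G F := by
  intro j hj x
  rw [← neg_sub F G, iteratedFDeriv_neg_apply, norm_neg]
  exact h j hj x

/-- A sequence of smooth maps whose successive distances in all `C^k` are summable has a smooth
limit. -/
theorem exists_limit_of_ckClose [CompleteSpace E] {f : ℕ → E → E} (hf : ∀ n, ContDiff ℝ ∞ (f n))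
    {δ : ℕ → ℝ} (hδ : Summable δ) (h : ∀ n, CkClose n (δ n) (f (n + 1)) (f n)) :
    ∃ g : E → E, ContDiff ℝ ∞ g ∧ ∀ n, CkClose n (∑' m, δ (m + n)) g (f n) := by
  have hsumx : ∀ x, Summable fun m => f (m + 1) x - f m x := fun x =>
    Summable.of_norm_bounded hδ fun m => (h m).norm_sub_le x
  set g : E → E := fun x => f 0 x + ∑' m, (f (m + 1) x - f m x) with hg
  have htail : ∀ n, g - f n = fun x => ∑' m, (f (m + n + 1) - f (m + n)) x := by
    intro n
    funext x
    have h1 := (hsumx x).sum_add_tsum_nat_add n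
    rw [Finset.sum_range_sub (fun m => f m x)] at h1
    simp only [hg, Pi.sub_apply]
    rw [← h1]
    abel
  have hδn : ∀ n, Summable fun m => δ (m + n) := fun n => (summable_nat_add_iff n).2 hδ
  have hcd : ∀ n m : ℕ, ContDiff ℝ ((n : ℕ∞) : WithTop ℕ∞) (f (m + n + 1) - f (m + n)) := fun n m =>
    ((hf _).sub (hf _)).of_le (by exact_mod_cast le_top)
  have hbd : ∀ (n k m : ℕ) (x : E), (k : ℕ∞) ≤ (n : ℕ∞) →
      ‖iteratedFDeriv ℝ k (f (m + n + 1) - f (m + n)) x‖ ≤ δ (m + n) := fun n k m x hk =>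
    h (m + n) k ((by exact_mod_cast hk : k ≤ n).trans (Nat.le_add_left n m)) x
  -- The step with index `m + n` is controlled up to order `m + n ≥ n`, so the tail `g - f n` is of
  -- class `C^n`; adding the smooth map `f n` shows that `g` is of class `C^n` for each `n`.
  refine ⟨g, contDiff_infty.2 fun n => ?_, fun n j hj x => ?_⟩
  · have h1 : ContDiff ℝ ((n : ℕ∞) : WithTop ℕ∞) (g - f n) := by
      rw [htail n]
      exact contDiff_tsum (N := (n : ℕ∞)) (v := fun _ m => δ (m + n)) (hcd n)
        (fun _ _ => hδn n) (hbd n)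
    have h2 := h1.add (contDiff_infty.1 (hf n) n)
    simp only [Pi.sub_apply, sub_add_cancel] at h2
    exact h2
  · rw [htail n, iteratedFDeriv_tsum_apply (N := (n : ℕ∞)) (v := fun _ m => δ (m + n)) (hcd n)
      (fun _ _ => hδn n) (hbd n) (by exact_mod_cast hj)]
    exact tsum_of_norm_bounded (hδn n).hasSum fun m => hbd n j m x (by exact_mod_cast hj)

/-- The section is a translate of `Φ` composed with the inclusion of the second factor. This makes
the derivatives in `x` jointly continuous in `(t, x)`, hence uniformly continuous on compact sets.
-/
theorem iteratedFDeriv_section {Φ : ℝ × E → E} (hΦ : ContDiff ℝ ∞ Φ) (j : ℕ) (t : ℝ) (x : E) :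
    iteratedFDeriv ℝ j (fun y => Φ (t, y)) x =
      (iteratedFDeriv ℝ j Φ (t, x)).compContinuousLinearMap
        fun _ => ContinuousLinearMap.inr ℝ ℝ E := by
  have hc : ContDiff ℝ ∞ fun z : ℝ × E => Φ ((t, 0) + z) := hΦ.comp (contDiff_const.add contDiff_id)
  have h1 := (ContinuousLinearMap.inr ℝ ℝ E).iteratedFDeriv_comp_right hc x (i := j)
    (by exact_mod_cast le_top)
  rw [iteratedFDeriv_comp_add_left] at h1
  have e1 : (fun z : ℝ × E => Φ ((t, 0) + z)) ∘ (ContinuousLinearMap.inr ℝ ℝ E) =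
      fun y => Φ (t, y) := by
    funext y
    simp
  have e2 : (t, (0 : E)) + (ContinuousLinearMap.inr ℝ ℝ E) x = (t, x) := by simp
  rw [e1, e2] at h1
  exact h1

theorem continuous_iteratedFDeriv_section {Φ : ℝ × E → E} (hΦ : ContDiff ℝ ∞ Φ) (j : ℕ) :
    Continuous fun p : ℝ × E => iteratedFDeriv ℝ j (fun y => Φ (p.1, y)) p.2 := by
  simp only [iteratedFDeriv_section hΦ]
  exact (ContinuousMultilinearMap.compContinuousLinearMapL
    fun _ : Fin j => ContinuousLinearMap.inr ℝ ℝ E).continuous.comp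
      (hΦ.continuous_iteratedFDeriv (by exact_mod_cast le_top))

/-- The derivatives of a smooth family of maps are uniformly continuous in the parameter on compact
sets. -/
theorem eventually_iteratedFDeriv_section_close {Φ : ℝ × E → E} (hΦ : ContDiff ℝ ∞ Φ) (j : ℕ)
    {K : Set E} (hK : IsCompact K) (a b : ℝ) {δ : ℝ} (hδ : 0 < δ) :
    ∀ᶠ N : ℕ in atTop, ∀ s ∈ Set.Icc a b, ∀ t ∈ Set.Icc a b, |s - t| ≤ 1 / (N : ℝ) → ∀ x ∈ K,
      ‖iteratedFDeriv ℝ j ((fun y => Φ (s, y)) - fun y => Φ (t, y)) x‖ ≤ δ := by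
  have hu := (isCompact_Icc (a := a) (b := b)).prod hK |>.uniformContinuousOn_of_continuous
    (continuous_iteratedFDeriv_section hΦ j).continuousOn
  obtain ⟨η, hη, hu⟩ := Metric.uniformContinuousOn_iff.1 hu δ hδ
  filter_upwards [tendsto_one_div_atTop_nhds_zero_nat.eventually_lt_const hη] with N hN s hs t ht hst
    x hx
  have hd : dist (s, x) (t, x) < η := by
    rw [Prod.dist_eq, dist_self, Real.dist_eq, max_eq_left (abs_nonneg _)]
    exact hst.trans_lt hN
  have h := hu (s, x) ⟨hs, hx⟩ (t, x) ⟨ht, hx⟩ hd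
  have hc : ∀ r : ℝ, ContDiffAt ℝ j (fun y => Φ (r, y)) x := fun r =>
    ((hΦ.comp (contDiff_const.prodMk contDiff_id)).of_le (by exact_mod_cast le_top)).contDiffAt
  rw [iteratedFDeriv_sub_apply (hc s) (hc t), ← dist_eq_norm]
  exact h.le

end CkClose

/-! ### Estimates and limits in the group of lifts -/

namespace Surface

/-- The difference of tame maps is doubly periodic or vanishes far out, so uniform bounds on one
ball suffice. Radius `2` covers both a unit square of periods and the region where lifts on the disk
may differ from the identity. -/
theorem exists_iteratedFDeriv_sub_eq (M : Surface) {L L' : ℝ × ℝ → ℝ × ℝ} (hL : M.Tame L)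
    (hL' : M.Tame L') (j : ℕ) (x : ℝ × ℝ) :
    (∃ y ∈ Metric.closedBall (0 : ℝ × ℝ) 2,
      iteratedFDeriv ℝ j (L - L') x = iteratedFDeriv ℝ j (L - L') y) ∨
      iteratedFDeriv ℝ j (L - L') x = 0 := by
  have hper : (∀ (m n : ℤ) (x : ℝ × ℝ), (L - L') (x + ((m : ℝ), (n : ℝ))) = (L - L') x) →
      ∃ y ∈ Metric.closedBall (0 : ℝ × ℝ) 2,
        iteratedFDeriv ℝ j (L - L') x = iteratedFDeriv ℝ j (L - L') y := by
    intro h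
    refine ⟨(Int.fract x.1, Int.fract x.2), ?_, ?_⟩
    · rw [mem_closedBall_zero_iff, Prod.norm_def]
      refine max_le ?_ ?_ <;>
      · rw [Real.norm_eq_abs, abs_of_nonneg (Int.fract_nonneg _)]
        exact (Int.fract_lt_one _).le.trans one_le_two
    · have e : x = (Int.fract x.1, Int.fract x.2) + ((⌊x.1⌋ : ℝ), (⌊x.2⌋ : ℝ)) := by
        ext
        · exact (Int.fract_add_floor _).symm
        · exact (Int.fract_add_floor _).symm
      conv_lhs => rw [e, ← iteratedFDeriv_comp_add_right]
      simp only [h]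
  cases M
  · exact Or.inl (hper fun m n x => by simp [hL m n x, hL' m n x])
  · exact Or.inl (hper fun m n x => by simp [hL m n x, hL' m n x])
  · by_cases hx : x ∈ Metric.closedBall (0 : ℝ × ℝ) 2
    · exact Or.inl ⟨x, hx, rfl⟩
    · right
      have ho : IsOpen {y : ℝ × ℝ | 2 < ‖y‖} := isOpen_lt continuous_const continuous_norm
      have hx' : 2 < ‖x‖ := by rwa [mem_closedBall_zero_iff, not_le] at hx
      have he : L - L' =ᶠ[𝓝 x] fun _ => 0 := by
        filter_upwards [ho.mem_nhds hx'] with y hy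
        rw [Pi.sub_apply, hL y hy, hL' y hy, sub_self]
      rw [he.iteratedFDeriv ℝ j |>.eq_of_nhds]
      rw [iteratedFDeriv_fun_zero]
      rfl

/-- The conjugate of a rotation. -/
noncomputable def conjRot (M : Surface) (W : M.liftGroup) (t : ℝ) : M.liftGroup :=
  W * M.rotL t * W⁻¹

theorem rotL_zero (M : Surface) : M.rotL 0 = 1 := by
  have h := M.rotL_add 0 0
  rw [add_zero] at h
  exact left_eq_mul.1 h

theorem rotL_neg (M : Surface) (t : ℝ) : M.rotL (-t) = (M.rotL t)⁻¹ := by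
  rw [eq_inv_iff_mul_eq_one, ← rotL_add, neg_add_cancel, rotL_zero]

theorem conjRot_inv (M : Surface) (W : M.liftGroup) (t : ℝ) :
    (M.conjRot W t)⁻¹ = M.conjRot W (-t) := by
  simp only [conjRot, rotL_neg]
  group

theorem conjRot_contDiff (M : Surface) (W : M.liftGroup) :
    ContDiff ℝ ∞ fun p : ℝ × (ℝ × ℝ) => (M.conjRot W p.1).1 p.2 :=
  W.2.1.comp (M.rotLift_contDiff.comp (contDiff_fst.prodMk (W.2.2.1.comp contDiff_snd)))

/-- Conjugates of rotations by a fixed map depend continuously on the angle. -/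
theorem eventually_ckClose_conjRot (M : Surface) (W : M.liftGroup) (k : ℕ) {δ : ℝ} (hδ : 0 < δ) :
    ∀ᶠ N : ℕ in atTop, ∀ s ∈ Set.Icc (-3 : ℝ) 3, ∀ t ∈ Set.Icc (-3 : ℝ) 3,
      |s - t| ≤ 1 / (N : ℝ) → CkClose k δ (M.conjRot W s).1 (M.conjRot W t).1 := by
  have h : ∀ᶠ N : ℕ in atTop, ∀ j ∈ Finset.range (k + 1), ∀ s ∈ Set.Icc (-3 : ℝ) 3,
      ∀ t ∈ Set.Icc (-3 : ℝ) 3, |s - t| ≤ 1 / (N : ℝ) → ∀ x ∈ Metric.closedBall (0 : ℝ × ℝ) 2,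
      ‖iteratedFDeriv ℝ j (⇑(M.conjRot W s).1 - ⇑(M.conjRot W t).1) x‖ ≤ δ :=
    (eventually_all_finset _).2 fun j _ => eventually_iteratedFDeriv_section_close
      (M.conjRot_contDiff W) j (isCompact_closedBall 0 2) (-3) 3 hδ
  filter_upwards [h] with N hN s hs t ht hst j hj x
  rcases M.exists_iteratedFDeriv_sub_eq (M.conjRot W s).2.2.2.2 (M.conjRot W t).2.2.2.2 j x with
    ⟨y, hy, e⟩ | e
  · rw [e]
    exact hN j (Finset.mem_range_succ_iff.2 hj) s hs t ht hst y hy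
  · rw [e, norm_zero]
    exact hδ.le

theorem isClosed_cover (M : Surface) : IsClosed M.cover := by
  cases M
  · exact isClosed_univ
  · exact isClosed_Icc.preimage continuous_snd
  · exact isClosed_disk

/-- Lets the derivatives within the cover in `IsCkBound` be computed as ordinary derivatives of
lifts defined on the whole plane. -/
theorem uniqueDiffOn_cover (M : Surface) : UniqueDiffOn ℝ M.cover := by
  cases M
  · exact uniqueDiffOn_univ
  · have h : annulus.cover = Set.univ ×ˢ Set.Icc (0 : ℝ) 1 := by
      ext x
      simp [cover]
    rw [h]
    exact uniqueDiffOn_univ.prod (uniqueDiffOn_Icc one_pos)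
  · refine uniqueDiffOn_convex (fun x hx y hy a b ha hb hab => ?_) ⟨0, ?_⟩
    · have hx' : x.1 ^ 2 + x.2 ^ 2 ≤ 1 := hx
      have hy' : y.1 ^ 2 + y.2 ^ 2 ≤ 1 := hy
      change (a * x.1 + b * y.1) ^ 2 + (a * x.2 + b * y.2) ^ 2 ≤ 1
      have h1 : (a * x.1 + b * y.1) ^ 2 + (a * x.2 + b * y.2) ^ 2 =
          (a + b) * (a * (x.1 ^ 2 + x.2 ^ 2) + b * (y.1 ^ 2 + y.2 ^ 2)) -
            a * b * ((x.1 - y.1) ^ 2 + (x.2 - y.2) ^ 2) := by ring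
      have h2 : 0 ≤ a * b * ((x.1 - y.1) ^ 2 + (x.2 - y.2) ^ 2) := by positivity
      have h3 := mul_le_mul_of_nonneg_left hx' ha
      have h4 := mul_le_mul_of_nonneg_left hy' hb
      rw [h1, hab]
      linarith
    · refine interior_maximal (t := {x : ℝ × ℝ | x.1 ^ 2 + x.2 ^ 2 < 1})
        (fun x (hx : x.1 ^ 2 + x.2 ^ 2 < 1) => hx.le)
        (isOpen_lt (by fun_prop) continuous_const) ?_
      simp

theorem isCkBound_descend (M : Surface) {L L' : M.liftGroup} {k : ℕ} {C : ℝ}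
    (h : CkClose k C L.1 L'.1) : M.IsCkBound k (M.descend L) (M.descend L') C := by
  refine ⟨fun p => ?_, L.1, L'.1, M.isSmoothLift_descend L, M.isSmoothLift_descend L',
    fun j _ hj x hx => ?_⟩
  · obtain ⟨x, rfl⟩ := M.proj_surjective p
    rw [descend_proj, descend_proj]
    refine (M.dist_proj_le _ _).trans ?_
    rw [dist_eq_norm]
    exact h.norm_sub_le _
  · have hc : ∀ L : M.liftGroup, ContDiffAt ℝ j L.1 x := fun L =>
      (L.2.1.of_le (by exact_mod_cast le_top)).contDiffAt
    rw [iteratedFDerivWithin_eq_iteratedFDeriv M.uniqueDiffOn_cover (hc L) hx,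
      iteratedFDerivWithin_eq_iteratedFDeriv M.uniqueDiffOn_cover (hc L') hx,
      ← iteratedFDeriv_sub_apply (hc L) (hc L')]
    exact h j hj x

theorem dC_nonneg (M : Surface) (k : ℕ) (f g : Equiv.Perm M.Pt) : 0 ≤ M.dC k f g :=
  Real.sInf_nonneg fun _ h => h.1

theorem dC_descend_le (M : Surface) {L L' : M.liftGroup} {k : ℕ} {C : ℝ}
    (h : CkClose k C L.1 L'.1) (h' : CkClose k C (L⁻¹).1 (L'⁻¹).1) :
    M.dC k (M.descend L) (M.descend L') ≤ C := by
  refine csInf_le ⟨0, fun _ h => h.1⟩ ⟨(norm_nonneg _).trans (h.norm_sub_le 0),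
    M.isCkBound_descend h, ?_⟩
  have h2 := M.isCkBound_descend h'
  rwa [map_inv, map_inv] at h2

/-- The first `k` terms are at most `C` times weights of total mass at most `1`; in the remaining
terms the quotient `d / (1 + d)` is at most `1`, and the weights add up to `2⁻ᵏ`. -/
theorem dInf_descend_le (M : Surface) {L L' : M.liftGroup} {k : ℕ} {C : ℝ}
    (h : CkClose k C L.1 L'.1) (h' : CkClose k C (L⁻¹).1 (L'⁻¹).1) :
    M.dInf (M.descend L) (M.descend L') ≤ C + (1 / 2) ^ k := by
  have hC : 0 ≤ C := (norm_nonneg _).trans (h.norm_sub_le 0)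
  set d : ℕ → ℝ := fun i => M.dC (i + 1) (M.descend L) (M.descend L') with hd
  have hd0 : ∀ i, 0 ≤ d i := fun i => M.dC_nonneg _ _ _
  set u : ℕ → ℝ := fun i => d i / (2 ^ (i + 1) * (1 + d i)) with hu
  have hgeo : HasSum (fun i : ℕ => (1 / 2 : ℝ) ^ (i + 1)) 1 := by
    have h2 := hasSum_geometric_two.mul_left (1 / 2 : ℝ)
    rw [one_div_mul_cancel two_ne_zero] at h2
    simpa only [pow_succ'] using h2
  have hgeo' : HasSum (fun i : ℕ => (1 / 2 : ℝ) ^ (i + k + 1)) ((1 / 2) ^ k) := by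
    have := hgeo.mul_right ((1 / 2 : ℝ) ^ k)
    rw [one_mul] at this
    refine this.congr_fun fun i => ?_
    ring
  have hfac : ∀ i, u i = (1 / 2) ^ (i + 1) * (d i / (1 + d i)) := fun i => by
    have := hd0 i
    simp only [hu]
    rw [div_pow, one_pow]
    field_simp
  have hu1 : ∀ i, u i ≤ (1 / 2) ^ (i + 1) := fun i => by
    have := hd0 i
    rw [hfac]
    refine mul_le_of_le_one_right (by positivity) ?_
    rw [div_le_one (by positivity)]
    linarith
  have huC : ∀ i < k, u i ≤ (1 / 2) ^ (i + 1) * C := fun i hi => by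
    have := hd0 i
    rw [hfac]
    refine mul_le_mul_of_nonneg_left ?_ (by positivity)
    refine (div_le_self this (by linarith)).trans ?_
    exact M.dC_descend_le (h.mono hi le_rfl) (h'.mono hi le_rfl)
  have hu0 : ∀ i, 0 ≤ u i := fun i => by
    have := hd0 i
    simp only [hu]
    positivity
  have hus : Summable u := Summable.of_nonneg_of_le hu0 hu1 hgeo.summable
  change ∑' i, u i ≤ _
  rw [← hus.sum_add_tsum_nat_add k]
  refine add_le_add ?_ ?_
  · calc ∑ i ∈ Finset.range k, u i ≤ ∑ i ∈ Finset.range k, (1 / 2 : ℝ) ^ (i + 1) * C :=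
          Finset.sum_le_sum fun i hi => huC i (Finset.mem_range.1 hi)
      _ = (∑ i ∈ Finset.range k, (1 / 2 : ℝ) ^ (i + 1)) * C := (Finset.sum_mul _ _ _).symm
      _ ≤ 1 * C := mul_le_mul_of_nonneg_right
          (hgeo.summable.sum_le_tsum _ (fun i _ => by positivity) |>.trans_eq hgeo.tsum_eq) hC
      _ = C := one_mul C
  · rw [← hgeo'.tsum_eq]
    exact ((summable_nat_add_iff k).2 hus).tsum_le_tsum (fun i => hu1 _) hgeo'.summable

theorem Tame.of_tendsto {M : Surface} {f : ℕ → ℝ × ℝ → ℝ × ℝ} {g : ℝ × ℝ → ℝ × ℝ}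
    (hf : ∀ n, M.Tame (f n)) (h : ∀ x, Tendsto (fun n => f n x) atTop (𝓝 (g x))) : M.Tame g := by
  cases M
  · exact fun m n x => tendsto_nhds_unique (h _)
      (((h x).add_const _).congr fun i => (hf i m n x).symm)
  · exact fun m n x => tendsto_nhds_unique (h _)
      (((h x).add_const _).congr fun i => (hf i m n x).symm)
  · exact fun x hx => tendsto_nhds_unique (h x) (tendsto_const_nhds.congr fun i => (hf i x hx).symm)

/-- Completeness of the group of lifts. -/
theorem exists_liftGroup_limit (M : Surface) {Ψ : ℕ → M.liftGroup} {δ : ℕ → ℝ} (hδ : Summable δ)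
    (h : ∀ n, CkClose n (δ n) (Ψ (n + 1)).1 (Ψ n).1)
    (h' : ∀ n, CkClose n (δ n) ((Ψ (n + 1))⁻¹).1 ((Ψ n)⁻¹).1) :
    ∃ L : M.liftGroup, ∀ n, CkClose n (∑' m, δ (m + n)) L.1 (Ψ n).1 ∧
      CkClose n (∑' m, δ (m + n)) (L⁻¹).1 ((Ψ n)⁻¹).1 := by
  obtain ⟨g, hg, hgc⟩ := exists_limit_of_ckClose (fun n => (Ψ n).2.1) hδ h
  obtain ⟨g', hg', hgc'⟩ := exists_limit_of_ckClose (fun n => ((Ψ n)⁻¹).2.1) hδ h'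
  have h0 : Tendsto (fun n => ∑' m, δ (m + n)) atTop (𝓝 0) := tendsto_sum_nat_add δ
  have hlim : ∀ {u : ℕ → ℝ × ℝ → ℝ × ℝ} {v : ℝ × ℝ → ℝ × ℝ},
      (∀ n, CkClose n (∑' m, δ (m + n)) v (u n)) → ∀ y : ℕ → ℝ × ℝ,
      Tendsto (fun n => u n (y n) - v (y n)) atTop (𝓝 0) := fun huv y =>
    squeeze_zero_norm (fun n => (huv n).symm.norm_sub_le (y n)) h0
  have hpt : ∀ {u : ℕ → ℝ × ℝ → ℝ × ℝ} {v : ℝ × ℝ → ℝ × ℝ},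
      (∀ n, CkClose n (∑' m, δ (m + n)) v (u n)) → ∀ x, Tendsto (fun n => u n x) atTop (𝓝 (v x)) :=
    fun {u v} huv x => by
      have := (hlim huv fun _ => x).add_const (v x)
      simpa using this
  -- Left inverses pass to the limit: `w n - z` tends to `0` uniformly, hence also along the moving
  -- points `u n x`, and `z` is continuous.
  have hinv : ∀ {u w : ℕ → ℝ × ℝ → ℝ × ℝ} {v z : ℝ × ℝ → ℝ × ℝ},
      (∀ n, CkClose n (∑' m, δ (m + n)) v (u n)) → (∀ n, CkClose n (∑' m, δ (m + n)) z (w n)) →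
      Continuous z → (∀ n x, w n (u n x) = x) → ∀ x, z (v x) = x := fun {u w v z} huv hwz hz hwu x => by
    have h1 := (hlim hwz fun n => u n x).add ((hz.tendsto _).comp (hpt huv x))
    simp only [Function.comp_apply, sub_add_cancel, hwu, zero_add] at h1
    exact (tendsto_nhds_unique h1 tendsto_const_nhds)
  have hl := hinv hgc hgc' hg'.continuous fun n x => perm_inv_apply_self (Ψ n).1 x
  have hr := hinv hgc' hgc hg.continuous fun n x => perm_apply_inv_self (Ψ n).1 x
  have hcov : ∀ {v : ℝ × ℝ → ℝ × ℝ} {u : ℕ → M.liftGroup},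
      (∀ n, CkClose n (∑' m, δ (m + n)) v (u n).1) → ∀ x ∈ M.cover, v x ∈ M.cover :=
    fun {v u} huv x hx => M.isClosed_cover.mem_of_tendsto (hpt huv x)
      (Eventually.of_forall fun n => ((u n).2.2.2.1 x).2 hx)
  refine ⟨⟨⟨g, g', hl, hr⟩, hg, hg', fun x => ⟨fun hx => ?_, hcov hgc x⟩,
    Tame.of_tendsto (fun n => (Ψ n).2.2.2.2) (hpt hgc)⟩, fun n => ⟨hgc n, hgc' n⟩⟩
  rw [← hl x]
  exact hcov (u := fun n => (Ψ n)⁻¹) hgc' _ hx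

end Surface

/-! ### The angles -/

namespace AbCParams

variable (P : AbCParams)

theorem q_succ (n : ℕ) : P.q (n + 1) = P.k n * P.l n * P.q n ^ 2 := rfl

theorem q_succ_coe (n : ℕ) : (P.q (n + 1) : ℚ) = (P.k n : ℚ) * (P.l n : ℚ) * (P.q n : ℚ) ^ 2 := by
  rw [q_succ]
  push_cast
  ring

theorem α_succ (n : ℕ) : P.α (n + 1) = P.α n + 1 / (P.q (n + 1) : ℚ) := by
  rw [q_succ_coe]
  rfl

/-- The bound on `l_n` does not receive `q_n` as an argument; this inequality leaves finitely many
values of `q_n` once `k_n` is given. -/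
theorem q_le_k (n : ℕ) : P.q n ≤ P.k n := by
  rw [k, mul_right_comm, mul_comm]
  exact le_mul_of_one_le_right' one_le

theorem two_pow_le_q (n : ℕ) : 2 ^ (n + 1) ≤ (P.q (n + 1) : ℕ) := by
  have h1 : (2 : ℕ+) ^ (n + 2) ≤ P.k n := by
    rw [k, mul_assoc]
    exact le_mul_of_one_le_right' one_le
  have h2 : P.k n ≤ P.q (n + 1) := by
    rw [q_succ, mul_assoc]
    exact le_mul_of_one_le_right' one_le
  have h3 : ((2 ^ (n + 2) : ℕ+) : ℕ) ≤ (P.q (n + 1) : ℕ) := h1.trans h2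
  rw [PNat.pow_coe] at h3
  exact (Nat.pow_le_pow_right two_pos (Nat.le_succ _)).trans h3

theorem l_le_q (n : ℕ) : (P.l n : ℕ) ≤ (P.q (n + 1) : ℕ) := by
  have h : P.l n ≤ P.q (n + 1) := by
    rw [q_succ, mul_right_comm, mul_comm]
    exact le_mul_of_one_le_right' one_le
  exact h

theorem exists_α_eq (n : ℕ) : ∃ p : ℤ, P.α n = p / (P.q n : ℚ) := by
  induction n with
  | zero => exact ⟨P.α₀.num, (Rat.num_div_den P.α₀).symm⟩
  | succ n ih =>
    obtain ⟨p, hp⟩ := ih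
    refine ⟨p * (P.k n * P.l n * P.q n : ℕ) + 1, ?_⟩
    have h1 : (P.k n : ℚ) ≠ 0 := by exact_mod_cast (P.k n).ne_zero
    have h2 : (P.l n : ℚ) ≠ 0 := by exact_mod_cast (P.l n).ne_zero
    have h3 : (P.q n : ℚ) ≠ 0 := by exact_mod_cast (P.q n).ne_zero
    rw [α_succ, hp, q_succ_coe]
    push_cast
    field_simp

/-- The increments `1 / q_{n+1}` are at most `2^{-(n+1)}`, so the angles drift by less than `1` in
total. -/
theorem α_mem (n : ℕ) : P.α₀ ≤ P.α n ∧ P.α n ≤ P.α₀ + 1 - (1 / 2) ^ n := by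
  induction n with
  | zero => simp [α]
  | succ n ih =>
    have h : (0 : ℚ) < 2 ^ (n + 1) := by positivity
    have h1 : (2 : ℚ) ^ (n + 1) ≤ (P.q (n + 1) : ℚ) := by exact_mod_cast P.two_pow_le_q n
    have h2 : 1 / (P.q (n + 1) : ℚ) ≤ (1 / 2) ^ (n + 1) := by
      rw [div_pow, one_pow]
      exact one_div_le_one_div_of_le h h1
    have h3 : 0 ≤ 1 / (P.q (n + 1) : ℚ) := by positivity
    have h4 : (1 / 2 : ℚ) ^ n = 2 * (1 / 2) ^ (n + 1) := by
      rw [pow_succ]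
      ring
    rw [α_succ]
    constructor <;> linarith [ih.1, ih.2]

/-- The angle `α_n`, normalized modulo `1`. -/
noncomputable def angle (n : ℕ) : ℝ := (P.α n : ℝ) - ⌊P.α₀⌋

/-- One compact interval serves all constructions, whatever `α₀` is; uniform continuity in the angle
can therefore be used before the construction is known. -/
theorem angle_mem (n : ℕ) : P.angle n ∈ Set.Icc (0 : ℝ) 3 := by
  obtain ⟨h1, h2⟩ := P.α_mem n
  have h3 : (0 : ℚ) ≤ (1 / 2) ^ n := by positivity
  have h4 := Int.floor_le P.α₀
  have h5 := (Int.lt_floor_add_one P.α₀).le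
  have a1 : (0 : ℚ) ≤ P.α n - ⌊P.α₀⌋ := by linarith
  have a2 : P.α n - ⌊P.α₀⌋ ≤ (3 : ℚ) := by linarith
  constructor
  · have : ((0 : ℚ) : ℝ) ≤ ((P.α n - ⌊P.α₀⌋ : ℚ) : ℝ) := by exact_mod_cast a1
    simpa [angle] using this
  · have : ((P.α n - ⌊P.α₀⌋ : ℚ) : ℝ) ≤ ((3 : ℚ) : ℝ) := by exact_mod_cast a2
    simpa [angle] using this

theorem angle_succ_sub (n : ℕ) : P.angle (n + 1) - P.angle n = 1 / (P.q (n + 1) : ℝ) := by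
  rw [angle, angle, α_succ]
  push_cast
  ring

theorem abs_angle_sub_le (n : ℕ) : |P.angle (n + 1) - P.angle n| ≤ 1 / ((P.l n : ℕ) : ℝ) := by
  rw [angle_succ_sub, abs_of_nonneg (by positivity)]
  have h : (0 : ℝ) < ((P.l n : ℕ) : ℝ) := by exact_mod_cast (P.l n).pos
  exact one_div_le_one_div_of_le h (by exact_mod_cast P.l_le_q n)

theorem exists_angle_eq (n : ℕ) : ∃ p : ℤ, P.angle n = p * (1 / (P.q n : ℝ)) := by
  obtain ⟨p, hp⟩ := P.exists_α_eq n
  have h3 : (P.q n : ℝ) ≠ 0 := by exact_mod_cast (P.q n).ne_zero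
  refine ⟨p - ⌊P.α₀⌋ * (P.q n : ℕ), ?_⟩
  rw [angle, hp]
  push_cast
  field_simp

end AbCParams

/-! ### The smooth conjugation maps -/

open Classical in
/-- A diffeomorphism of the strip that agrees with `g` off a set of measure less than `2⁻ⁿ`, if
there is one. -/
noncomputable def stripApprox (q : ℕ+) (g : Equiv.Perm Sq) (n : ℕ) : stripGroup q :=
  if h : ∃ F : stripGroup q, Sq.vol {x | stripGroup.toSq q F x ≠ g x} < 2⁻¹ ^ n then h.choose else 1

theorem vol_stripApprox_ne_lt {q : ℕ+} {g : Equiv.Perm Sq} (hg : g ∈ approxGroup q) (n : ℕ) :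
    Sq.vol {x | stripGroup.toSq q (stripApprox q g n) x ≠ g x} < 2⁻¹ ^ n := by
  have h : ∃ F : stripGroup q, Sq.vol {x | stripGroup.toSq q F x ≠ g x} < 2⁻¹ ^ n :=
    hg _ (ENNReal.pow_pos (by simp) n)
  rw [stripApprox, dif_pos h]
  exact h.choose_spec

namespace Surface

/-- The lifts of the smooth approximations of partition permutations with given numbers of cells. -/
def approxLifts (M : Surface) (k s : ℕ+) (n : ℕ) : Set M.liftGroup :=
  ⋃ q ∈ Set.Iic k, Set.range
    fun π : Equiv.Perm ((Fin q × Fin k) × Fin s) × Equiv.Perm ((Fin q × Fin k) × Fin s) =>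
      M.stripLift (stripApprox q (cellPerm q k s π.1 * cellPerm q k s π.2) n)

/-- The approximant is a fixed choice depending only on `q`, the permutation and `n`, and both `q ≤
k` and the pair of cell permutations range over finite sets. -/
theorem finite_approxLifts (M : Surface) (k s : ℕ+) (n : ℕ) : (M.approxLifts k s n).Finite :=
  (Set.finite_Iic k).biUnion fun _ _ => Set.finite_range _

theorem rotL_int_mul (M : Surface) (m : ℤ) (t : ℝ) : M.rotL (m * t) = M.rotL t ^ m := by
  let φ : Multiplicative ℝ →* M.liftGroup :=
    { toFun := fun t => M.rotL t.toAdd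
      map_one' := M.rotL_zero
      map_mul' := fun s t => M.rotL_add s.toAdd t.toAdd }
  have h := map_zpow φ (Multiplicative.ofAdd t) m
  rw [← ofAdd_zsmul, zsmul_eq_mul] at h
  exact h

theorem rot_int (M : Surface) (m : ℤ) : M.rot m = 1 := by
  have h0 : ((m : ℝ) : UnitAddCircle) = 0 := by
    rw [← AddCircle.coe_zero, coe_unitAddCircle_eq_iff]
    exact ⟨m, by simp⟩
  refine Equiv.ext fun p => ?_
  cases M
  · refine Prod.ext ?_ rfl
    change p.1 + ((m : ℝ) : UnitAddCircle) = p.1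
    rw [h0, add_zero]
  · refine Prod.ext ?_ rfl
    change p.1 + ((m : ℝ) : UnitAddCircle) = p.1
    rw [h0, add_zero]
  · exact Subtype.ext (planeRot_int m p.1)

theorem rot_sub_int (M : Surface) (t : ℝ) (m : ℤ) : M.rot (t - m) = M.rot t := by
  have h : t - m = t + ((-m : ℤ) : ℝ) := by push_cast; ring
  rw [← descend_rotL, h, rotL_add, map_mul, descend_rotL, descend_rotL, rot_int, mul_one]

theorem conjRot_mul_of_commute (M : Surface) {W f : M.liftGroup} {t : ℝ}
    (h : Commute f (M.rotL t)) : M.conjRot (W * f) t = M.conjRot W t := by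
  simp only [conjRot, mul_inv_rev]
  rw [mul_assoc W f, h.eq]
  group

end Surface

/-! ### The smooth sequence and the bounds `l_n^*` -/

namespace TwistedAbC

variable (M : Surface) (P : TwistedAbC)

/-- The diffeomorphism of the strip that approximates `h n`. -/
noncomputable def approx (n : ℕ) : stripGroup (P.q n) := stripApprox (P.q n) (P.h n) n

/-- The lift of the smooth conjugation map `H_n`. -/
noncomputable def liftH (n : ℕ) : M.liftGroup := prodUpTo (fun i => M.stripLift (P.approx i)) n

theorem liftH_succ (n : ℕ) : P.liftH M (n + 1) = P.liftH M n * M.stripLift (P.approx n) := rfl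

theorem stripLift_approx_mem (n : ℕ) :
    M.stripLift (P.approx n) ∈ M.approxLifts (P.k n) (P.s (n + 1)) n :=
  Set.mem_biUnion (P.q_le_k n) ⟨(P.untwistedIndex n (P.σ n), P.twistIndex n), rfl⟩

/-- Only finitely many maps can occur as `H_n` once the numbers of cells are given. -/
theorem finite_liftH (k s : ℕ → ℕ+) (n : ℕ) : {W : M.liftGroup | ∃ P : TwistedAbC,
    (∀ i < n, P.k i = k i) ∧ (∀ i < n, P.s (i + 1) = s (i + 1)) ∧ P.liftH M n = W}.Finite := by
  induction n with
  | zero =>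
    refine (Set.finite_singleton (1 : M.liftGroup)).subset ?_
    rintro _ ⟨P, -, -, rfl⟩
    rfl
  | succ n ih =>
    refine (Set.Finite.image2 (fun a b => a * b) ih
      (M.finite_approxLifts (k n) (s (n + 1)) n)).subset ?_
    rintro _ ⟨P, hk, hs, rfl⟩
    refine ⟨P.liftH M n, ⟨P, fun i hi => hk i (hi.trans n.lt_succ_self),
      fun i hi => hs i (hi.trans n.lt_succ_self), rfl⟩, M.stripLift (P.approx n), ?_, rfl⟩
    rw [← hk n n.lt_succ_self, ← hs n n.lt_succ_self]
    exact P.stripLift_approx_mem M n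

/-- The lift of the smooth transformation `T_n`. -/
noncomputable def liftT (n : ℕ) : M.liftGroup := M.conjRot (P.liftH M n) (P.angle n)

/-- The new factor of `H_{n+1}` commutes with `R_{1/q_n}`, and the angle is an integer multiple of
`1/q_n`. After this rewriting `T_n` and `T_{n+1}` differ only in the angle of rotation. -/
theorem liftT_eq (n : ℕ) : P.liftT M n = M.conjRot (P.liftH M (n + 1)) (P.angle n) := by
  obtain ⟨p, hp⟩ := P.exists_angle_eq n
  rw [liftH_succ, M.conjRot_mul_of_commute, liftT]
  rw [hp, M.rotL_int_mul]
  exact (M.stripLift_commute (P.approx n)).zpow_right p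

/-- The distance bound imposed on the step from `T_n` to `T_{n+1}`. -/
noncomputable def stepBound (n : ℕ) (ε : ℝ) : ℝ := min (ε / 16) ((1 / 2) ^ n)

/-- The order of the derivatives controlled in the step from `T_n` to `T_{n+1}`. -/
def IsStepOrder (n : ℕ) (ε : ℝ) (K : ℕ) : Prop := n ≤ K ∧ (1 / 2 : ℝ) ^ K ≤ ε / 16

/-- For `l_n` larger than a number that depends only on the numbers of cells and on `ε`, the step
from `T_n` to `T_{n+1}` is small. -/
theorem exists_threshold {n : ℕ} (k : Fin (n + 1) → ℕ+) (s : Fin (n + 2) → ℕ+) {ε : ℝ}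
    (hε : 0 < ε) : ∃ N : ℕ, ∀ P : TwistedAbC, (∀ i : Fin (n + 1), P.k i = k i) →
      (∀ i : Fin (n + 2), P.s i = s i) → N ≤ (P.l n : ℕ) → ∃ K, IsStepOrder n ε K ∧
      CkClose K (stepBound n ε) (P.liftT M (n + 1)).1 (P.liftT M n).1 ∧
      CkClose K (stepBound n ε) ((P.liftT M (n + 1))⁻¹).1 ((P.liftT M n)⁻¹).1 := by
  obtain ⟨K₀, hK₀⟩ := exists_pow_lt_of_lt_one (show 0 < ε / 16 by positivity)
    (show (1 / 2 : ℝ) < 1 by norm_num)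
  set K := max n K₀
  have hK : IsStepOrder n ε K := ⟨le_max_left _ _,
    (pow_le_pow_of_le_one (by norm_num) (by norm_num) (le_max_right _ _)).trans hK₀.le⟩
  have hδ : 0 < stepBound n ε := lt_min (by positivity) (by positivity)
  -- The default value `1` is never read: `H_{n+1}` involves only `k_i` with `i ≤ n` and `s_i` with
  -- `i ≤ n + 1`.
  have hfin := finite_liftH M (fun i => if h : i < n + 1 then k ⟨i, h⟩ else 1)
    (fun i => if h : i < n + 2 then s ⟨i, h⟩ else 1) (n + 1)
  -- A single `N` works for the finitely many possible conjugating maps, so it does not depend on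
  -- the construction.
  obtain ⟨N, hN⟩ := eventually_atTop.1 ((eventually_all_finite hfin).2 fun W _ =>
    M.eventually_ckClose_conjRot W K hδ)
  refine ⟨N, fun P hk hs hl => ⟨K, hK, ?_⟩⟩
  have hmem := hN _ hl (P.liftH M (n + 1)) ⟨P, fun i hi => by
    rw [dif_pos hi]
    exact hk ⟨i, hi⟩, fun i hi => by
    rw [dif_pos (Nat.succ_lt_succ hi)]
    exact hs ⟨i + 1, Nat.succ_lt_succ hi⟩, rfl⟩
  have hd := P.abs_angle_sub_le n
  obtain ⟨a1, a2⟩ := P.angle_mem n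
  obtain ⟨b1, b2⟩ := P.angle_mem (n + 1)
  rw [P.liftT_eq M n, liftT]
  constructor
  · exact hmem _ ⟨by linarith, b2⟩ _ ⟨by linarith, a2⟩ hd
  -- The inverses are conjugates of rotations by the opposite angles; this is why the continuity
  -- estimate covers `[-3, 3]`.
  · rw [M.conjRot_inv, M.conjRot_inv]
    refine hmem _ ⟨by linarith, by linarith⟩ _ ⟨by linarith, by linarith⟩ ?_
    rwa [neg_sub_neg, abs_sub_comm]

open Classical in
/-- The bounds `l_n^*`. -/
noncomputable def lstar (n : ℕ) (k : Fin (n + 1) → ℕ+) (s : Fin (n + 2) → ℕ+)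
    (ε : Fin (n + 1) → ℝ) : ℕ :=
  if hε : 0 < ε (Fin.last n) then (exists_threshold M k s hε).choose else 0

theorem exists_ckClose_of_lstar_le {ε : ℕ → ℝ} (hε : ∀ n, 0 < ε n) {n : ℕ}
    (h : lstar M n (fun i => P.k i) (fun i => P.s i) (fun i => ε i) ≤ (P.l n : ℕ)) :
    ∃ K, IsStepOrder n (ε n) K ∧
      CkClose K (stepBound n (ε n)) (P.liftT M (n + 1)).1 (P.liftT M n).1 ∧
      CkClose K (stepBound n (ε n)) ((P.liftT M (n + 1))⁻¹).1 ((P.liftT M n)⁻¹).1 := by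
  have hε' : 0 < (fun i : Fin (n + 1) => ε i) (Fin.last n) := hε n
  rw [lstar, dif_pos hε'] at h
  exact (exists_threshold M _ _ hε').choose_spec P (fun _ => rfl) (fun _ => rfl) h

/-- The smooth map that approximates `h n`. -/
noncomputable def smoothMap (n : ℕ) : Equiv.Perm M.Pt := M.descend (M.stripLift (P.approx n))

theorem descend_liftT (n : ℕ) : M.descend (P.liftT M n) =
    prodUpTo (P.smoothMap M) n * M.rot (P.α n) * (prodUpTo (P.smoothMap M) n)⁻¹ := by
  rw [liftT, Surface.conjRot, map_mul, map_mul, map_inv, liftH, map_prodUpTo, M.descend_rotL,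
    AbCParams.angle, M.rot_sub_int]
  rfl

theorem isSmoothAbC_descend_liftT :
    IsSmoothAbC P.toAbCParams M fun n => M.descend (P.liftT M n) := by
  refine ⟨P.smoothMap M, fun n => M.isAreaDiffeo_descend_stripLift _, fun n => ?_, fun n => ?_⟩
  · have h := (M.stripLift_commute (P.approx n)).map M.descend
    rw [M.descend_rotL] at h
    exact h
  · rw [smoothH_eq_prodUpTo]
    exact P.descend_liftT M n

theorem models_descend_liftT (n : ℕ) : M.Models (M.descend (P.liftT M n))
    (prodUpTo (fun i => stripGroup.toSq (P.q i) (P.approx i)) n * sqRot (P.α n) *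
      (prodUpTo (fun i => stripGroup.toSq (P.q i) (P.approx i)) n)⁻¹) := by
  have h := Surface.Models.prodUpTo (f := P.smoothMap M)
    (fun i => M.models_descend_stripLift (P.approx i)) n
  rw [descend_liftT]
  exact (h.mul (fun x => M.rot_param _ x)).mul h.inv

theorem measurePreserving_descend_liftT (n : ℕ) :
    MeasurePreserving (M.descend (P.liftT M n)) M.vol M.vol := by
  have h := prodUpTo_mem (fun i => stripGroup.toSq_mem_mpGroup (P.approx i)) n
  exact (P.models_descend_liftT M n).measurePreserving (M.continuous_descend _).measurable
    (mul_mem (mul_mem h (sqRot_mem_mpGroup _)) (inv_mem h)).1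

theorem tsum_vol_ne_top :
    ∑' n, Sq.vol {x | stripGroup.toSq (P.q n) (P.approx n) x ≠ P.h n x} ≠ ⊤ := by
  refine ne_top_of_le_ne_top ?_ (ENNReal.tsum_le_tsum fun n =>
    (vol_stripApprox_ne_lt (P.h_mem_approxGroup n) n).le)
  rw [ENNReal.tsum_geometric]
  simp

end TwistedAbC

theorem proposition45 (M : Surface) :
    ∃ lstar : (n : ℕ) → (Fin (n + 1) → ℕ+) → (Fin n → ℕ+) → (Fin (n + 2) → ℕ+) →
        (Fin (n + 1) → ℝ) → ℕ,
      ∀ ε : ℕ → ℝ, (∀ n, 0 < ε n) → Summable ε →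
        (∀ n, ∑' m, ε (n + 1 + m) < ε n / 4) →
      ∀ (P : TwistedAbC) (T : M.Pt ≃ᵐ M.Pt), MeasurePreserving T M.vol M.vol →
        P.IsWeakLimit M T →
        (∀ n, lstar n (fun i => P.k i) (fun i => P.l i) (fun i => P.s i) (fun i => ε i)
          ≤ (P.l n : ℕ)) →
      ∃ Ts : ℕ → Equiv.Perm M.Pt, IsSmoothAbC P.toAbCParams M Ts ∧
        (∀ n, M.dInf (Ts n) (Ts (n + 1)) < ε n / 4) ∧
        ∃ Tlim : Equiv.Perm M.Pt, M.IsAreaDiffeo Tlim ∧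
          Tendsto (fun n => M.dInf (Ts n) Tlim) atTop (𝓝 0) ∧
          MeasureIsomorphic M.vol T M.vol Tlim := by
  refine ⟨fun n k _ s ε => TwistedAbC.lstar M n k s ε, ?_⟩
  intro ε hε _ _ P T hT hlim hl
  have hstep := fun n => P.exists_ckClose_of_lstar_le M hε (hl n)
  set δ : ℕ → ℝ := fun n => TwistedAbC.stepBound n (ε n)
  have hδ0 : ∀ n, 0 ≤ δ n := fun n => le_min (by linarith [hε n]) (by positivity)
  have hδ : Summable δ := Summable.of_nonneg_of_le hδ0 (fun n => min_le_right _ _)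
    summable_geometric_two
  -- The order controlled at step `n` is at least `n`, and the step bounds are at most `2⁻ⁿ`, so the
  -- lifts converge in every `C^k`.
  obtain ⟨L, hL⟩ := M.exists_liftGroup_limit (Ψ := P.liftT M) hδ
    (fun n => by
      obtain ⟨K, hK, h, -⟩ := hstep n
      exact h.mono hK.1 le_rfl)
    (fun n => by
      obtain ⟨K, hK, -, h⟩ := hstep n
      exact h.mono hK.1 le_rfl)
  have h0 : Tendsto (fun n => ∑' m, δ (m + n)) atTop (𝓝 0) := tendsto_sum_nat_add δ
  have hconv : ∀ y, Tendsto (fun n => M.descend (P.liftT M n) y) atTop (𝓝 (M.descend L y)) :=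
    fun y => tendsto_iff_dist_tendsto_zero.2 (squeeze_zero (fun _ => dist_nonneg)
      (fun n => (M.isCkBound_descend (hL n).1.symm).1 y) h0)
  refine ⟨fun n => M.descend (P.liftT M n), P.isSmoothAbC_descend_liftT M, fun n => ?_,
    M.descend L, Surface.isAreaDiffeo_descend ?_, ?_, ?_⟩
  · obtain ⟨K, hK, h, h'⟩ := hstep n
    -- The derivatives up to order `K` contribute at most `ε n / 16`, the higher orders at most `2⁻ᴷ
    -- ≤ ε n / 16`.
    have h1 := M.dInf_descend_le h.symm h'.symm
    have h2 : TwistedAbC.stepBound n (ε n) ≤ ε n / 16 := min_le_left _ _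
    linarith [hε n, hK.2]
  · exact measurePreserving_of_tendsto (fun n => P.measurePreserving_descend_liftT M n)
      (M.continuous_descend L).measurable hconv
  · have h1 : Tendsto (fun n : ℕ => ∑' m, δ (m + n) + (1 / 2 : ℝ) ^ n) atTop (𝓝 0) := by
      simpa using h0.add (tendsto_pow_atTop_nhds_zero_of_lt_one (r := (1 / 2 : ℝ))
        (by norm_num) (by norm_num))
    refine squeeze_zero (fun n => tsum_nonneg fun k => ?_)
      (fun n => M.dInf_descend_le (hL n).1.symm (hL n).2.symm) h1
    have := M.dC_nonneg (k + 1) (M.descend (P.liftT M n)) (M.descend L)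
    positivity
  · exact hlim.measureIsomorphic hT (fun n => stripGroup.toSq_mem_mpGroup (P.approx n))
      P.tsum_vol_ne_top (fun n => P.models_descend_liftT M n) hconv
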